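/- Let $\mathcal F$ be the set of finite words over $\{0,1\}$ that begin and end with $0$. An infinite word $V\in\{0,1\}^{\mathbb N}$ is \emph{built from} $v\in\mathcal F$ if $V=v1^{a_1}v1^{a_2}v\cdots$ for some natural numbers $a_i\ge 0$; $V$ is \emph{rank-1} if it is built from infinitely many $v\in\mathcal F$, and a rank-1 word is \emph{degenerate} if $V=vvv\cdots$ for some nonempty finite word $v$. Let $\mathcal R$ be the set of non-degenerate rank-1 words, with the topology generated by the sets $\{V\in\mathcal R: V\text{ is built from }v\}$, $v\in\mathcal F$. The rank-1 system of $V$ is $X_V=\{x\in\{0,1\}^{\mathbb Z}:\text{every finite subword of }x\text{ is a subword of }V\}$ with the shift $\sigma(x)(i)=x(i+1)$. Words $V,W\in\mathcal R$ are \emph{isomorphic} if there is a homeomorphism $X_V\to X_W$ that commutes with $\sigma$. Let $E_0$ be the relation of eventual agreement on $\{0,1\}^{\mathbb N}$: $xE_0y$ iff there is $n$ with $x(m)=y(m)$ for all $m>n$. \textbf{Theorem.} The space $\mathcal R$ is Polish, and the isomorphism relation on $\mathcal R$ is Borel bi-reducible with $E_0$. More precisely: (1) For $\alpha\in\{0,1\}^{\mathbb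 N}$ let $v_0=0$, let $v_{m+1}=v_m1v_mv_m$ if $\alpha(m)=0$ and $v_{m+1}=v_mv_m1v_m$ if $\alpha(m)=1$, and let $V_\alpha$ be the infinite word of which every $v_m$ is an initial segment. Then $V_\alpha\in\mathcal R$ for every $\alpha$, and $\alpha\mapsto V_\alpha$ is a continuous reduction of $E_0$ to the isomorphism relation on $\mathcal R$. (2) The isomorphism relation on $\mathcal R$ is hyperfinite, that is, it is the union of an increasing sequence of Borel equivalence relations on $\mathcal R$ all of whose classes are finite; and it is Borel reducible to $E_0$. Moreover, the isomorphism relation is an $F_\sigma$ subset of $\mathcal R\times\mathcal R$. -/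

import Mathlib

open Set Topology

/-!
Letters: `false` is the symbol 0 and `true` is the symbol 1.  Finite words are elements of
`List Bool`, infinite words of `ℕ → Bool`, bi-infinite words of `ℤ → Bool`.
-/

/-! ### Finite and infinite words -/

/-- The set `𝓕` of finite words that begin and end with 0. -/
def zeroWords : Set (List Bool) :=
  {v | v.head? = some false ∧ v.getLast? = some false}

/-- `u` is an initial segment of the infinite word `V`. -/
def IsInitialSegment (u : List Bool) (V : ℕ → Bool) : Prop :=
  ∀ (i : ℕ) (h : i < u.length), u[i] = V i

/-- `u` is a (finite) subword of the infinite word `V`. -/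
def IsSubword (u : List Bool) (V : ℕ → Bool) : Prop :=
  ∃ k : ℕ, ∀ (i : ℕ) (h : i < u.length), u[i] = V (k + i)

/-- `u` is a (finite) subword of the bi-infinite word `x`. -/
def IsBiSubword (u : List Bool) (x : ℤ → Bool) : Prop :=
  ∃ k : ℤ, ∀ (i : ℕ) (h : i < u.length), u[i] = x (k + (i : ℤ))

/-- The finite word `v 1^{a 0} v 1^{a 1} ⋯ v 1^{a (n-1)}`. -/
def spacedWord (v : List Bool) (a : ℕ → ℕ) : ℕ → List Bool
  | 0 => []
  | n + 1 => spacedWord v a n ++ v ++ List.replicate (a n) true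

/-- `V` is built from `v ∈ 𝓕`: `V = v 1^{a 0} v 1^{a 1} v ⋯` for some sequence `a` of natural
numbers. -/
def BuiltFrom (V : ℕ → Bool) (v : List Bool) : Prop :=
  v ∈ zeroWords ∧ ∃ a : ℕ → ℕ, ∀ n, IsInitialSegment (spacedWord v a n) V

/-- `V` is rank-1: it is built from infinitely many words of `𝓕`. -/
def IsRankOne (V : ℕ → Bool) : Prop :=
  {v | BuiltFrom V v}.Infinite

/-- `V` is degenerate: `V = vvv⋯` for some nonempty finite word `v` (not required to be
in `𝓕`). -/
def IsDegenerate (V : ℕ → Bool) : Prop :=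
  ∃ v : List Bool, v ≠ [] ∧ ∀ n, IsInitialSegment (List.replicate n v).flatten V

/-! ### The space of non-degenerate rank-1 words -/

/-- The set `𝓡'` of all rank-1 words.  (A `def`, so that it does not carry the topology
of `ℕ → Bool`.) -/
def RankOneWord : Type := {V : ℕ → Bool // IsRankOne V}

/-- The underlying infinite word. -/
def RankOneWord.word (V : RankOneWord) : ℕ → Bool := V.1

/-- The topology on `𝓡'` generated by the sets `A^v = {V | V is built from v}`, `v ∈ 𝓕`. -/
instance : TopologicalSpace RankOneWord :=
  TopologicalSpace.generateFrom
    {A | ∃ v ∈ zeroWords, A = {V : RankOneWord | BuiltFrom V.word v}}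

/-- The space `𝓡` of non-degenerate rank-1 words, with the subspace topology from `𝓡'`. -/
abbrev NondegenerateRankOneWord : Type := {V : RankOneWord // ¬ IsDegenerate V.word}

/-! ### Rank-1 systems and topological isomorphism -/

/-- The bi-infinite words all of whose finite subwords are subwords of `V`. -/
def systemCarrier (V : ℕ → Bool) : Set (ℤ → Bool) :=
  {x | ∀ u : List Bool, IsBiSubword u x → IsSubword u V}

theorem isClosed_systemCarrier (V : ℕ → Bool) : IsClosed (systemCarrier V) := by
  have h : systemCarrier V = ⋂ (u : List Bool) (_ : ¬ IsSubword u V) (k : ℤ),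
      (⋂ (i : ℕ) (h : i < u.length), {x : ℤ → Bool | u[i] = x (k + (i : ℤ))})ᶜ := by
    ext x
    simp only [systemCarrier, IsBiSubword, mem_ofPred_eq, mem_iInter, mem_compl_iff]
    constructor
    · intro hx u hu k hk
      exact hu (hx u ⟨k, hk⟩)
    · rintro hx u ⟨k, hk⟩
      by_contra hu
      exact hx u hu k hk
  rw [h]
  refine isClosed_iInter fun u => isClosed_iInter fun _ => isClosed_iInter fun k => ?_
  rw [isClosed_compl_iff]
  have hfin : (⋂ (i : ℕ) (h : i < u.length), {x : ℤ → Bool | u[i] = x (k + (i : ℤ))})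
      = ⋂ i : Fin u.length, {x : ℤ → Bool | u[i.1] = x (k + (i.1 : ℤ))} := by
    ext x
    simp only [mem_iInter, mem_ofPred_eq]
    exact ⟨fun hx i => hx i.1 i.2, fun hx i hi => hx ⟨i, hi⟩⟩
  rw [hfin]
  refine isOpen_iInter_of_finite fun i => ?_
  exact (isOpen_discrete {b : Bool | u[i.1] = b}).preimage (continuous_apply (k + (i.1 : ℤ)))

theorem mapsTo_shift_systemCarrier (V : ℕ → Bool) (g : ℤ) :
    MapsTo (SymbolicDynamics.FullShift.shift g) (systemCarrier V) (systemCarrier V) := by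
  rintro x hx u ⟨k, hk⟩
  refine hx u ⟨g + k, fun i hi => ?_⟩
  rw [hk i hi, SymbolicDynamics.FullShift.shift_apply, add_assoc]

/-- The system `X` associated to the word `V`, as a subshift of `{0,1}^ℤ`. -/
def wordSystem (V : ℕ → Bool) : SymbolicDynamics.FullShift.Subshift Bool ℤ where
  carrier := systemCarrier V
  isClosed := isClosed_systemCarrier V
  mapsTo := mapsTo_shift_systemCarrier V

/-- The shift map `σ`, `σ x i = x (1 + i)`, on a subshift of `{0,1}^ℤ`. -/
def subshiftMap (X : SymbolicDynamics.FullShift.Subshift Bool ℤ) : X.carrier → X.carrier :=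
  (X.mapsTo 1).restrict

/-- Topological isomorphism of subshifts: there is a homeomorphism commuting with the shifts. -/
def SubshiftIsomorphic (X Y : SymbolicDynamics.FullShift.Subshift Bool ℤ) : Prop :=
  ∃ φ : X.carrier ≃ₜ Y.carrier, Function.Semiconj φ (subshiftMap X) (subshiftMap Y)

/-- The topological isomorphism relation on `𝓡`: the associated rank-1 systems are
topologically isomorphic. -/
def rankOneIso (V W : NondegenerateRankOneWord) : Prop :=
  SubshiftIsomorphic (wordSystem V.1.word) (wordSystem W.1.word)

/-! ### Descriptive set theory -/

/-- The relation `E₀` of eventual agreement on `{0,1}^ℕ`. -/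
def eventualAgreement (x y : ℕ → Bool) : Prop := ∃ n, ∀ m > n, x m = y m

/-- `f` is a reduction of `E` to `F`. -/
def IsReduction {X Y : Type*} (E : X → X → Prop) (F : Y → Y → Prop) (f : X → Y) : Prop :=
  ∀ x y, E x y ↔ F (f x) (f y)

/-- `E` is Borel reducible to `F`. -/
def BorelReducible {X Y : Type*} [TopologicalSpace X] [TopologicalSpace Y]
    (E : X → X → Prop) (F : Y → Y → Prop) : Prop :=
  ∃ f : X → Y, @Measurable X Y (borel X) (borel Y) f ∧ IsReduction E F f

/-- `E` and `F` are Borel bi-reducible. -/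
def BorelBireducible {X Y : Type*} [TopologicalSpace X] [TopologicalSpace Y]
    (E : X → X → Prop) (F : Y → Y → Prop) : Prop :=
  BorelReducible E F ∧ BorelReducible F E

/-- A finite Borel equivalence relation: an equivalence relation that is a Borel subset of
`X × X` and all of whose classes are finite. -/
structure IsFiniteBorelEquivalence {X : Type*} [TopologicalSpace X]
    (E : X → X → Prop) : Prop where
  equivalence : Equivalence E
  borel : @MeasurableSet (X × X) (borel (X × X)) {p : X × X | E p.1 p.2}
  finite : ∀ x, {y | E x y}.Finite

/-- Hyperfiniteness: `E` is the union of an increasing sequence of finite Borel equivalence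
relations. -/
def IsHyperfinite {X : Type*} [TopologicalSpace X] (E : X → X → Prop) : Prop :=
  ∃ F : ℕ → X → X → Prop,
    (∀ k, IsFiniteBorelEquivalence (F k)) ∧
    (∀ k x y, F k x y → F (k + 1) x y) ∧
    ∀ x y, E x y ↔ ∃ k, F k x y

/-- A countable union of closed sets. -/
def IsFSigma {X : Type*} [TopologicalSpace X] (S : Set X) : Prop :=
  ∃ C : ℕ → Set X, (∀ k, IsClosed (C k)) ∧ S = ⋃ k, C k

/-- The words `v_m` produced by `α ∈ {0,1}^ℕ`: `v_0 = 0`, and `v_{m+1}` is `v_m 1 v_m v_m` if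
`α m = 0` and `v_m v_m 1 v_m` if `α m = 1`. -/
def stageWord (α : ℕ → Bool) : ℕ → List Bool
  | 0 => [false]
  | m + 1 =>
    if α m = false then stageWord α m ++ [true] ++ stageWord α m ++ stageWord α m
    else stageWord α m ++ stageWord α m ++ [true] ++ stageWord α m

/-!
A word built from a block `v` is described by the set of places where the copies of `v` start. Such
a set of starting positions is called a base of the word (`IsBase`); the copies are the tiles of a
tiling (`IsTiling`). A non-degenerate rank-1 word has infinitely many bases. Given one of them, all
but finitely many bases are contained in it (`exists_subset_of_long`): if a long initial segment of
the word occurred off the given tiling, the overlap would force that segment, and in the end the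
word, to be periodic (`IsBlock.overlap_iterate`).

Two words of the space have isomorphic systems if and only if they have a common base
(`isomorphic_iff`). If they do, then both systems are isomorphic to the system of sequences of tile
positions, since the tiling of each point of the system is unique. Conversely, an isomorphism
respects asymptotic pairs of points. Where two distinct asymptotic points cease to differ, tiles of
all levels start (`allTiles_of_asymptotic`); so, up to a fixed shift, an isomorphism maps beginnings
of long tiles to beginnings of long tiles, and by symmetry ends to ends
(`exists_tiling_correspondence`). If the system contains the fixed point of all ones, the points
with ones on a half-line take the place of asymptotic pairs.

Having a common base is an F-sigma condition, because for two given blocks it is closed, by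
compactness of the space of sets of positions. For hyperfiniteness and the reduction to `E₀`, every
base but the largest, which consists of all zeros, is assigned a parent: among the bases that
contain it and have a smaller first gap (the least positive element), the one with the largest first
gap. The sequence of all parents is a code of the word (`parentCode`). Bases contained in a common
base are common bases (`isBase_of_subset`), so words with a common base have codes that eventually
agree (`exists_parentBit_iff`). Words whose codes agree from a given stage on have a common base
with a bounded first gap (`exists_common_base_of_parentBit`): descend along the parents and use the
pigeonhole principle. A word has finitely many bases with a bounded first gap and each of them is a
base of finitely many words with a bounded block (`finite_common_base`), so agreement from a fixed
stage on is an equivalence relation with finite classes.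

The space is Polish because it embeds as a `Gδ` set by sending a word `V` to `V` together with the
set of finite words from which it is built.

In the reduction of `E₀`, the first gap of the base formed by stage `m` depends on `α m`. If the
words of `α` and `β` have a common base, then for large `m` the base formed by stage `m` of either
word is a base of both, and so `α m = β m`; if `α` and `β` agree from some stage on, then the copies
of that stage start at the same places in both words.
-/

/-! ### Tilings of bi-infinite words -/

/-- `(h, f)` is a block: a finite word of length `h` with letters `f 0, …, f (h - 1)` that begins
and ends with 0.  The values of `f` outside `[0, h)` are irrelevant. -/
structure IsBlock (h : ℤ) (f : ℤ → Bool) : Prop where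
  pos : 0 < h
  first : f 0 = false
  last : f (h - 1) = false

/-- `P` is the set of starting positions of disjoint occurrences of the block `(h, f)` in `x` that
cover all the zeros of `x`. -/
structure IsTiling (h : ℤ) (f : ℤ → Bool) (x : ℤ → Bool) (P : Set ℤ) : Prop where
  occ : ∀ p ∈ P, ∀ i, 0 ≤ i → i < h → x (p + i) = f i
  cover : ∀ i, x i = false → ∃ p ∈ P, p ≤ i ∧ i < p + h
  disj : ∀ p ∈ P, ∀ q ∈ P, p < q → p + h ≤ q

theorem IsTiling.occ' {h : ℤ} {f x : ℤ → Bool} {P : Set ℤ} (hP : IsTiling h f x P) {p : ℤ}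
    (hp : p ∈ P) {j : ℤ} (h1 : p ≤ j) (h2 : j < p + h) : x j = f (j - p) := by
  have := hP.occ p hp (j - p) (by omega) (by omega)
  rwa [show p + (j - p) = j by ring] at this

theorem IsTiling.start_zero {h : ℤ} {f x : ℤ → Bool} {P : Set ℤ} (hb : IsBlock h f)
    (hP : IsTiling h f x P) {p : ℤ} (hp : p ∈ P) : x p = false := by
  have := hP.occ p hp 0 le_rfl hb.pos
  rw [add_zero] at this
  rw [this, hb.first]

theorem IsTiling.end_zero {h : ℤ} {f x : ℤ → Bool} {P : Set ℤ} (hb : IsBlock h f)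
    (hP : IsTiling h f x P) {p : ℤ} (hp : p ∈ P) : x (p + h - 1) = false := by
  have := hP.occ p hp (h - 1) (by have := hb.pos; omega) (by omega)
  rw [show p + h - 1 = p + (h - 1) by ring, this, hb.last]

theorem IsTiling.shift {h : ℤ} {f x : ℤ → Bool} {P : Set ℤ} (hP : IsTiling h f x P) (k : ℤ) :
    IsTiling h f (fun i => x (i + k)) {p | p + k ∈ P} where
  occ p hp i h0 h1 := by
    have := hP.occ (p + k) hp i h0 h1
    rwa [show p + k + i = p + i + k by ring] at this
  cover i hi := by
    obtain ⟨p, hp, h1, h2⟩ := hP.cover (i + k) hi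
    exact ⟨p - k, by simpa using hp, by omega, by omega⟩
  disj p hp q hq hpq := by
    have := hP.disj _ hp _ hq (by omega)
    omega

/-- A block `f` of length `e + b + c` whose suffix of length `b + c` is `1 ^ b` followed by its
prefix of length `c`, and which has period `b + c`, has `1 ^ b` at the places from `c` on: both
prefix and suffix of length `b + c` contain the same number of zeros. -/
theorem ones_of_rotation {f : ℤ → Bool} {c b e : ℕ}
    (h1 : ∀ i : ℕ, i < e → f ((c + b : ℕ) + i) = f i)
    (h2 : ∀ j : ℕ, j < b → f (e + j) = true)
    (h3 : ∀ j : ℕ, j < c → f (e + b + j) = f j) :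
    ∀ j : ℕ, j < b → f (c + j) = true := by
  let g : ℕ → ℕ := fun i => if f i = true then 0 else 1
  have e1 : ∑ i ∈ Finset.range (c + b + e), g i
      = ∑ i ∈ Finset.range c, g i + ∑ i ∈ Finset.range b, g (c + i)
        + ∑ i ∈ Finset.range e, g i := by
    rw [Finset.sum_range_add, Finset.sum_range_add]
    congr 1
    refine Finset.sum_congr rfl fun i hi => ?_
    have := h1 i (Finset.mem_range.1 hi)
    simp only [g]
    rw [← this]
    push_cast
    rfl
  have e2 : ∑ i ∈ Finset.range (e + b + c), g i
      = ∑ i ∈ Finset.range e, g i + ∑ i ∈ Finset.range c, g i := by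
    rw [Finset.sum_range_add, Finset.sum_range_add]
    have z : ∑ i ∈ Finset.range b, g (e + i) = 0 := by
      refine Finset.sum_eq_zero fun i hi => ?_
      have := h2 i (Finset.mem_range.1 hi)
      simp only [g]
      push_cast
      rw [if_pos this]
    rw [z, add_zero]
    congr 1
    refine Finset.sum_congr rfl fun i hi => ?_
    have := h3 i (Finset.mem_range.1 hi)
    simp only [g]
    rw [← this]
    push_cast
    rfl
  -- The block is the prefix of length `c`, then `b` letters, then the prefix of length `e`; it is
  -- also the prefix of length `e`, then `b` ones, then the prefix of length `c`.
  have e3 : ∑ i ∈ Finset.range b, g (c + i) = 0 := by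
    have : c + b + e = e + b + c := by ring
    rw [this, e2] at e1
    omega
  intro j hj
  have := (Finset.sum_eq_zero_iff.1 e3) j (Finset.mem_range.2 hj)
  simp only [g] at this
  push_cast at this
  by_contra hne
  rw [if_neg hne] at this
  exact one_ne_zero this

/-- If two tilings by the same block overlap at a distance `0 < d < h`, then in both of them the
gap up to the next tile is the number `b` of ones following the place `h - d` of the block; hence
the next tiles overlap at the same distance.  This is only a matter of the letters at
`[p, p + 2h)`. -/
theorem IsTiling.overlap_step {h : ℤ} {f x x' : ℤ → Bool} {P Q : Set ℤ} (hb : IsBlock h f)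
    (hP : IsTiling h f x P) (hQ : IsTiling h f x' Q) {p q b : ℤ} (hq : q ∈ P) (hp : p ∈ Q)
    (h1 : q < p) (h2 : p < q + h) (hb0 : 0 ≤ b)
    (hb1 : ∀ j, 0 ≤ j → j < b → f (h - (p - q) + j) = true)
    (hb2 : f (h - (p - q) + b) = false) (hbd : b < p - q)
    (agree : ∀ i, p ≤ i → i < p + 2 * h → x i = x' i) :
    q + h + b ∈ P ∧ p + h + b ∈ Q := by
  have hpos := hb.pos
  have hz : x (q + h + b) = false := by
    rw [agree _ (by omega) (by omega), hQ.occ' hp (by omega) (by omega), ← hb2]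
    congr 1; ring
  obtain ⟨q', hq', a1, a2⟩ := hP.cover _ hz
  have hqq' : q < q' := by
    rcases lt_trichotomy q q' with c | c | c
    · exact c
    · omega
    · have := hP.disj _ hq' _ hq c; omega
  have a3 := hP.disj _ hq _ hq' hqq'
  have a4 : q' = q + h + b := by
    by_contra hne
    have z := hP.start_zero hb hq'
    rw [agree _ (by omega) (by omega), hQ.occ' hp (by omega) (by omega)] at z
    have := hb1 (q' - q - h) (by omega) (by omega)
    rw [show h - (p - q) + (q' - q - h) = q' - p by ring, z] at this
    exact absurd this (by decide)
  have hfd : f (p - q) = false := by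
    rw [← hP.occ' hq (by omega) (by omega), agree _ (by omega) (by omega)]
    exact hQ.start_zero hb hp
  have key : ∀ j, 0 ≤ j → j < b → f (p - q - b + j) = true := by
    obtain ⟨c, hc⟩ := Int.eq_ofNat_of_zero_le (show 0 ≤ p - q - b by omega)
    obtain ⟨b', hb'⟩ := Int.eq_ofNat_of_zero_le hb0
    obtain ⟨e, he⟩ := Int.eq_ofNat_of_zero_le (show 0 ≤ h - (p - q) by omega)
    have := ones_of_rotation (f := f) (c := c) (b := b') (e := e) ?_ ?_ ?_
    · intro j hj0 hj1
      obtain ⟨j', rfl⟩ := Int.eq_ofNat_of_zero_le hj0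
      have := this j' (by omega)
      rw [hc]; exact this
    · intro i hi
      have r := hQ.occ p hp i (by omega) (by omega)
      rw [← agree _ (by omega) (by omega), hP.occ' hq (by omega) (by omega)] at r
      rw [← r]; congr 1; push_cast; omega
    · intro j hj
      rw [← he]; exact hb1 _ (by omega) (by omega)
    · intro j hj
      have r := hP.occ q' hq' j (by omega) (by omega)
      rw [agree _ (by omega) (by omega), hQ.occ' hp (by omega) (by omega)] at r
      rw [← r]; congr 1; omega
  have hz' : x' (p + h + b) = false := by
    rw [← agree _ (by omega) (by omega), hP.occ' hq' (by omega) (by omega), ← hfd]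
    congr 1; omega
  obtain ⟨p', hp', b1, b2⟩ := hQ.cover _ hz'
  have hpp' : p < p' := by
    rcases lt_trichotomy p p' with c | c | c
    · exact c
    · omega
    · have := hQ.disj _ hp' _ hp c; omega
  have b3 := hQ.disj _ hp _ hp' hpp'
  have b4 : p' = p + h + b := by
    by_contra hne
    have z := hQ.start_zero hb hp'
    rw [← agree _ (by omega) (by omega), hP.occ' hq' (by omega) (by omega)] at z
    have := key (p' - p - h) (by omega) (by omega)
    rw [show p - q - b + (p' - p - h) = p' - q' by omega, z] at this
    exact absurd this (by decide)
  exact ⟨a4 ▸ hq', b4 ▸ hp'⟩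

theorem IsBlock.exists_first_zero {h : ℤ} {f : ℤ → Bool} (hb : IsBlock h f) {d : ℤ} (hd : 0 < d) :
    ∃ b, 0 ≤ b ∧ b < d ∧ (∀ j, 0 ≤ j → j < b → f (h - d + j) = true) ∧ f (h - d + b) = false := by
  have hex : ∃ n : ℕ, f (h - d + n) = false := by
    refine ⟨(d - 1).toNat, ?_⟩
    rw [← hb.last]; congr 1; omega
  classical
  refine ⟨Nat.find hex, by omega, ?_, ?_, Nat.find_spec hex⟩
  · have : Nat.find hex ≤ (d - 1).toNat := by
      refine Nat.find_min' hex ?_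
      rw [← hb.last]; congr 1; omega
    omega
  · intro j h0 h1
    obtain ⟨j', rfl⟩ := Int.eq_ofNat_of_zero_le h0
    have := Nat.find_min hex (m := j') (by omega)
    simpa using this

/-- Overlapping tilings by the same block continue with constant gaps as long as the words agree.
The gap depends only on the block and on the distance `d` of the overlap. -/
theorem IsBlock.overlap_iterate {h : ℤ} {f : ℤ → Bool} (hb : IsBlock h f) {d : ℤ} (hd : 0 < d)
    (hdh : d < h) :
    ∃ c, h ≤ c ∧ c < 2 * h ∧ ∀ (x x' : ℤ → Bool) (P Q : Set ℤ) (p : ℤ),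
      IsTiling h f x P → IsTiling h f x' Q → p - d ∈ P → p ∈ Q →
      ∀ n : ℕ, (∀ i, p ≤ i → i < p + n * c + 2 * h → x i = x' i) →
        p + n * c ∈ Q := by
  obtain ⟨b, b0, b1, b2, b3⟩ := hb.exists_first_zero hd
  refine ⟨h + b, by omega, by omega, fun x x' P Q p hP hQ hq hp n => ?_⟩
  suffices H : (∀ i, p ≤ i → i < p + n * (h + b) + 2 * h → x i = x' i) →
      p + n * (h + b) - d ∈ P ∧ p + n * (h + b) ∈ Q from fun ha => (H ha).2
  induction n with
  | zero => intro _; simpa using ⟨hq, hp⟩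
  | succ n ih =>
    intro ha
    have hn : (0 : ℤ) ≤ n * (h + b) := by have := hb.pos; positivity
    have hn1 : ((n + 1 : ℕ) : ℤ) * (h + b) = n * (h + b) + (h + b) := by push_cast; ring
    rw [hn1] at ha ⊢
    have hpos := hb.pos
    obtain ⟨u, v⟩ := ih fun i h1 h2 => ha i h1 (by omega)
    have e : p + n * (h + b) - (p + n * (h + b) - d) = d := by ring
    have := IsTiling.overlap_step hb hP hQ (b := b) u v (by omega) (by omega) b0
      (by rw [e]; exact b2) (by rw [e]; exact b3) (by omega)
      (fun i h1 h2 => ha i (by omega) (by omega))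
    constructor
    · convert this.1 using 1; ring
    · convert this.2 using 1; ring

/-- A word with a tile at every `p + n c`, where the gap `c` leaves no room for another tile, is
`c`-periodic from `p` on. -/
theorem IsTiling.periodic {h : ℤ} {f x : ℤ → Bool} {Q : Set ℤ}
    (hQ : IsTiling h f x Q) {p c : ℤ} (hc : h ≤ c) (hc2 : c < 2 * h) (hp : ∀ n : ℕ, p + n * c ∈ Q) :
    ∀ i, p ≤ i → x (i + c) = x i := by
  have key : ∀ (n : ℕ) (j : ℤ), 0 ≤ j → j < c →
      x (p + n * c + j) = if j < h then f j else true := by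
    intro n j h0 h1
    split_ifs with hj
    · exact hQ.occ _ (hp n) _ h0 hj
    · by_contra hne
      obtain ⟨q, hq, a1, a2⟩ := hQ.cover _ (Bool.eq_false_iff.2 hne)
      have h3 := hp (n + 1)
      push_cast at h3
      have e : p + ((n : ℤ) + 1) * c = p + n * c + c := by ring
      rw [e] at h3
      rcases lt_trichotomy (p + n * c) q with k | k | k
      · have := hQ.disj _ hq _ h3 (by omega)
        have := hQ.disj _ (hp n) _ hq k
        omega
      · omega
      · have := hQ.disj _ hq _ (hp n) k
        omega
  intro i hi
  have e := Int.emod_add_mul_ediv (i - p) c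
  have m0 := Int.emod_nonneg (i - p) (show c ≠ 0 by omega)
  have m1 := Int.emod_lt_of_pos (i - p) (show 0 < c by omega)
  obtain ⟨n, hn⟩ := Int.eq_ofNat_of_zero_le (Int.ediv_nonneg (show 0 ≤ i - p by omega)
    (show 0 ≤ c by omega))
  rw [hn] at e
  have k1 := key n _ m0 m1
  have k2 := key (n + 1) _ m0 m1
  rw [← k1] at k2
  convert k2 using 2
  · push_cast; linarith
  · linarith

/-- Overlapping tilings of two words that agree from `p` on force periodicity. -/
theorem IsTiling.periodic_of_overlap {h : ℤ} {f x x' : ℤ → Bool} {P Q : Set ℤ} (hb : IsBlock h f)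
    (hP : IsTiling h f x P) (hQ : IsTiling h f x' Q) {p q : ℤ} (hq : q ∈ P) (hp : p ∈ Q)
    (h1 : q < p) (h2 : p < q + h) (agree : ∀ i, p ≤ i → x i = x' i) :
    ∃ c, 0 < c ∧ ∀ i, p ≤ i → x' (i + c) = x' i := by
  obtain ⟨c, hc, hc2, H⟩ := hb.overlap_iterate (d := p - q) (by omega) (by omega)
  have hpos := hb.pos
  refine ⟨c, by omega, hQ.periodic hc hc2 fun n => ?_⟩
  exact H x x' P Q p hP hQ (by simpa using hq) hp n fun i hi _ => agree i hi

/-! ### Compactness -/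

/-- Sequential compactness of `β ^ ℤ` for a finite alphabet `β`. -/
theorem exists_cluster {β : Type*} [Finite β] (z : ℕ → ℤ → β) :
    ∃ (x : ℤ → β) (φ : ℕ → ℕ), StrictMono φ ∧
      ∀ i, ∀ᶠ n in Filter.atTop, z (φ n) i = x i := by
  let _ : TopologicalSpace β := ⊥
  have : DiscreteTopology β := ⟨rfl⟩
  obtain ⟨x, -, φ, hφ, hx⟩ := isCompact_univ.tendsto_subseq (x := z) fun _ => mem_univ _
  refine ⟨x, φ, hφ, fun i => ?_⟩
  have := (tendsto_pi_nhds.1 hx) i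
  rw [nhds_discrete, Filter.tendsto_pure] at this
  exact this

theorem IsClosed.mem_of_eventually {β : Type*} [TopologicalSpace β] {X : Set (ℤ → β)}
    (hX : IsClosed X) {z : ℕ → ℤ → β} {x : ℤ → β} (hz : ∀ᶠ n in Filter.atTop, z n ∈ X)
    (hx : ∀ i, ∀ᶠ n in Filter.atTop, z n i = x i) : x ∈ X := by
  refine hX.mem_of_tendsto (tendsto_pi_nhds.2 fun i => ?_) hz
  refine tendsto_const_nhds.congr' ?_
  filter_upwards [hx i] with n hn using hn.symm

theorem eventually_forall_Icc {β : Type*} {z : ℕ → ℤ → β} {x : ℤ → β}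
    (hx : ∀ i, ∀ᶠ n in Filter.atTop, z n i = x i) (a b : ℤ) :
    ∀ᶠ n in Filter.atTop, ∀ i, a ≤ i → i ≤ b → z n i = x i := by
  have := (Filter.eventually_all_finset (Finset.Icc a b) (l := Filter.atTop)
    (p := fun i n => z n i = x i)).2 fun i _ => hx i
  filter_upwards [this] with n hn i h1 h2 using hn i (Finset.mem_Icc.2 ⟨h1, h2⟩)

theorem isClosed_letter_eq (i : ℤ) (b : Bool) : IsClosed {x : ℤ → Bool | x i = b} :=
  isClosed_eq (continuous_apply i) continuous_const

theorem isOpen_letter_eq (i : ℤ) (b : Bool) : IsOpen {x : ℤ → Bool | x i = b} :=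
  (isOpen_discrete ({b} : Set Bool)).preimage (continuous_apply (A := fun _ : ℤ => Bool) i)

/-- Being a tiling is a closed condition on the word and the indicator of the set of tiles. -/
theorem isClosed_isTiling (h : ℤ) (f : ℤ → Bool) :
    IsClosed {z : (ℤ → Bool) × (ℤ → Bool) | IsTiling h f z.1 {p | z.2 p = true}} := by
  have e : {z : (ℤ → Bool) × (ℤ → Bool) | IsTiling h f z.1 {p | z.2 p = true}} =
      {z | ∀ p i, 0 ≤ i → i < h → z.2 p = true → z.1 (p + i) = f i} ∩
      ({z | ∀ i, z.1 i = false → ∃ p ∈ Set.Icc (i - h + 1) i, z.2 p = true} ∩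
      {z | ∀ p q, p < q → q < p + h → z.2 p = true → ¬ z.2 q = true}) := by
    ext z
    constructor
    · intro hz
      refine ⟨fun p i h0 h1 hp => hz.occ p hp i h0 h1, fun i hi => ?_, fun p q h1 h2 hp hq => ?_⟩
      · obtain ⟨p, hp, a, b⟩ := hz.cover i hi
        exact ⟨p, ⟨by omega, a⟩, hp⟩
      · have := hz.disj p hp q hq h1
        omega
    · rintro ⟨h1, h2, h3⟩
      refine ⟨fun p hp i a b => h1 p i a b hp, fun i hi => ?_, fun p hp q hq hpq => ?_⟩
      · obtain ⟨p, ⟨a, b⟩, hp⟩ := h2 i hi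
        exact ⟨p, hp, b, by omega⟩
      · by_contra hlt
        exact h3 p q hpq (by omega) hp hq
  have c1 : ∀ (i : ℤ) (b : Bool), IsClosed {z : (ℤ → Bool) × (ℤ → Bool) | z.1 i = b} :=
    fun i b => (isClosed_letter_eq i b).preimage continuous_fst
  have c2 : ∀ (i : ℤ) (b : Bool), IsClosed {z : (ℤ → Bool) × (ℤ → Bool) | z.2 i = b} :=
    fun i b => (isClosed_letter_eq i b).preimage continuous_snd
  have o1 : ∀ (i : ℤ) (b : Bool), IsOpen {z : (ℤ → Bool) × (ℤ → Bool) | z.1 i = b} :=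
    fun i b => (isOpen_letter_eq i b).preimage continuous_fst
  have o2 : ∀ (i : ℤ) (b : Bool), IsOpen {z : (ℤ → Bool) × (ℤ → Bool) | z.2 i = b} :=
    fun i b => (isOpen_letter_eq i b).preimage continuous_snd
  rw [e]
  refine IsClosed.inter ?_ (IsClosed.inter ?_ ?_)
  · simp only [ofPred_forall]
    exact isClosed_iInter fun p => isClosed_iInter fun i => isClosed_iInter fun _ =>
      isClosed_iInter fun _ => isClosed_imp (o2 p true) (c1 _ _)
  · simp only [ofPred_forall]
    refine isClosed_iInter fun i => isClosed_imp (o1 i false) ?_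
    have : {z : (ℤ → Bool) × (ℤ → Bool) | ∃ p ∈ Set.Icc (i - h + 1) i, z.2 p = true} =
        ⋃ p ∈ Set.Icc (i - h + 1) i, {z | z.2 p = true} := by
      ext z; simp
    rw [this]
    exact (Set.finite_Icc _ _).isClosed_biUnion fun p _ => c2 p true
  · simp only [ofPred_forall]
    exact isClosed_iInter fun p => isClosed_iInter fun q => isClosed_iInter fun _ =>
      isClosed_iInter fun _ => isClosed_imp (o2 p true) (o2 q true).isClosed_compl

theorem setOf_indicator_eq (P : Set ℤ) [DecidablePred (· ∈ P)] :
    {p | (fun p => decide (p ∈ P)) p = true} = P := by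
  ext p; simp

/-- Words with a tiling whose set of tiles satisfies a closed condition form a closed set, because
the space of sets of tiles is compact. -/
theorem isClosed_exists_isTiling (h : ℤ) (f : ℤ → Bool) {C : Set (ℤ → Bool)} (hC : IsClosed C) :
    IsClosed {x : ℤ → Bool | ∃ Q ∈ C, IsTiling h f x {p | Q p = true}} := by
  have := isClosedMap_fst_of_compactSpace (X := ℤ → Bool) (Y := ℤ → Bool) _
    ((isClosed_isTiling h f).inter (hC.preimage continuous_snd))
  convert this using 1
  ext x
  constructor
  · rintro ⟨Q, hQ, ht⟩
    exact ⟨(x, Q), ⟨ht, hQ⟩, rfl⟩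
  · rintro ⟨⟨x, Q⟩, ⟨ht, hQ⟩, rfl⟩
    exact ⟨Q, hQ, ht⟩

/-- The word `x` has a tiling by the block `(h, f)` in which a tile starts at `p`. -/
def HasTile (h : ℤ) (f : ℤ → Bool) (x : ℤ → Bool) (p : ℤ) : Prop :=
  ∃ P, IsTiling h f x P ∧ p ∈ P

theorem isClosed_hasTile (h : ℤ) (f : ℤ → Bool) (p : ℤ) : IsClosed {x | HasTile h f x p} := by
  classical
  convert isClosed_exists_isTiling h f (isClosed_letter_eq p true) using 1
  ext x
  constructor
  · rintro ⟨P, hP, hp⟩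
    exact ⟨fun p => decide (p ∈ P), by simpa using hp, by rwa [setOf_indicator_eq]⟩
  · rintro ⟨Q, hQ, ht⟩
    exact ⟨_, ht, hQ⟩

theorem isClosed_exists_notMem_tiling (h : ℤ) (f : ℤ → Bool) (p : ℤ) :
    IsClosed {x | ∃ P, IsTiling h f x P ∧ p ∉ P} := by
  classical
  convert isClosed_exists_isTiling h f (isClosed_letter_eq p false) using 1
  ext x
  constructor
  · rintro ⟨P, hP, hp⟩
    exact ⟨fun p => decide (p ∈ P), by simpa using hp, by rwa [setOf_indicator_eq]⟩
  · rintro ⟨Q, hQ, ht⟩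
    refine ⟨_, ht, ?_⟩
    have hQ' : Q p = false := hQ
    simp [hQ']

theorem isClosed_exists_tiling (h : ℤ) (f : ℤ → Bool) :
    IsClosed {x | ∃ P, IsTiling h f x P} := by
  classical
  convert isClosed_exists_isTiling h f isClosed_univ using 1
  ext x
  constructor
  · rintro ⟨P, hP⟩
    exact ⟨fun p => decide (p ∈ P), trivial, by rwa [setOf_indicator_eq]⟩
  · rintro ⟨Q, hQ, ht⟩
    exact ⟨_, ht⟩

/-- The word `x` translated by `k` places to the left. -/
def shiftWord (k : ℤ) (x : ℤ → Bool) : ℤ → Bool := fun i => x (i + k)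

theorem hasTile_shiftWord {h : ℤ} {f x : ℤ → Bool} {k p : ℤ} :
    HasTile h f (shiftWord k x) p ↔ HasTile h f x (p + k) := by
  constructor
  · rintro ⟨P, hP, hp⟩
    refine ⟨{q | q + -k ∈ P}, ?_, by simpa using hp⟩
    have := hP.shift (-k)
    simpa [shiftWord, sub_eq_add_neg, add_assoc] using this
  · rintro ⟨P, hP, hp⟩
    exact ⟨_, hP.shift k, hp⟩

/-! ### Rank-one systems and their asymptotic points -/

/-- The properties of the system of a non-degenerate rank-1 word, with a chain of blocks
`(h n, f n)` each of which is built from the previous one, that the analysis of isomorphisms uses.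
They are symmetric under reversal of words. -/
structure RankOneSystem (X : Set (ℤ → Bool)) (h : ℕ → ℤ) (f : ℕ → ℤ → Bool) : Prop where
  closed : IsClosed X
  shift : ∀ x ∈ X, ∀ k, shiftWord k x ∈ X
  block : ∀ n, IsBlock (h n) (f n)
  double : ∀ n, 2 * h n ≤ h (n + 1)
  tile : ∀ x ∈ X, ∀ n, ∃ P, IsTiling (h n) (f n) x P
  nest_start : ∀ x ∈ X, ∀ n p, HasTile (h (n + 1)) (f (n + 1)) x p → HasTile (h n) (f n) x p
  nest_end : ∀ x ∈ X, ∀ n p, HasTile (h (n + 1)) (f (n + 1)) x p →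
    HasTile (h n) (f n) x (p + h (n + 1) - h n)
  per_right : ∀ x ∈ X, ∀ c > 0, ∀ N, (∀ i ≥ N, x (i + c) = x i) → ∀ i ≥ N, x i = true
  per_left : ∀ x ∈ X, ∀ c > 0, ∀ N, (∀ i ≤ N, x (i - c) = x i) → ∀ i ≤ N, x i = true
  ones_left : (fun _ => true) ∈ X → ∃ x ∈ X, x 0 = false ∧ ∀ i < 0, x i = true
  ones_right : (fun _ => true) ∈ X → ∃ x ∈ X, x (-1) = false ∧ ∀ i ≥ 0, x i = true

namespace RankOneSystem

variable {X : Set (ℤ → Bool)} {h : ℕ → ℤ} {f : ℕ → ℤ → Bool}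

/-- Tilings of words that agree on a right half-line agree there. -/
theorem mem_of_agree_right (S : RankOneSystem X h f) {x x' : ℤ → Bool} (hx : x ∈ X) {H : ℤ}
    {F : ℤ → Bool} (hb : IsBlock H F) {P P' : Set ℤ} (hP : IsTiling H F x P)
    (hP' : IsTiling H F x' P') {p : ℤ}
    (agree : ∀ i ≥ p, x i = x' i) (hp : p ∈ P) : p ∈ P' := by
  have hz := hP.start_zero hb hp
  obtain ⟨q, hq, h1, h2⟩ := hP'.cover p (by rw [← agree p le_rfl, hz])
  rcases h1.eq_or_lt with rfl | h1
  · exact hq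
  · obtain ⟨c, hc, hper⟩ := hP'.periodic_of_overlap hb hP hq hp h1 h2
      fun i hi => (agree i hi).symm
    have := S.per_right x hx c hc p hper p le_rfl
    rw [hz] at this
    exact absurd this (by decide)

theorem tiling_unique (S : RankOneSystem X h f) {x : ℤ → Bool} (hx : x ∈ X) {H : ℤ}
    {F : ℤ → Bool} (hb : IsBlock H F) {P P' : Set ℤ} (hP : IsTiling H F x P)
    (hP' : IsTiling H F x P') : P = P' :=
  Set.ext fun _ => ⟨fun hp => S.mem_of_agree_right hx hb hP hP' (fun _ _ => rfl) hp,
    fun hp => S.mem_of_agree_right hx hb hP' hP (fun _ _ => rfl) hp⟩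

theorem mem_of_hasTile (S : RankOneSystem X h f) {x : ℤ → Bool} (hx : x ∈ X) {n : ℕ}
    {P : Set ℤ} (hP : IsTiling (h n) (f n) x P) {p : ℤ} (hp : HasTile (h n) (f n) x p) : p ∈ P := by
  obtain ⟨P', hP', hp'⟩ := hp
  rwa [S.tiling_unique hx (S.block n) hP hP']

theorem hasTile_of_le (S : RankOneSystem X h f) {x : ℤ → Bool} (hx : x ∈ X) {m n : ℕ} {p : ℤ}
    (hmn : m ≤ n) (hp : HasTile (h n) (f n) x p) : HasTile (h m) (f m) x p := by
  induction hmn with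
  | refl => exact hp
  | step _ ih => exact ih (S.nest_start x hx _ p hp)

theorem length_ge (S : RankOneSystem X h f) (n : ℕ) : (n : ℤ) + 1 ≤ h n := by
  induction n with
  | zero => have := (S.block 0).pos; push_cast; omega
  | succ n ih => have := S.double n; push_cast; omega

/-- The position `p` of `x` starts a tile of every level. -/
def AllTiles (h : ℕ → ℤ) (f : ℕ → ℤ → Bool) (x : ℤ → Bool) (p : ℤ) : Prop :=
  ∀ n, HasTile (h n) (f n) x p

theorem agree_of_allTiles (S : RankOneSystem X h f) {x x' : ℤ → Bool} {p p' : ℤ}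
    (hp : AllTiles h f x p) (hp' : AllTiles h f x' p') {i : ℤ} (hi : 0 ≤ i) :
    x (p + i) = x' (p' + i) := by
  obtain ⟨P, hP, hpP⟩ := hp i.toNat
  obtain ⟨P', hP', hpP'⟩ := hp' i.toNat
  have := S.length_ge i.toNat
  rw [hP.occ p hpP i hi (by omega), hP'.occ p' hpP' i hi (by omega)]

theorem zero_of_allTiles (S : RankOneSystem X h f) {x : ℤ → Bool} {p : ℤ}
    (hp : AllTiles h f x p) (N : ℤ) : ∃ i ≥ N, x i = false := by
  obtain ⟨P, hP, hpP⟩ := hp (N - p).toNat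
  have := S.length_ge (N - p).toNat
  exact ⟨_, by omega, hP.end_zero (S.block _) hpP⟩

theorem allTiles_unique (S : RankOneSystem X h f) {x : ℤ → Bool} (hx : x ∈ X) {p q : ℤ}
    (hp : AllTiles h f x p) (hq : AllTiles h f x q) : p = q := by
  wlog hpq : p < q generalizing p q
  · rcases lt_trichotomy p q with c | c | c
    · exact absurd c hpq
    · exact c
    · exact (this hq hp c).symm
  obtain ⟨i, hi, hz⟩ := S.zero_of_allTiles hp p
  have := S.per_right x hx (q - p) (by omega) p (fun j hj => by
    have := S.agree_of_allTiles hp hq (i := j - p) (by omega)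
    rw [show p + (j - p) = j by ring, show q + (j - p) = j + (q - p) by ring] at this
    exact this.symm) i hi
  rw [hz] at this
  exact absurd this (by decide)

/-- Two distinct points that agree from some place on, with infinitely many zeros there, have a
common position that starts a tile of every level: the first zero after the last place where they
differ. -/
theorem allTiles_of_asymptotic (S : RankOneSystem X h f) {x x' : ℤ → Bool} (hx : x ∈ X)
    (hx' : x' ∈ X) (hne : x ≠ x') {N : ℤ} (agree : ∀ i ≥ N, x i = x' i)
    (hz : ∀ M : ℤ, ∃ i ≥ M, x i = false) : ∃ p, AllTiles h f x p ∧ AllTiles h f x' p := by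
  obtain ⟨k₀, hk₀⟩ := Function.ne_iff.1 hne
  obtain ⟨k, hk, hmax⟩ := Int.exists_greatest_of_bdd (P := fun i => x i ≠ x' i)
    ⟨N, fun z hz => by by_contra hlt; exact hz (agree z (by omega))⟩ ⟨k₀, hk₀⟩
  replace agree : ∀ i > k, x i = x' i := fun i hi => by
    by_contra hne'
    have := hmax i hne'
    omega
  obtain ⟨p₀, hp₀, hp₀z⟩ := hz (k + 1)
  obtain ⟨p, ⟨hkp, hpz⟩, hmin⟩ := Int.exists_least_of_bdd (P := fun i => k < i ∧ x i = false)
    ⟨k, fun z hz => hz.1.le⟩ ⟨p₀, by omega, hp₀z⟩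
  have hpz' : x' p = false := by rw [← agree p hkp, hpz]
  have key : ∀ n, HasTile (h n) (f n) x p ∧ HasTile (h n) (f n) x' p := by
    intro n
    have hb := S.block n
    obtain ⟨P, hP⟩ := S.tile x hx n
    obtain ⟨P', hP'⟩ := S.tile x' hx' n
    have t1 : ∀ r > k, r ∈ P → r ∈ P' := fun r hr hrP =>
      S.mem_of_agree_right hx hb hP hP' (fun i hi => agree i (by omega)) hrP
    have t2 : ∀ r > k, r ∈ P' → r ∈ P := fun r hr hrP =>
      S.mem_of_agree_right hx' hb hP' hP (fun i hi => (agree i (by omega)).symm) hrP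
    by_cases hpP : p ∈ P
    · exact ⟨⟨P, hP, hpP⟩, ⟨P', hP', t1 p hkp hpP⟩⟩
    have hpP' : p ∉ P' := fun c => hpP (t2 p hkp c)
    exfalso
    obtain ⟨q, hq, a1, a2⟩ := hP.cover p hpz
    obtain ⟨q', hq', b1, b2⟩ := hP'.cover p hpz'
    have a3 : q ≤ k := by
      by_contra hlt
      have := hmin q ⟨by omega, hP.start_zero hb hq⟩
      exact hpP ((show q = p by omega) ▸ hq)
    have b3 : q' ≤ k := by
      by_contra hlt
      have := hmin q' ⟨by omega, by rw [agree q' (by omega)]; exact hP'.start_zero hb hq'⟩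
      exact hpP' ((show q' = p by omega) ▸ hq')
    have l1 : q ≤ q' := by
      by_contra hlt
      obtain ⟨r, hr, c1, c2⟩ := hP'.cover (q + h n - 1)
        (by rw [← agree _ (by omega)]; exact hP.end_zero hb hq)
      rcases lt_or_ge k r with c | c
      · have := hP.disj q hq r (t2 r c hr) (by omega)
        omega
      · rcases lt_trichotomy r q' with d | d | d
        · have := hP'.disj r hr q' hq' d; omega
        · omega
        · have := hP'.disj q' hq' r hr d; omega
    have l2 : q' ≤ q := by
      by_contra hlt
      obtain ⟨r, hr, c1, c2⟩ := hP.cover (q' + h n - 1)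
        (by rw [agree _ (by omega)]; exact hP'.end_zero hb hq')
      rcases lt_or_ge k r with c | c
      · have := hP'.disj q' hq' r (t1 r c hr) (by omega)
        omega
      · rcases lt_trichotomy r q with d | d | d
        · have := hP.disj r hr q hq d; omega
        · omega
        · have := hP.disj q hq r hr d; omega
    have : q = q' := le_antisymm l1 l2
    subst this
    exact hk (by rw [hP.occ' hq a3 (by omega), hP'.occ' hq' a3 (by omega)])
  exact ⟨p, fun n => (key n).1, fun n => (key n).2⟩

/-- In a point with only ones far to the left, the first zero starts a tile of every level. -/
theorem allTiles_of_ones (S : RankOneSystem X h f) {x : ℤ → Bool} (hx : x ∈ X)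
    (hne : x ≠ fun _ => true) {N : ℤ} (hN : ∀ i ≤ N, x i = true) : ∃ p, AllTiles h f x p := by
  obtain ⟨k₀, hk₀⟩ := Function.ne_iff.1 hne
  obtain ⟨p, hpz, hmin⟩ := Int.exists_least_of_bdd (P := fun i => x i = false)
    ⟨N, fun z hz => by by_contra hlt; rw [hN z (by omega)] at hz; exact absurd hz (by decide)⟩
    ⟨k₀, by simpa using hk₀⟩
  refine ⟨p, fun n => ?_⟩
  obtain ⟨P, hP⟩ := S.tile x hx n
  obtain ⟨q, hq, a1, a2⟩ := hP.cover p hpz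
  have := hmin q (hP.start_zero (S.block n) hq)
  exact ⟨P, hP, (show q = p by omega) ▸ hq⟩

theorem ones_mem_of_left (S : RankOneSystem X h f) {x : ℤ → Bool} (hx : x ∈ X) {N : ℤ}
    (hN : ∀ i ≤ N, x i = true) : (fun _ => true) ∈ X := by
  refine S.closed.mem_of_eventually (z := fun n => shiftWord (-n) x)
    (Filter.Eventually.of_forall fun n => S.shift x hx _) fun i => ?_
  filter_upwards [Filter.eventually_ge_atTop (i - N).toNat] with n hn
  exact hN _ (by omega)

theorem ones_mem_of_right (S : RankOneSystem X h f) {x : ℤ → Bool} (hx : x ∈ X) {N : ℤ}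
    (hN : ∀ i ≥ N, x i = true) : (fun _ => true) ∈ X := by
  refine S.closed.mem_of_eventually (z := fun n => shiftWord n x)
    (Filter.Eventually.of_forall fun n => S.shift x hx _) fun i => ?_
  filter_upwards [Filter.eventually_ge_atTop (N - i).toNat] with n hn
  exact hN _ (by omega)

theorem eq_ones_of_fixed (S : RankOneSystem X h f) {x : ℤ → Bool} (hx : x ∈ X)
    (hfix : shiftWord 1 x = x) : x = fun _ => true := by
  funext i
  exact S.per_right x hx 1 one_pos i (fun j _ => congrFun hfix j) i le_rfl

/-- If the word of all ones does not belong to `X`, then there are two distinct points that agree on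
a right half-line: otherwise, by compactness, a window of bounded length would determine the letter
to its left, and then every point would be periodic on a left half-line. -/
theorem exists_asymptotic (S : RankOneSystem X h f) (hX : X.Nonempty)
    (h1 : (fun _ => true) ∉ X) : ∃ x ∈ X, ∃ x' ∈ X, x ≠ x' ∧ ∀ i ≥ 0, x i = x' i := by
  by_contra! hcon
  have hdet : ∃ N : ℕ, ∀ x ∈ X, ∀ x' ∈ X, (∀ i : ℤ, 0 ≤ i → i ≤ N → x i = x' i) →
      x (-1) = x' (-1) := by
    by_contra! hno
    choose x hx x' hx' hag hne using hno
    obtain ⟨y, φ, hφ, hy⟩ := exists_cluster fun n i => (x n i, x' n i)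
    have y1 : (fun i => (y i).1) ∈ X := S.closed.mem_of_eventually (z := fun n => x (φ n))
      (Filter.Eventually.of_forall fun n => hx _)
      fun i => by filter_upwards [hy i] with n hn; rw [← hn]
    have y2 : (fun i => (y i).2) ∈ X := S.closed.mem_of_eventually (z := fun n => x' (φ n))
      (Filter.Eventually.of_forall fun n => hx' _)
      fun i => by filter_upwards [hy i] with n hn; rw [← hn]
    have hag' : ∀ i ≥ 0, (y i).1 = (y i).2 := by
      intro i hi
      obtain ⟨n, hn, hin⟩ := ((hy i).and (Filter.eventually_ge_atTop i.toNat)).exists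
      rw [← hn]
      exact hag _ i hi (by have := hφ.le_apply (x := n); omega)
    have heq : (fun i => (y i).1) = fun i => (y i).2 := by
      by_contra hne'
      obtain ⟨i, hi, hi'⟩ := hcon _ y1 _ y2 hne'
      exact hi' (hag' i hi)
    obtain ⟨n, hn⟩ := (hy (-1)).exists
    refine hne (φ n) ?_
    have e1 := congrArg Prod.fst hn
    have e2 := congrArg Prod.snd hn
    simp only at e1 e2
    rw [e1, e2]
    exact congrFun heq (-1)
  obtain ⟨N, hdet⟩ := hdet
  obtain ⟨x, hx⟩ := hX
  -- Two windows of length `N + 1` of `x` coincide, and hence so do all letters to their left.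
  obtain ⟨j, j', hjj, hblk⟩ := Finite.exists_ne_map_eq_of_infinite
    fun (j : ℕ) (i : Fin (N + 1)) => x (-j + i)
  wlog hlt : j < j' generalizing j j'
  · exact this j' j hjj.symm hblk.symm (by omega)
  have hind : ∀ t : ℕ, ∀ i, 0 ≤ i → i ≤ (N : ℤ) → x (-j - t + i) = x (-j' - t + i) := by
    intro t
    induction t with
    | zero =>
      intro i h0 hi
      have := congrFun hblk ⟨i.toNat, by omega⟩
      simp only at this
      rw [Int.toNat_of_nonneg h0] at this
      simpa using this
    | succ t ih =>
      intro i h0 hi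
      rcases h0.eq_or_lt with rfl | h0
      · have := hdet _ (S.shift x hx (-j - t)) _ (S.shift x hx (-j' - t)) fun i a b => by
          have := ih i a b
          simp only [shiftWord]
          rwa [add_comm i, add_comm i (-(j' : ℤ) - t)]
        simp only [shiftWord] at this
        convert this using 2 <;> push_cast <;> ring
      · have := ih (i - 1) (by omega) (by omega)
        convert this using 2 <;> push_cast <;> ring
  have := S.per_left x hx (j' - j : ℕ) (by omega) (-j) fun i hi => by
    have := hind (-j - i).toNat 0 le_rfl (by omega)
    rw [show (-(j : ℤ) - ((-j - i).toNat : ℤ) + 0) = i by omega] at this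
    rw [this]; congr 1; omega
  exact h1 (S.ones_mem_of_left hx this)

end RankOneSystem

/-! ### Reversal of words -/

/-- The word `x` read backwards. -/
def revWord (x : ℤ → Bool) : ℤ → Bool := fun i => x (-1 - i)

/-- The block `(h, f)` read backwards. -/
def revBlock (h : ℤ) (f : ℤ → Bool) : ℤ → Bool := fun i => f (h - 1 - i)

theorem revWord_revWord (x : ℤ → Bool) : revWord (revWord x) = x := by
  funext i; simp [revWord]

theorem revBlock_revBlock (h : ℤ) (f : ℤ → Bool) : revBlock h (revBlock h f) = f := by
  funext i; simp [revBlock]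

theorem revWord_shiftWord (k : ℤ) (x : ℤ → Bool) :
    revWord (shiftWord k x) = shiftWord (-k) (revWord x) := by
  funext i; simp only [revWord, shiftWord]; congr 1; ring

theorem IsTiling.rev {h : ℤ} {f x : ℤ → Bool} {P : Set ℤ} (hP : IsTiling h f x P) :
    IsTiling h (revBlock h f) (revWord x) {p | -p - h ∈ P} where
  occ p hp i h0 h1 := by
    have := hP.occ _ hp (h - 1 - i) (by omega) (by omega)
    rw [show -p - h + (h - 1 - i) = -1 - (p + i) by ring] at this
    exact this
  cover i hi := by
    obtain ⟨p, hp, h1, h2⟩ := hP.cover _ hi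
    exact ⟨-p - h, by simpa using hp, by omega, by omega⟩
  disj p hp q hq hpq := by
    have := hP.disj _ hq _ hp (by omega)
    omega

theorem hasTile_rev {h : ℤ} {f x : ℤ → Bool} {p : ℤ} :
    HasTile h (revBlock h f) x p ↔ HasTile h f (revWord x) (-p - h) := by
  constructor
  · rintro ⟨P, hP, hp⟩
    refine ⟨_, by simpa [revBlock_revBlock] using hP.rev, ?_⟩
    simpa using hp
  · rintro ⟨P, hP, hp⟩
    exact ⟨_, by simpa [revWord_revWord] using hP.rev, hp⟩

theorem RankOneSystem.reverse {X : Set (ℤ → Bool)} {h : ℕ → ℤ} {f : ℕ → ℤ → Bool}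
    (S : RankOneSystem X h f) :
    RankOneSystem {x | revWord x ∈ X} h (fun n => revBlock (h n) (f n)) where
  closed := S.closed.preimage (continuous_pi fun i => continuous_apply (-1 - i))
  shift x hx k := by
    change revWord _ ∈ X
    rw [revWord_shiftWord]
    exact S.shift _ hx _
  block n := by
    have hb := S.block n
    refine ⟨hb.pos, ?_, ?_⟩
    · simpa [revBlock] using hb.last
    · simpa [revBlock] using hb.first
  double := S.double
  tile x hx n := by
    obtain ⟨P, hP⟩ := S.tile _ hx n
    exact ⟨_, by simpa [revWord_revWord] using hP.rev⟩
  nest_start x hx n p hp := by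
    rw [hasTile_rev] at hp ⊢
    have := S.nest_end _ hx n _ hp
    convert this using 1; ring
  nest_end x hx n p hp := by
    rw [hasTile_rev] at hp ⊢
    have := S.nest_start _ hx n _ hp
    convert this using 1; ring
  per_right x hx c hc N hN i hi := by
    have := S.per_left _ hx c hc (-1 - N) (fun j hj => by
      have := hN (-1 - j) (by omega)
      simp only [revWord]
      rw [← this]; congr 1; ring) (-1 - i) (by omega)
    simpa [revWord] using this
  per_left x hx c hc N hN i hi := by
    have := S.per_right _ hx c hc (-1 - N) (fun j hj => by
      have := hN (-1 - j) (by omega)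
      simp only [revWord]
      rw [← this]; congr 1; ring) (-1 - i) (by omega)
    simpa [revWord] using this
  ones_left h1 := by
    obtain ⟨x, hx, h0, hx1⟩ := S.ones_right h1
    refine ⟨revWord x, by simpa [revWord_revWord] using hx, by simpa [revWord] using h0, ?_⟩
    intro i hi
    exact hx1 _ (by omega)
  ones_right h1 := by
    obtain ⟨x, hx, h0, hx1⟩ := S.ones_left h1
    refine ⟨revWord x, by simpa [revWord_revWord] using hx, by simpa [revWord] using h0, ?_⟩
    intro i hi
    exact hx1 _ (by omega)

/-! ### Isomorphisms of rank-one systems -/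

/-- `ψ` restricts to a shift-commuting bijection from `Y` to `X` given by a block code of
radius `R`. -/
structure IsBlockCode (Y X : Set (ℤ → Bool)) (ψ : (ℤ → Bool) → ℤ → Bool) (R : ℤ) : Prop where
  radius_nonneg : 0 ≤ R
  mapsTo : ∀ y ∈ Y, ψ y ∈ X
  inj : ∀ y ∈ Y, ∀ y' ∈ Y, ψ y = ψ y' → y = y'
  surj : ∀ x ∈ X, ∃ y ∈ Y, ψ y = x
  shift : ∀ y ∈ Y, ∀ k, ψ (shiftWord k y) = shiftWord k (ψ y)
  code : ∀ y ∈ Y, ∀ y' ∈ Y, ∀ j, (∀ i, j - R ≤ i → i ≤ j + R → y i = y' i) → ψ y j = ψ y' j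

namespace IsBlockCode

variable {X Y : Set (ℤ → Bool)} {h k : ℕ → ℤ} {f g : ℕ → ℤ → Bool} {ψ : (ℤ → Bool) → ℤ → Bool}
  {R : ℤ}

theorem reverse (C : IsBlockCode Y X ψ R) :
    IsBlockCode {y | revWord y ∈ Y} {x | revWord x ∈ X} (fun y => revWord (ψ (revWord y))) R where
  radius_nonneg := C.radius_nonneg
  mapsTo y hy := by
    change revWord _ ∈ X
    rw [revWord_revWord]
    exact C.mapsTo _ hy
  inj y hy y' hy' he := by
    have := congrArg revWord he
    simp only [revWord_revWord] at this
    have := congrArg revWord (C.inj _ hy _ hy' this)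
    simpa only [revWord_revWord] using this
  surj x hx := by
    obtain ⟨y, hy, hyx⟩ := C.surj _ hx
    refine ⟨revWord y, by simpa [revWord_revWord] using hy, ?_⟩
    simp only [revWord_revWord, hyx]
  shift y hy k := by
    rw [revWord_shiftWord, C.shift _ hy, revWord_shiftWord, neg_neg]
  code y hy y' hy' j hj := by
    refine C.code _ hy _ hy' _ fun i h1 h2 => hj _ (by omega) (by omega)

theorem map_ones (C : IsBlockCode Y X ψ R) (S : RankOneSystem X h f)
    (h1 : (fun _ => true) ∈ Y) : ψ (fun _ => true) = fun _ => true :=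
  S.eq_ones_of_fixed (C.mapsTo _ h1) (C.shift _ h1 1).symm

theorem ones_mem (C : IsBlockCode Y X ψ R) (T : RankOneSystem Y k g)
    (h1 : (fun _ => true) ∈ X) : (fun _ => true) ∈ Y := by
  obtain ⟨y, hy, hyx⟩ := C.surj _ h1
  have := T.eq_ones_of_fixed hy (C.inj _ (T.shift y hy 1) _ hy (by rw [C.shift y hy, hyx]; rfl))
  exact this ▸ hy

/-- Sufficiently long runs of ones are mapped to ones. -/
theorem exists_ones_radius (C : IsBlockCode Y X ψ R) (S : RankOneSystem X h f)
    (T : RankOneSystem Y k g) : ∃ R' : ℤ, 0 ≤ R' ∧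
      ∀ y ∈ Y, ∀ j, (∀ i, j - R' ≤ i → i ≤ j + R' → y i = true) → ψ y j = true := by
  by_cases h1 : (fun _ => true) ∈ Y
  · refine ⟨R, C.radius_nonneg, fun y hy j hj => ?_⟩
    rw [C.code y hy _ h1 j hj, C.map_ones S h1]
  · by_contra! hno
    choose y hy j hj _ using fun n : ℕ => hno n (by positivity)
    refine h1 (T.closed.mem_of_eventually (z := fun n => shiftWord (j n) (y n))
      (Filter.Eventually.of_forall fun n => T.shift _ (hy n) _) fun i => ?_)
    filter_upwards [Filter.eventually_ge_atTop i.natAbs] with n hn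
    exact hj n _ (by omega) (by omega)

/-- The points in which the position 0 starts a tile of every level are mapped to points in which
some fixed position `u` does. -/
theorem exists_start_offset (C : IsBlockCode Y X ψ R) (S : RankOneSystem X h f)
    (T : RankOneSystem Y k g) (hY : Y.Nonempty) :
    ∃ u, (∃ y ∈ Y, RankOneSystem.AllTiles k g y 0) ∧
      ∀ y ∈ Y, RankOneSystem.AllTiles k g y 0 → RankOneSystem.AllTiles h f (ψ y) u := by
  -- One such point comes from a pair of asymptotic points, or from a point with ones to the left.
  obtain ⟨y₀, hy₀, p₀, p₁, hp₀, hp₁⟩ : ∃ y ∈ Y, ∃ p q,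
      RankOneSystem.AllTiles k g y p ∧ RankOneSystem.AllTiles h f (ψ y) q := by
    by_cases h1 : (fun _ => true) ∈ Y
    · obtain ⟨y, hy, hy0, hy1⟩ := T.ones_left h1
      obtain ⟨p, hp⟩ := T.allTiles_of_ones hy
        (by intro e; rw [e] at hy0; exact absurd hy0 (by decide)) (N := -1)
        (fun i hi => hy1 i (by omega))
      obtain ⟨q, hq⟩ := S.allTiles_of_ones (C.mapsTo y hy) (N := -1 - R)
        (by
          intro e
          rw [← C.map_ones S h1] at e
          rw [C.inj _ hy _ h1 e] at hy0
          exact absurd hy0 (by decide))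
        (fun i hi => by
          rw [C.code y hy _ h1 i fun j _ hj => hy1 j (by omega), C.map_ones S h1])
      exact ⟨y, hy, p, q, hp, hq⟩
    · have h2 : (fun _ => true) ∉ X := fun c => h1 (C.ones_mem T c)
      obtain ⟨y, hy, y', hy', hne, hag⟩ := T.exists_asymptotic hY h1
      obtain ⟨p, hp, -⟩ := T.allTiles_of_asymptotic hy hy' hne hag fun M => by
        by_contra! hno
        exact h1 (T.ones_mem_of_right hy (N := M) fun i hi => by simpa using hno i hi)
      obtain ⟨q, hq, -⟩ := S.allTiles_of_asymptotic (C.mapsTo y hy) (C.mapsTo y' hy')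
        (fun e => hne (C.inj y hy y' hy' e)) (N := R)
        (fun i hi => C.code y hy y' hy' i fun j hj _ => hag j (by omega)) fun M => by
        by_contra! hno
        exact h2 (S.ones_mem_of_right (C.mapsTo y hy) (N := M) fun i hi => by
          simpa using hno i hi)
      exact ⟨y, hy, p, q, hp, hq⟩
  have hz : RankOneSystem.AllTiles k g (shiftWord p₀ y₀) 0 := fun n =>
    hasTile_shiftWord.2 (by simpa using hp₀ n)
  have hzψ : RankOneSystem.AllTiles h f (ψ (shiftWord p₀ y₀)) (p₁ - p₀) := fun n => by
    rw [C.shift y₀ hy₀]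
    exact hasTile_shiftWord.2 (by simpa using hp₁ n)
  have hzY := T.shift y₀ hy₀ p₀
  refine ⟨p₁ - p₀, ⟨_, hzY, hz⟩, fun y hy hy0 => ?_⟩
  -- All points in which 0 starts a tile of every level agree to the right of 0.
  by_cases hne : y = shiftWord p₀ y₀
  · rwa [hne]
  obtain ⟨p, hp, hp'⟩ := S.allTiles_of_asymptotic (C.mapsTo _ hzY) (C.mapsTo y hy)
    (fun e => hne (C.inj _ hzY _ hy e).symm) (N := R)
    (fun i hi => C.code _ hzY _ hy i fun j hj _ => by
      have := T.agree_of_allTiles hz hy0 (i := j) (by omega)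
      simpa using this)
    (S.zero_of_allTiles hzψ)
  rwa [S.allTiles_unique (C.mapsTo _ hzY) hzψ hp]

/-- A quantitative form of `exists_start_offset`, by compactness: tiles of a high level are
mapped near their left end to tiles of a given level. -/
theorem exists_level_start (C : IsBlockCode Y X ψ R) (S : RankOneSystem X h f)
    (T : RankOneSystem Y k g) {u : ℤ}
    (hu : ∀ y ∈ Y, RankOneSystem.AllTiles k g y 0 → RankOneSystem.AllTiles h f (ψ y) u) (n : ℕ) :
    ∃ m₀, ∀ m ≥ m₀, ∀ y ∈ Y, ∀ p, HasTile (k m) (g m) y p → HasTile (h n) (f n) (ψ y) (p + u) := by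
  suffices H : ∃ m, ∀ y ∈ Y, HasTile (k m) (g m) y 0 → HasTile (h n) (f n) (ψ y) u by
    obtain ⟨m₀, hm⟩ := H
    refine ⟨m₀, fun m hmm y hy p hp => ?_⟩
    have := hm (shiftWord p y) (T.shift y hy p)
      (hasTile_shiftWord.2 (by simpa using T.hasTile_of_le hy hmm hp))
    rw [C.shift y hy, hasTile_shiftWord] at this
    rwa [add_comm]
  by_contra! hno
  choose y hy hy0 hyu using hno
  obtain ⟨z, φ, hφ, hz⟩ := exists_cluster y
  have hzY : z ∈ Y := T.closed.mem_of_eventually (Filter.Eventually.of_forall fun n => hy (φ n)) hz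
  have hz0 : RankOneSystem.AllTiles k g z 0 := fun M => by
    refine (isClosed_hasTile (k M) (g M) 0).mem_of_eventually (z := fun n => y (φ n)) ?_ hz
    filter_upwards [Filter.eventually_ge_atTop M] with n hn
    exact T.hasTile_of_le (hy _) (hn.trans hφ.le_apply) (hy0 _)
  have hψ : ∀ i, ∀ᶠ n in Filter.atTop, ψ (y (φ n)) i = ψ z i := fun i => by
    filter_upwards [eventually_forall_Icc hz (i - R) (i + R)] with n hn
    exact C.code _ (hy _) _ hzY i hn
  obtain ⟨P, hP, hu'⟩ : ψ z ∈ {x | ∃ P, IsTiling (h n) (f n) x P ∧ u ∉ P} := by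
    refine (isClosed_exists_notMem_tiling (h n) (f n) u).mem_of_eventually
      (z := fun n => ψ (y (φ n))) (Filter.Eventually.of_forall fun j => ?_) hψ
    obtain ⟨P, hP⟩ := S.tile _ (C.mapsTo _ (hy (φ j))) n
    exact ⟨P, hP, fun c => hyu _ ⟨P, hP, c⟩⟩
  exact hu' (S.mem_of_hasTile (C.mapsTo z hzY) hP (hu z hzY hz0 n))

/-- The mirror image of `exists_level_start`: right ends of tiles of a high level are mapped near
right ends of tiles of a given level. -/
theorem exists_level_end (C : IsBlockCode Y X ψ R) (S : RankOneSystem X h f)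
    (T : RankOneSystem Y k g) (hY : Y.Nonempty) :
    ∃ e, ∀ n, ∃ m₀, ∀ m ≥ m₀, ∀ y ∈ Y, ∀ p, HasTile (k m) (g m) y p →
      HasTile (h n) (f n) (ψ y) (p + k m + e - h n) := by
  have hY' : {y | revWord y ∈ Y}.Nonempty := by
    obtain ⟨y, hy⟩ := hY
    exact ⟨revWord y, by simpa [revWord_revWord] using hy⟩
  obtain ⟨u, -, hu⟩ := C.reverse.exists_start_offset S.reverse T.reverse hY'
  refine ⟨-u, fun n => ?_⟩
  obtain ⟨m₀, hm⟩ := C.reverse.exists_level_start S.reverse T.reverse hu n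
  refine ⟨m₀, fun m hmm y hy p hp => ?_⟩
  have := hm m hmm (revWord y) (by simpa [revWord_revWord] using hy) (-p - k m)
    (by rw [hasTile_rev, revWord_revWord]; simpa using hp)
  rw [hasTile_rev] at this
  simp only [revWord_revWord] at this
  convert this using 1; ring

/-- The tiles of a high level in `y` correspond, up to a fixed shift `u`, to tiles by some block
`(H, F)` in `ψ y`.  Near the two ends of such a tile, `ψ y` is a tile of a fixed level `n`, and in
between it is determined by the tile of `y`.  Outside, a tile of level `n` would have to contain a
long run of ones, except near its ends, and it contains the zero at the place
`h (n - 1) - 1`. -/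
theorem exists_tiling_correspondence (C : IsBlockCode Y X ψ R) (S : RankOneSystem X h f)
    (T : RankOneSystem Y k g) (hY : Y.Nonempty) :
    ∃ (m : ℕ) (H : ℤ) (F : ℤ → Bool) (u : ℤ), IsBlock H F ∧
      (∃ y ∈ Y, RankOneSystem.AllTiles k g y 0 ∧ RankOneSystem.AllTiles h f (ψ y) u) ∧
      ∀ y ∈ Y, ∀ Q, IsTiling (k m) (g m) y Q → IsTiling H F (ψ y) {p | p - u ∈ Q} := by
  obtain ⟨u, ⟨y₀, hy₀, hy₀0⟩, hu⟩ := C.exists_start_offset S T hY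
  obtain ⟨e, he⟩ := C.exists_level_end S T hY
  obtain ⟨R', hR', hones⟩ := C.exists_ones_radius S T
  obtain ⟨n, hn⟩ : ∃ n : ℕ, R + R' + |u| + |e| < n := ⟨(R + R' + |u| + |e| + 1).toNat, by omega⟩
  have hR := C.radius_nonneg
  have hh := S.length_ge n
  have hd := S.double n
  obtain ⟨m₁, hm₁⟩ := C.exists_level_start S T hu (n + 1)
  obtain ⟨m₂, hm₂⟩ := he (n + 1)
  obtain ⟨m, hm1, hm2, hm3⟩ : ∃ m, m₁ ≤ m ∧ m₂ ≤ m ∧ 2 * h (n + 1) < k m := by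
    refine ⟨max (max m₁ m₂) (2 * h (n + 1)).toNat, by omega, by omega, ?_⟩
    have := T.length_ge (max (max m₁ m₂) (2 * h (n + 1)).toNat)
    omega
  replace hm₁ := hm₁ m hm1
  replace hm₂ := hm₂ m hm2
  have hau := abs_le.1 (le_refl |u|)
  have hae := abs_le.1 (le_refl |e|)
  have hu0 := abs_nonneg u
  have he0 := abs_nonneg e
  set H := k m + e - u with hH
  obtain ⟨Q₀, hQ₀, h0Q₀⟩ := hy₀0 m
  have hb := S.block (n + 1)
  refine ⟨m, H, fun i => ψ y₀ (u + i), u, ⟨by omega, ?_, ?_⟩, ⟨y₀, hy₀, hy₀0, hu y₀ hy₀ hy₀0⟩, ?_⟩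
  · obtain ⟨P, hP, hp⟩ := hm₁ y₀ hy₀ 0 ⟨Q₀, hQ₀, h0Q₀⟩
    have := hP.start_zero hb hp
    simpa using this
  · obtain ⟨P, hP, hp⟩ := hm₂ y₀ hy₀ 0 ⟨Q₀, hQ₀, h0Q₀⟩
    have := hP.end_zero hb hp
    rw [← this]; congr 1; rw [hH]; ring
  intro y hy Q hQ
  obtain ⟨P, hP⟩ := S.tile _ (C.mapsTo y hy) (n + 1)
  have hstart : ∀ q ∈ Q, q + u ∈ P := fun q hq =>
    S.mem_of_hasTile (C.mapsTo y hy) hP (hm₁ y hy q ⟨Q, hQ, hq⟩)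
  have hend : ∀ q ∈ Q, q + k m + e - h (n + 1) ∈ P := fun q hq =>
    S.mem_of_hasTile (C.mapsTo y hy) hP (hm₂ y hy q ⟨Q, hQ, hq⟩)
  obtain ⟨P₀, hP₀⟩ := S.tile _ (C.mapsTo y₀ hy₀) (n + 1)
  have hstart₀ : 0 + u ∈ P₀ :=
    S.mem_of_hasTile (C.mapsTo y₀ hy₀) hP₀ (hm₁ y₀ hy₀ 0 ⟨Q₀, hQ₀, h0Q₀⟩)
  have hend₀ : 0 + k m + e - h (n + 1) ∈ P₀ :=
    S.mem_of_hasTile (C.mapsTo y₀ hy₀) hP₀ (hm₂ y₀ hy₀ 0 ⟨Q₀, hQ₀, h0Q₀⟩)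
  refine ⟨fun p hp i h0 h1 => ?_, fun j hj => ?_, fun p hp q hq hpq => ?_⟩
  · change p - u ∈ Q at hp
    rcases lt_or_ge i (h (n + 1)) with c1 | c1
    · rw [hP.occ' (hstart _ hp) (by omega) (by omega), hP₀.occ' hstart₀ (by omega) (by omega)]
      congr 1; ring
    rcases lt_or_ge i (H - h (n + 1)) with c2 | c2
    · have e1 : ψ y (p + i) = ψ (shiftWord (p - u) y) (u + i) := by
        rw [C.shift y hy]; simp only [shiftWord]; congr 1; ring
      rw [e1]
      refine C.code _ (T.shift y hy _) _ hy₀ _ fun j hj1 hj2 => ?_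
      have q1 := hQ.occ _ hp j (by omega) (by omega)
      have q2 := hQ₀.occ _ h0Q₀ j (by omega) (by omega)
      rw [zero_add] at q2
      rw [q2, ← q1]
      simp only [shiftWord]; congr 1; ring
    · rw [hP.occ' (hend _ hp) (by omega) (by omega), hP₀.occ' hend₀ (by omega) (by omega)]
      congr 1; ring
  · obtain ⟨t, ht, ht1, ht2⟩ := hP.cover j hj
    by_contra! hcon
    -- The tile `t` lies outside of all the tiles by `(H, F)`.
    have hout : ∀ q ∈ Q, t + h (n + 1) ≤ q + u ∨ q + k m + e ≤ t := by
      intro q hq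
      have c0 := hcon (q + u) (by simpa using hq)
      have c1 := hstart q hq
      have c2 := hend q hq
      rcases lt_trichotomy t (q + u) with a | a | a
      · exact Or.inl (hP.disj _ ht _ c1 a)
      · omega
      · rcases lt_trichotomy t (q + k m + e - h (n + 1)) with b | b | b
        · have := hP.disj _ ht _ c2 b; omega
        · omega
        · have := hP.disj _ c2 _ ht b; omega
    have hy1 : ∀ i, t - e ≤ i → i < t + h (n + 1) - u → y i = true := by
      intro i hi1 hi2
      by_contra hne
      obtain ⟨q, hq, a, b⟩ := hQ.cover i (Bool.eq_false_iff.2 hne)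
      rcases hout q hq with c | c <;> omega
    obtain ⟨P', hP', ht'⟩ := S.nest_start _ (C.mapsTo y hy) n t ⟨P, hP, ht⟩
    have hz := hP'.end_zero (S.block n) ht'
    rw [hones y hy _ fun i hi1 hi2 => hy1 i (by omega) (by omega)] at hz
    exact absurd hz (by decide)
  · change p - u ∈ Q at hp
    change q - u ∈ Q at hq
    have a1 := hend _ hp
    have a2 := hstart _ hq
    have a3 := hQ.disj _ hp _ hq (by omega)
    have := hP.disj _ a1 _ a2 (by omega)
    omega

end IsBlockCode

/-! ### Infinite words as bi-infinite words -/

/-- The infinite word `V` extended by ones to the left. -/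
def extWord (V : ℕ → Bool) : ℤ → Bool := fun i => if 0 ≤ i then V i.toNat else true

/-- The letters of the finite word `v`, as a function on `ℤ`. -/
def letters (v : List Bool) : ℤ → Bool := fun i => v.getD i.toNat true

/-- The block `(h, f)` extended by ones on both sides. -/
def padBlock (h : ℤ) (f : ℤ → Bool) : ℤ → Bool := fun i => if 0 ≤ i ∧ i < h then f i else true

theorem extWord_natCast (V : ℕ → Bool) (n : ℕ) : extWord V n = V n := by simp [extWord]

theorem extWord_of_neg (V : ℕ → Bool) {i : ℤ} (hi : i < 0) : extWord V i = true := by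
  simp [extWord, not_le.2 hi]

theorem nonneg_of_extWord {V : ℕ → Bool} {i : ℤ} (hi : extWord V i = false) : 0 ≤ i := by
  by_contra hlt
  rw [extWord_of_neg V (by omega)] at hi
  exact absurd hi (by decide)

theorem letters_natCast (v : List Bool) {i : ℕ} (hi : i < v.length) : letters v i = v[i] := by
  simp [letters, hi]

theorem isBlock_letters {v : List Bool} (hv : v ∈ zeroWords) : IsBlock v.length (letters v) := by
  obtain ⟨h1, h2⟩ := hv
  have hne : v ≠ [] := by rintro rfl; simp at h1
  have hpos : 0 < v.length := List.length_pos_iff.2 hne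
  refine ⟨by exact_mod_cast hpos, ?_, ?_⟩
  · have := letters_natCast v hpos
    rw [List.head?_eq_getElem?, List.getElem?_eq_getElem hpos, Option.some.injEq] at h1
    rw [← h1, ← this]; rfl
  · have := letters_natCast v (show v.length - 1 < v.length by omega)
    rw [List.getLast?_eq_getElem?, List.getElem?_eq_getElem (by omega), Option.some.injEq] at h2
    rw [← h2, ← this]; congr 1; omega

/-- The word consisting of the letters `f 0, …, f (h - 1)`. -/
def blockList (h : ℤ) (f : ℤ → Bool) : List Bool := List.ofFn fun i : Fin h.toNat => f i

theorem IsBlock.blockList_mem {h : ℤ} {f : ℤ → Bool} (hb : IsBlock h f) :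
    blockList h f ∈ zeroWords := by
  have hpos := hb.pos
  have hl : (blockList h f).length = h.toNat := by simp [blockList]
  constructor
  · rw [List.head?_eq_getElem?, List.getElem?_eq_getElem (by omega)]
    simp [blockList, hb.first]
  · rw [List.getLast?_eq_getElem?, List.getElem?_eq_getElem (by omega)]
    simp only [blockList, List.getElem_ofFn, Option.some.injEq, List.length_ofFn]
    rw [← hb.last]; congr 1; omega

theorem length_blockList {h : ℤ} {f : ℤ → Bool} (hb : IsBlock h f) :
    ((blockList h f).length : ℤ) = h := by
  have := hb.pos
  simp [blockList]; omega

theorem letters_blockList {h : ℤ} {f : ℤ → Bool} {i : ℤ} (h0 : 0 ≤ i) (h1 : i < h) :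
    letters (blockList h f) i = f i := by
  obtain ⟨j, rfl⟩ := Int.eq_ofNat_of_zero_le h0
  rw [letters_natCast _ (by simp [blockList]; omega)]
  simp [blockList]

theorem IsTiling.congr {h : ℤ} {f f' x : ℤ → Bool} {P : Set ℤ} (hP : IsTiling h f x P)
    (hf : ∀ i, 0 ≤ i → i < h → f i = f' i) : IsTiling h f' x P where
  occ p hp i h0 h1 := by rw [hP.occ p hp i h0 h1, hf i h0 h1]
  cover := hP.cover
  disj := hP.disj

/-! ### Words built from a block -/

section
variable {V : ℕ → Bool} {h : ℤ} {f : ℤ → Bool} {P : Set ℤ}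

theorem nonneg_of_mem_tiling (hb : IsBlock h f) (hP : IsTiling h f (extWord V) P) {p : ℤ}
    (hp : p ∈ P) : 0 ≤ p := nonneg_of_extWord (hP.start_zero hb hp)

theorem zero_mem_tiling (hV : V 0 = false) (hb : IsBlock h f) (hP : IsTiling h f (extWord V) P) :
    0 ∈ P := by
  obtain ⟨q, hq, h1, -⟩ := hP.cover 0 (by simpa [extWord] using hV)
  have := nonneg_of_mem_tiling hb hP hq
  exact (show q = 0 by omega) ▸ hq

theorem exists_mem_tiling_ge (hz : ∀ N, ∃ n ≥ N, V n = false)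
    (hP : IsTiling h f (extWord V) P) (N : ℤ) : ∃ p ∈ P, N ≤ p := by
  obtain ⟨n, hn, hn0⟩ := hz (N + h).toNat
  obtain ⟨p, hp, h1, h2⟩ := hP.cover n (by rw [extWord_natCast, hn0])
  exact ⟨p, hp, by omega⟩

/-- Two infinite words with the same initial segment have the same tiles there. -/
theorem tiling_congr_extWord {W : ℕ → Bool} {Q : Set ℤ} (hb : IsBlock h f)
    (hP : IsTiling h f (extWord V) P) (hQ : IsTiling h f (extWord W) Q) {N : ℤ}
    (agree : ∀ i < N, extWord V i = extWord W i) (p : ℤ) (hpN : p < N) : p ∈ P ↔ p ∈ Q := by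
  suffices H : ∀ n : ℕ, (n : ℤ) < N → ((n : ℤ) ∈ P ↔ (n : ℤ) ∈ Q) by
    constructor
    · intro hp
      obtain ⟨n, rfl⟩ := Int.eq_ofNat_of_zero_le (nonneg_of_mem_tiling hb hP hp)
      exact (H n hpN).1 hp
    · intro hp
      obtain ⟨n, rfl⟩ := Int.eq_ofNat_of_zero_le (nonneg_of_mem_tiling hb hQ hp)
      exact (H n hpN).2 hp
  intro n
  induction n using Nat.strong_induction_on with
  | _ n ih =>
    intro hn
    constructor
    · intro hp
      obtain ⟨q, hq, a1, a2⟩ := hQ.cover n (by rw [← agree _ hn]; exact hP.start_zero hb hp)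
      rcases a1.eq_or_lt with rfl | a1
      · exact hq
      obtain ⟨m, rfl⟩ := Int.eq_ofNat_of_zero_le (nonneg_of_mem_tiling hb hQ hq)
      have := hP.disj _ ((ih m (by omega) (by omega)).2 hq) _ hp a1
      omega
    · intro hp
      obtain ⟨q, hq, a1, a2⟩ := hP.cover n (by rw [agree _ hn]; exact hQ.start_zero hb hp)
      rcases a1.eq_or_lt with rfl | a1
      · exact hq
      obtain ⟨m, rfl⟩ := Int.eq_ofNat_of_zero_le (nonneg_of_mem_tiling hb hP hq)
      have := hQ.disj _ ((ih m (by omega) (by omega)).1 hq) _ hp a1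
      omega

end

theorem length_spacedWord_succ (v : List Bool) (a : ℕ → ℕ) (n : ℕ) :
    (spacedWord v a (n + 1)).length = (spacedWord v a n).length + v.length + a n := by
  simp [spacedWord, add_assoc]

theorem le_length_spacedWord {v : List Bool} (hv : v ∈ zeroWords) (a : ℕ → ℕ) (n : ℕ) :
    n ≤ (spacedWord v a n).length := by
  induction n with
  | zero => simp
  | succ n ih =>
    have := (isBlock_letters hv).pos
    rw [length_spacedWord_succ]; omega

theorem exists_spacedWord_index {v : List Bool} (hv : v ∈ zeroWords) (a : ℕ → ℕ) (i : ℕ) :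
    ∃ n, (spacedWord v a n).length ≤ i ∧ i < (spacedWord v a (n + 1)).length := by
  have hex : ∃ n, i < (spacedWord v a (n + 1)).length :=
    ⟨i, by have := le_length_spacedWord hv a (i + 1); omega⟩
  classical
  refine ⟨Nat.find hex, ?_, Nat.find_spec hex⟩
  by_contra hlt
  cases hn : Nat.find hex with
  | zero => rw [hn] at hlt; simp [spacedWord] at hlt
  | succ m =>
    rw [hn] at hlt
    exact Nat.find_min hex (m := m) (by omega) (by omega)

theorem BuiltFrom.exists_tiling {V : ℕ → Bool} {v : List Bool} (hV : BuiltFrom V v) :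
    V 0 = false ∧ (∀ N, ∃ n ≥ N, V n = false) ∧
      ∃ P, IsTiling v.length (letters v) (extWord V) P := by
  obtain ⟨hv, a, ha⟩ := hV
  have hb := isBlock_letters hv
  have hpos := hb.pos
  set L := fun n => (spacedWord v a n).length with hL
  have hLs : ∀ n, L (n + 1) = L n + v.length + a n := length_spacedWord_succ v a
  have hmono : StrictMono L := strictMono_nat_of_lt_succ fun n => by rw [hLs]; omega
  have hocc : ∀ n (i : ℕ) (hi : i < v.length), V (L n + i) = v[i] := by
    intro n i hi
    have := ha (n + 1) (L n + i) (by change _ < L (n + 1); rw [hLs]; omega)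
    rw [← this]
    simp [spacedWord, hL, hi]
  have hT : IsTiling v.length (letters v) (extWord V) {p | ∃ n, p = L n} := by
    refine ⟨?_, ?_, ?_⟩
    · rintro _ ⟨n, rfl⟩ i h0 h1
      obtain ⟨j, rfl⟩ := Int.eq_ofNat_of_zero_le h0
      have hj : j < v.length := by exact_mod_cast h1
      rw [letters_natCast _ hj, ← hocc n j hj, ← extWord_natCast V]; push_cast; rfl
    · intro i hi
      obtain ⟨j, rfl⟩ := Int.eq_ofNat_of_zero_le (nonneg_of_extWord hi)
      rw [extWord_natCast] at hi
      obtain ⟨n, h1, h2⟩ := exists_spacedWord_index hv a j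
      refine ⟨L n, ⟨n, rfl⟩, by exact_mod_cast h1, ?_⟩
      by_contra hlt
      have := ha (n + 1) j h2
      rw [hi] at this
      have hlt' : L n + v.length ≤ j := by omega
      simp only [spacedWord] at this
      rw [List.getElem_append_right (by simp; exact hlt')] at this
      simp at this
    · rintro _ ⟨m, rfl⟩ _ ⟨n, rfl⟩ hmn
      have hmn' : m < n := hmono.lt_iff_lt.1 (by exact_mod_cast hmn)
      have := hmono.monotone (show m + 1 ≤ n by omega)
      rw [hLs] at this
      omega
  have hz : ∀ n, V (L n) = false := fun n => by
    rw [← extWord_natCast V]; exact hT.start_zero hb ⟨n, rfl⟩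
  refine ⟨by simpa [hL, spacedWord] using hz 0, fun N => ?_, _, hT⟩
  exact ⟨L N, le_length_spacedWord hv a N, hz N⟩

theorem builtFrom_of_tiling {V : ℕ → Bool} {v : List Bool} {P : Set ℤ} (hv : v ∈ zeroWords)
    (h0 : V 0 = false) (hz : ∀ N, ∃ n ≥ N, V n = false)
    (hP : IsTiling v.length (letters v) (extWord V) P) : BuiltFrom V v := by
  have hb := isBlock_letters hv
  have hnext : ∀ p : P, ∃ q : P, p.1 < q.1 ∧ ∀ r ∈ P, p.1 < r → q.1 ≤ r := by
    rintro ⟨p, hp⟩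
    obtain ⟨q₀, hq₀, hpq⟩ := exists_mem_tiling_ge hz hP (p + 1)
    obtain ⟨q, ⟨h1, h2⟩, h3⟩ := Int.exists_least_of_bdd (P := fun q => q ∈ P ∧ p < q)
      ⟨p, fun z hz => hz.2.le⟩ ⟨q₀, hq₀, by omega⟩
    exact ⟨⟨q, h1⟩, h2, fun r hr hpr => h3 r ⟨hr, hpr⟩⟩
  choose nx hnx1 hnx2 using hnext
  let s : ℕ → P := fun n => Nat.rec ⟨0, zero_mem_tiling h0 hb hP⟩ (fun _ p => nx p) n
  have hs : ∀ n, s (n + 1) = nx (s n) := fun _ => rfl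
  have hgap : ∀ n, (s n).1 + v.length ≤ (s (n + 1)).1 := fun n =>
    hP.disj _ (s n).2 _ (s (n + 1)).2 (hnx1 _)
  refine ⟨hv, fun n => ((s (n + 1)).1 - (s n).1 - v.length).toNat, fun n => ?_⟩
  set a : ℕ → ℕ := fun n => ((s (n + 1)).1 - (s n).1 - v.length).toNat with ha
  suffices H : ((spacedWord v a n).length : ℤ) = (s n).1 ∧
      IsInitialSegment (spacedWord v a n) V from H.2
  induction n with
  | zero => exact ⟨rfl, fun i hi => by simp [spacedWord] at hi⟩
  | succ n ih =>
    obtain ⟨hl, hi⟩ := ih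
    have hg := hgap n
    have hl' : ((spacedWord v a (n + 1)).length : ℤ) = (s (n + 1)).1 := by
      rw [length_spacedWord_succ]; push_cast; rw [hl, ha]; simp only
      rw [Int.toNat_of_nonneg (by omega)]; ring
    refine ⟨hl', fun i hi' => ?_⟩
    simp only [spacedWord]
    rcases lt_or_ge i (spacedWord v a n).length with c | c
    · rw [List.getElem_append_left (by simp; omega), List.getElem_append_left c]
      exact hi i c
    rcases lt_or_ge i ((spacedWord v a n).length + v.length) with d | d
    · rw [List.getElem_append_left (by simp; omega), List.getElem_append_right c]
      rw [← letters_natCast, ← hP.occ _ (s n).2 _ (by positivity) (by omega), ← hl,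
        ← extWord_natCast V]
      congr 1; omega
    · rw [List.getElem_append_right (by simp; omega), List.getElem_replicate]
      by_contra hne
      obtain ⟨q, hq, a1, a2⟩ := hP.cover i (by
        rw [extWord_natCast]; exact Bool.eq_false_iff.2 fun c => hne c.symm)
      have b1 : q < (s (n + 1)).1 := by omega
      have b2 : q ≤ (s n).1 := by
        by_contra hlt
        have := hnx2 (s n) q hq (by omega)
        rw [← hs] at this
        omega
      rcases b2.eq_or_lt with b2 | b2
      · omega
      · have := hP.disj _ hq _ (s n).2 b2
        omega

/-- A word is degenerate if and only if it is periodic. -/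
theorem isDegenerate_iff {V : ℕ → Bool} : IsDegenerate V ↔ ∃ c > 0, ∀ i, V (i + c) = V i := by
  constructor
  · rintro ⟨v, hv, hV⟩
    have hpos := List.length_pos_iff.2 hv
    refine ⟨v.length, hpos, fun i => ?_⟩
    have hl : ∀ n, (List.replicate n v).flatten.length = n * v.length := by simp
    have hi : i < (List.replicate (i + 1) v).flatten.length := by rw [hl]; nlinarith
    have e1 := hV (i + 1) i hi
    have e2 := hV (i + 1 + 1) (i + v.length) (by rw [hl] at hi ⊢; nlinarith)
    rw [← e1, ← e2]
    simp [List.replicate_succ, List.getElem_append]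
  · rintro ⟨c, hc, hV⟩
    refine ⟨List.ofFn fun i : Fin c => V i, by simp; omega, fun n => ?_⟩
    induction n with
    | zero => intro i hi; simp at hi
    | succ n ih =>
      intro i hi
      simp only [List.replicate_succ, List.flatten_cons]
      rcases lt_or_ge i c with h | h
      · rw [List.getElem_append_left (by simpa using h)]; simp
      · rw [List.getElem_append_right (by simpa using h), ih]
        rw [← hV]; congr 1; simp; omega

/-! ### Nested tilings -/

section
variable {x : ℤ → Bool} {h h' : ℤ} {f f' : ℤ → Bool} {P P' : Set ℤ}

/-- If every tile of one tiling starts at a tile of another one, then the right ends of its tiles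
are also right ends of tiles of the other one. -/
theorem IsTiling.end_mem_of_subset (hb : IsBlock h f) (hb' : IsBlock h' f')
    (hP : IsTiling h f x P) (hP' : IsTiling h' f' x P') (hsub : P' ⊆ P) {p : ℤ} (hp : p ∈ P') :
    h ≤ h' ∧ p + h' - h ∈ P := by
  have hpos := hb.pos
  have hpos' := hb'.pos
  obtain ⟨q, hq, a1, a2⟩ := hP.cover _ (hP'.end_zero hb' hp)
  obtain ⟨r, hr, b1, b2⟩ := hP'.cover _ (hP.end_zero hb hq)
  have e : r = p := by
    rcases lt_trichotomy r p with c | c | c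
    · have := hP'.disj _ hr _ hp c; omega
    · exact c
    · have := hP'.disj _ hp _ hr c
      have := hP.disj _ hq _ (hsub hr) (by omega)
      omega
  subst e
  refine ⟨?_, (show q = r + h' - h by omega) ▸ hq⟩
  by_contra hlt
  have := hP.disj _ hq _ (hsub hp) (by omega)
  omega

/-- If the tiles of `P'` start at tiles of `P`, then the block of `P'` is itself tiled. -/
theorem IsTiling.pad_of_subset (hb : IsBlock h f) (hb' : IsBlock h' f')
    (hP : IsTiling h f x P) (hP' : IsTiling h' f' x P') (hsub : P' ⊆ P) {p : ℤ} (hp : p ∈ P') :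
    IsTiling h f (padBlock h' f') {t | p + t ∈ P ∧ 0 ≤ t ∧ t < h'} := by
  obtain ⟨hle, hend⟩ := hP.end_mem_of_subset hb hb' hP' hsub hp
  have hpos := hb.pos
  have key : ∀ t, p + t ∈ P → t < h' → t + h ≤ h' := by
    intro t ht hth
    rcases lt_trichotomy (p + t) (p + h' - h) with c | c | c
    · have := hP.disj _ ht _ hend c; omega
    · omega
    · have := hP.disj _ hend _ ht c; omega
  refine ⟨?_, fun i hi => ?_, fun s hs t ht hst => ?_⟩
  · rintro t ⟨ht, ht0, ht1⟩ i h0 h1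
    have := key t ht ht1
    rw [padBlock, if_pos (by omega), ← hP'.occ p hp _ (by omega) (by omega), ← hP.occ _ ht i h0 h1]
    congr 1; ring
  · simp only [padBlock] at hi
    split_ifs at hi with hi'
    rw [← hP'.occ p hp i hi'.1 hi'.2] at hi
    obtain ⟨q, hq, a1, a2⟩ := hP.cover _ hi
    refine ⟨q - p, ⟨by simpa using hq, ?_, by omega⟩, by omega, by omega⟩
    by_contra hlt
    have := hP.disj _ hq _ (hsub hp) (by omega)
    omega
  · have := hP.disj _ hs.1 _ ht.1 (by omega)
    omega

theorem padBlock_tile_bounds (hb : IsBlock h f) {T : Set ℤ}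
    (hT : IsTiling h f (padBlock h' f') T) {t : ℤ} (ht : t ∈ T) : 0 ≤ t ∧ t + h ≤ h' := by
  have h1 := hT.start_zero hb ht
  have h2 := hT.end_zero hb ht
  simp only [padBlock] at h1 h2
  split_ifs at h1 h2 with c1 c2
  omega

/-- A tiling by a block which is itself tiled can be refined. -/
theorem IsTiling.refine (hb : IsBlock h f) {T : Set ℤ} (hT : IsTiling h f (padBlock h' f') T)
    (hP' : IsTiling h' f' x P') : IsTiling h f x {p | ∃ q ∈ P', ∃ t ∈ T, p = q + t} := by
  have hpos := hb.pos
  refine ⟨?_, fun i hi => ?_, ?_⟩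
  · rintro _ ⟨q, hq, t, ht, rfl⟩ i h0 h1
    obtain ⟨b1, b2⟩ := padBlock_tile_bounds hb hT ht
    rw [← hT.occ t ht i h0 h1, padBlock, if_pos (by omega),
      ← hP'.occ q hq _ (by omega) (by omega)]
    congr 1; ring
  · obtain ⟨q, hq, a1, a2⟩ := hP'.cover i hi
    obtain ⟨t, ht, b1, b2⟩ := hT.cover (i - q) (by
      rw [padBlock, if_pos (by omega), ← hP'.occ' hq a1 a2, hi])
    exact ⟨q + t, ⟨q, hq, t, ht, rfl⟩, by omega, by omega⟩
  · rintro _ ⟨q, hq, t, ht, rfl⟩ _ ⟨q', hq', t', ht', rfl⟩ hlt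
    obtain ⟨b1, b2⟩ := padBlock_tile_bounds hb hT ht
    obtain ⟨b3, b4⟩ := padBlock_tile_bounds hb hT ht'
    rcases lt_trichotomy q q' with c | c | c
    · have := hP'.disj _ hq _ hq' c; omega
    · subst c
      have := hT.disj _ ht _ ht' (by omega); omega
    · have := hP'.disj _ hq' _ hq c; omega

end

/-! ### Bases of non-degenerate rank-1 words -/

/-- A base of the infinite word `V` is the set of starting positions of the occurrences of a block
from which `V` is built. -/
def IsBase (V : ℕ → Bool) (P : Set ℤ) : Prop :=
  ∃ h f, IsBlock h f ∧ IsTiling h f (extWord V) P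

/-- The infinite word `V` begins with 0, has infinitely many zeros, is built from arbitrarily long
blocks, and is not periodic. -/
structure IsNondegenerateRankOne (V : ℕ → Bool) : Prop where
  first : V 0 = false
  zeros : ∀ N, ∃ n ≥ N, V n = false
  aperiodic : ¬ ∃ c > 0, ∀ i, V (i + c) = V i
  rank : ∀ N : ℤ, ∃ h f P, N ≤ h ∧ IsBlock h f ∧ IsTiling h f (extWord V) P

theorem IsRankOne.exists_builtFrom {V : ℕ → Bool} (hV : IsRankOne V) (N : ℕ) :
    ∃ v, N ≤ v.length ∧ BuiltFrom V v := by
  by_contra! hno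
  exact hV ((List.finite_length_lt Bool N).subset fun v hv => by
    by_contra hlt
    exact hno v (by simpa using hlt) hv)

theorem IsRankOne.isNondegenerateRankOne {V : ℕ → Bool} (hV : IsRankOne V)
    (hd : ¬ IsDegenerate V) : IsNondegenerateRankOne V := by
  obtain ⟨v, -, hv⟩ := hV.exists_builtFrom 0
  obtain ⟨h0, hz, -⟩ := hv.exists_tiling
  refine ⟨h0, hz, fun h => hd (isDegenerate_iff.2 h), fun N => ?_⟩
  obtain ⟨v, hl, hv⟩ := hV.exists_builtFrom N.toNat
  obtain ⟨-, -, P, hP⟩ := hv.exists_tiling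
  exact ⟨_, _, P, by omega, isBlock_letters hv.1, hP⟩

namespace IsNondegenerateRankOne

variable {V : ℕ → Bool} {h : ℤ} {f : ℤ → Bool} {P : Set ℤ}

theorem builtFrom_iff (hV : IsNondegenerateRankOne V) {v : List Bool} :
    BuiltFrom V v ↔ v ∈ zeroWords ∧ ∃ P, IsTiling v.length (letters v) (extWord V) P :=
  ⟨fun h => ⟨h.1, h.exists_tiling.2.2⟩,
    fun ⟨hv, _, hP⟩ => builtFrom_of_tiling hv hV.first hV.zeros hP⟩

/-- The tiles of long blocks start at tiles of a given block: otherwise an occurrence of the long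
block, which is an initial segment of `V`, overlaps with the given tiling and so has a long
periodic initial segment. -/
theorem exists_subset_of_long (hV : IsNondegenerateRankOne V) (hb : IsBlock h f)
    (hP : IsTiling h f (extWord V) P) :
    ∃ N, ∀ h' f' P', N ≤ h' → IsBlock h' f' → IsTiling h' f' (extWord V) P' → P' ⊆ P := by
  have h0 := zero_mem_tiling hV.first hb hP
  have hpos := hb.pos
  have hd : ∀ d : ℤ, ∃ N : ℤ, 0 < d → d < h → ∀ h' f' P', N ≤ h' → IsBlock h' f' →
      IsTiling h' f' (extWord V) P' → ∀ k ∈ P', k - d ∉ P := by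
    intro d
    by_cases hdh : 0 < d ∧ d < h
    swap
    · exact ⟨0, fun h1 h2 => absurd ⟨h1, h2⟩ hdh⟩
    obtain ⟨c, hc, hc2, H⟩ := hb.overlap_iterate hdh.1 hdh.2
    obtain ⟨n, hn⟩ : ∃ n : ℕ, (n : ℤ) * c ∉ P := by
      by_contra! hall
      have := hP.periodic (p := 0) hc hc2 (by simpa using hall)
      refine hV.aperiodic ⟨c.toNat, by omega, fun i => ?_⟩
      have := this i (by positivity)
      rw [← extWord_natCast V, ← extWord_natCast V i, ← this]
      congr 1; push_cast; omega
    refine ⟨n * c + 2 * h, fun _ _ h' f' P' hN hb' hP' k hk hkd => hn ?_⟩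
    have h0' := zero_mem_tiling hV.first hb' hP'
    have := H (shiftWord k (extWord V)) (extWord V) {p | p + k ∈ P} P 0 (hP.shift k) hP
      (by simpa [add_comm, sub_eq_add_neg] using hkd) h0 n fun i hi1 hi2 => by
        have e1 := hP'.occ _ hk i hi1 (by omega)
        have e2 := hP'.occ _ h0' i hi1 (by omega)
        rw [zero_add] at e2
        rw [e2, ← e1, shiftWord, add_comm]
    simpa using this
  choose N hN using hd
  obtain ⟨M, hM⟩ := Finset.exists_le ((Finset.Ioo 0 h).image N)
  refine ⟨M, fun h' f' P' hh' hb' hP' k hk => ?_⟩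
  obtain ⟨q, hq, a1, a2⟩ := hP.cover k (hP'.start_zero hb' hk)
  rcases a1.eq_or_lt with rfl | a1
  · exact hq
  · have := hM (N (k - q)) (Finset.mem_image_of_mem N (Finset.mem_Ioo.2 ⟨by omega, by omega⟩))
    exact absurd (by simpa using hq)
      (hN (k - q) (by omega) (by omega) h' f' P' (by omega) hb' hP' k hk)

end IsNondegenerateRankOne

/-! ### The system of a rank-1 word -/

theorem mem_systemCarrier_iff {V : ℕ → Bool} {x : ℤ → Bool} :
    x ∈ systemCarrier V ↔ ∀ a b : ℤ, ∃ k : ℤ, 0 ≤ a + k ∧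
      ∀ i, a ≤ i → i < b → x i = extWord V (i + k) := by
  constructor
  · intro hx a b
    obtain ⟨k, hk⟩ := hx (List.ofFn fun j : Fin (b - a).toNat => x (a + j))
      ⟨a, fun i hi => by simp⟩
    refine ⟨k - a, by omega, fun i h1 h2 => ?_⟩
    have := hk (i - a).toNat (by simp; omega)
    simp only [List.getElem_ofFn] at this
    rw [show i + (k - a) = ((k + (i - a).toNat : ℕ) : ℤ) by omega, extWord_natCast, ← this]
    congr 1; omega
  · rintro hx u ⟨k, hk⟩
    obtain ⟨l, hl, hl'⟩ := hx k (k + u.length)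
    refine ⟨(k + l).toNat, fun i hi => ?_⟩
    rw [hk i hi, hl' _ (by omega) (by omega), ← extWord_natCast V]
    congr 1; omega

/-- Limits of translates of `V` by larger and larger amounts belong to the system of `V`. -/
theorem mem_systemCarrier_of_eventually {V : ℕ → Bool} {x : ℤ → Bool} {k : ℕ → ℤ}
    (hk : ∀ j : ℕ, (j : ℤ) ≤ k j)
    (hx : ∀ i, ∀ᶠ j in Filter.atTop, shiftWord (k j) (extWord V) i = x i) :
    x ∈ systemCarrier V := by
  rw [mem_systemCarrier_iff]
  intro a b
  obtain ⟨j, hj, hj'⟩ := ((eventually_forall_Icc hx a b).and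
    (Filter.eventually_ge_atTop a.natAbs)).exists
  refine ⟨k j, by have := hk j; omega, fun i h1 h2 => (hj i h1 h2.le).symm⟩

namespace IsNondegenerateRankOne

variable {V : ℕ → Bool} {h : ℤ} {f : ℤ → Bool} {P : Set ℤ}

/-- Every initial segment of `V` extends to a point of the system of `V`, since it occurs
arbitrarily far to the right in `V`. -/
theorem exists_mem_systemCarrier (hV : IsNondegenerateRankOne V) (M : ℤ) :
    ∃ x ∈ systemCarrier V, ∀ i, 0 ≤ i → i < M → x i = extWord V i := by
  obtain ⟨h, f, P, hM, hb, hP⟩ := hV.rank M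
  have h0 := zero_mem_tiling hV.first hb hP
  choose p hp hpj using fun j : ℕ => exists_mem_tiling_ge hV.zeros hP j
  obtain ⟨x, φ, hφ, hx⟩ := exists_cluster fun j => shiftWord (p j) (extWord V)
  refine ⟨x, mem_systemCarrier_of_eventually (k := fun j => p (φ j))
    (fun j => le_trans (by exact_mod_cast hφ.le_apply) (hpj _)) hx, fun i hi1 hi2 => ?_⟩
  obtain ⟨j, hj⟩ := (hx i).exists
  have e1 := hP.occ _ (hp (φ j)) i hi1 (by omega)
  have e2 := hP.occ _ h0 i hi1 (by omega)
  rw [zero_add] at e2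
  rw [← hj, e2, ← e1, shiftWord, add_comm]

theorem exists_tiling_of_mem_systemCarrier (hP : IsTiling h f (extWord V) P) {x : ℤ → Bool}
    (hx : x ∈ systemCarrier V) : ∃ Q, IsTiling h f x Q := by
  rw [mem_systemCarrier_iff] at hx
  choose k hk hk' using fun n : ℕ => hx (-n) (n + 1)
  refine (isClosed_exists_tiling h f).mem_of_eventually
    (z := fun n => shiftWord (k n) (extWord V))
    (Filter.Eventually.of_forall fun n => ⟨_, hP.shift (k n)⟩) fun i => ?_
  filter_upwards [Filter.eventually_ge_atTop i.natAbs] with n hn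
  exact (hk' n i (by omega) (by omega)).symm

/-- A sequence of blocks for `V`, each of which is built from the previous one. -/
theorem exists_chain (hV : IsNondegenerateRankOne V) :
    ∃ (h : ℕ → ℤ) (f : ℕ → ℤ → Bool), (∀ n, IsBlock (h n) (f n)) ∧
      (∀ n, ∃ P, IsTiling (h n) (f n) (extWord V) P) ∧ (∀ n, 2 * h n ≤ h (n + 1)) ∧
      ∀ n, ∃ T, IsTiling (h n) (f n) (padBlock (h (n + 1)) (f (n + 1))) T ∧ 0 ∈ T ∧
        h (n + 1) - h n ∈ T := by
  let B := {b : ℤ × (ℤ → Bool) // IsBlock b.1 b.2 ∧ ∃ P, IsTiling b.1 b.2 (extWord V) P}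
  have hstep : ∀ b : B, ∃ b' : B, 2 * b.1.1 ≤ b'.1.1 ∧ ∃ T,
      IsTiling b.1.1 b.1.2 (padBlock b'.1.1 b'.1.2) T ∧ 0 ∈ T ∧ b'.1.1 - b.1.1 ∈ T := by
    rintro ⟨⟨h, f⟩, hb, P, hP⟩
    obtain ⟨N, hN⟩ := hV.exists_subset_of_long hb hP
    obtain ⟨h', f', P', hle, hb', hP'⟩ := hV.rank (max N (2 * h))
    have hsub := hN h' f' P' (le_trans (le_max_left _ _) hle) hb' hP'
    have h0 := zero_mem_tiling hV.first hb' hP'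
    have hpos := hb.pos
    have hpos' := hb'.pos
    obtain ⟨e1, e2⟩ := hP.end_mem_of_subset hb hb' hP' hsub h0
    refine ⟨⟨(h', f'), hb', P', hP'⟩, le_trans (le_max_right _ _) hle, _,
      hP.pad_of_subset hb hb' hP' hsub h0, ⟨by simpa using hsub h0, le_rfl, hpos'⟩, ?_, ?_, ?_⟩
    · simp only
      convert e2 using 1; ring
    · simp only; omega
    · simp only; omega
  choose nx hnx1 hnx2 using hstep
  obtain ⟨h, f, P, -, hb, hP⟩ := hV.rank 0
  let s : ℕ → B := fun n => Nat.rec ⟨(h, f), hb, P, hP⟩ (fun _ b => nx b) n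
  exact ⟨fun n => (s n).1.1, fun n => (s n).1.2, fun n => (s n).2.1, fun n => (s n).2.2,
    fun n => hnx1 (s n), fun n => hnx2 (s n)⟩

/-- The system of `V` has the properties collected in `RankOneSystem`: tilings pass to limits,
periodicity of a half-line with zeros would make `V` periodic, and long runs of ones in `V` are
bounded by zeros on both sides. -/
theorem rankOneSystem (hV : IsNondegenerateRankOne V) {h : ℕ → ℤ} {f : ℕ → ℤ → Bool}
    (hb : ∀ n, IsBlock (h n) (f n)) (hP : ∀ n, ∃ P, IsTiling (h n) (f n) (extWord V) P)
    (hd : ∀ n, 2 * h n ≤ h (n + 1))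
    (hT : ∀ n, ∃ T, IsTiling (h n) (f n) (padBlock (h (n + 1)) (f (n + 1))) T ∧ 0 ∈ T ∧
      h (n + 1) - h n ∈ T) : RankOneSystem (systemCarrier V) h f := by
  have htile : ∀ x ∈ systemCarrier V, ∀ n, ∃ P, IsTiling (h n) (f n) x P := fun x hx n => by
    obtain ⟨P, hP⟩ := hP n
    exact exists_tiling_of_mem_systemCarrier hP hx
  have hshift : ∀ x ∈ systemCarrier V, ∀ k, shiftWord k x ∈ systemCarrier V := fun x hx k => by
    have := mapsTo_shift_systemCarrier V k hx
    convert this using 1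
    funext i
    rw [SymbolicDynamics.FullShift.shift_apply, shiftWord, add_comm]
  have hlen : ∀ n : ℕ, (n : ℤ) + 1 ≤ h n := by
    intro n
    induction n with
    | zero => have := (hb 0).pos; push_cast; omega
    | succ n ih => have := hd n; push_cast; omega
  have hletter : ∀ n i, 0 ≤ i → i < h n → f n i = extWord V i := fun n i h0 h1 => by
    obtain ⟨P, hP⟩ := hP n
    rw [← hP.occ 0 (zero_mem_tiling hV.first (hb n) hP) i h0 h1, zero_add]
  -- A periodic half-line that contains arbitrarily long tiles makes `V` periodic.
  have hper : ∀ (x : ℤ → Bool) (c : ℤ), 0 < c → (∀ n, ∃ P, IsTiling (h n) (f n) x P ∧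
      ∃ q ∈ P, ∀ i, q ≤ i → i + c < q + h n → x (i + c) = x i) → False := by
    intro x c hc hx
    refine hV.aperiodic ⟨c.toNat, by omega, fun i => ?_⟩
    obtain ⟨P, hP, q, hq, hqi⟩ := hx (i + c.toNat)
    have hl := hlen (i + c.toNat)
    have := hqi (q + i) (by omega) (by omega)
    rw [add_assoc, hP.occ q hq _ (by omega) (by omega), hP.occ q hq _ (by omega) (by omega),
      hletter _ _ (by omega) (by omega), hletter _ _ (by omega) (by omega)] at this
    rw [← extWord_natCast V, ← extWord_natCast V i, ← this]
    congr 1; omega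
  have hiter : ∀ (x : ℤ → Bool) (c N i : ℤ), 0 < c → (∀ j ≥ N, x (j + c) = x j) → N ≤ i →
      ∀ n : ℕ, x (i + n * c) = x i := by
    intro x c N i hc hN hi n
    induction n with
    | zero => simp
    | succ n ih =>
      rw [← ih, ← hN (i + n * c) (by have : 0 ≤ (n : ℤ) * c := by positivity
                                     omega)]
      congr 1; push_cast; ring
  refine ⟨isClosed_systemCarrier V, hshift, hb, hd, htile, ?_, ?_, ?_, ?_, ?_, ?_⟩
  · rintro x - n p ⟨P, hP, hp⟩
    obtain ⟨T, hT, h0, -⟩ := hT n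
    exact ⟨_, hT.refine (hb n) hP, p, hp, 0, h0, by ring⟩
  · rintro x - n p ⟨P, hP, hp⟩
    obtain ⟨T, hT, -, h1⟩ := hT n
    exact ⟨_, hT.refine (hb n) hP, p, hp, _, h1, by ring⟩
  · intro x hx c hc N hN i hi
    by_contra hne
    refine hper x c hc fun n => ?_
    obtain ⟨P, hP⟩ := htile x hx n
    obtain ⟨q, hq, a1, a2⟩ := hP.cover (i + (h n).toNat * c)
      ((hiter x c N i hc hN hi _).trans (Bool.eq_false_iff.2 hne))
    refine ⟨P, hP, q, hq, fun j hj _ => hN j ?_⟩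
    have : ((h n).toNat : ℤ) ≤ (h n).toNat * c := le_mul_of_one_le_right (by positivity) (by omega)
    omega
  · intro x hx c hc N hN i hi
    by_contra hne
    refine hper x c hc fun n => ?_
    obtain ⟨P, hP⟩ := htile x hx n
    have hit := hiter (fun j => x (-j)) c (-N) (-i) hc (fun j hj => by
      have := hN (-j) (by omega)
      rw [← this]; congr 1; ring) (by omega) (h n).toNat
    simp only [neg_neg] at hit
    obtain ⟨q, hq, a1, a2⟩ := hP.cover _ (hit.trans (Bool.eq_false_iff.2 hne))
    refine ⟨P, hP, q, hq, fun j hj hj' => ?_⟩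
    have : ((h n).toNat : ℤ) ≤ (h n).toNat * c := le_mul_of_one_le_right (by positivity) (by omega)
    rw [← hN (j + c) (by omega)]; congr 1; ring
  · intro h1
    rw [mem_systemCarrier_iff] at h1
    choose k hk hk' using fun L : ℕ => h1 0 L
    have hpt : ∀ L : ℕ, ∃ x ∈ systemCarrier V, x 0 = false ∧ ∀ i, -(L : ℤ) ≤ i → i < 0 →
        x i = true := by
      intro L
      obtain ⟨n₀, hn₀, hz₀⟩ := hV.zeros (k L + L).toNat
      obtain ⟨z, ⟨hz1, hz2⟩, hz3⟩ := Int.exists_least_of_bdd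
        (P := fun i => k L ≤ i ∧ extWord V i = false)
        ⟨k L, fun z hz => hz.1⟩ ⟨n₀, by omega, by rw [extWord_natCast, hz₀]⟩
      have hzL : k L + L ≤ z := by
        by_contra hlt
        have := hk' L (z - k L) (by omega) (by omega)
        rw [sub_add_cancel, hz2] at this
        exact absurd this (by decide)
      obtain ⟨x, hx, hxV⟩ := hV.exists_mem_systemCarrier (z + 1)
      have := hk L
      refine ⟨shiftWord z x, hshift x hx z, ?_, fun i hi1 hi2 => ?_⟩
      · rw [shiftWord, zero_add, hxV z (by omega) (by omega), hz2]
      · rw [shiftWord, hxV _ (by omega) (by omega)]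
        by_contra hne
        have := hz3 (i + z) ⟨by omega, Bool.eq_false_iff.2 hne⟩
        omega
    choose x hx hx0 hx1 using hpt
    obtain ⟨y, φ, hφ, hy⟩ := exists_cluster x
    refine ⟨y, (isClosed_systemCarrier V).mem_of_eventually
      (Filter.Eventually.of_forall fun n => hx (φ n)) hy, ?_, fun i hi => ?_⟩
    · obtain ⟨n, hn⟩ := (hy 0).exists
      rw [← hn, hx0]
    · obtain ⟨n, hn, hn'⟩ := ((hy i).and (Filter.eventually_ge_atTop i.natAbs)).exists
      rw [← hn]
      exact hx1 _ _ (by have := hφ.le_apply (x := n); omega) hi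
  · intro h1
    rw [mem_systemCarrier_iff] at h1
    choose k hk hk' using fun L : ℕ => h1 0 L
    have hpt : ∀ L : ℕ, ∃ x ∈ systemCarrier V, x (-1) = false ∧ ∀ i, 0 ≤ i → i < (L : ℤ) + 1 →
        x i = true := by
      intro L
      obtain ⟨z, ⟨hz1, hz2⟩, hz3⟩ := Int.exists_greatest_of_bdd
        (P := fun i => i < k (L + 1) + (L + 1) ∧ extWord V i = false)
        ⟨k (L + 1) + (L + 1), fun z hz => hz.1.le⟩
        ⟨0, by have := hk (L + 1); omega, by simpa [extWord] using hV.first⟩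
      have hzL : z < k (L + 1) := by
        by_contra hlt
        have := hk' (L + 1) (z - k (L + 1)) (by omega) (by push_cast; omega)
        rw [sub_add_cancel, hz2] at this
        exact absurd this (by decide)
      obtain ⟨x, hx, hxV⟩ := hV.exists_mem_systemCarrier (k (L + 1) + (L + 1))
      have := nonneg_of_extWord hz2
      refine ⟨shiftWord (z + 1) x, hshift x hx _, ?_, fun i hi1 hi2 => ?_⟩
      · rw [shiftWord, show -1 + (z + 1) = z by ring, hxV z (by omega) (by omega), hz2]
      · rw [shiftWord, hxV _ (by omega) (by omega)]
        by_contra hne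
        have := hz3 (i + (z + 1)) ⟨by omega, Bool.eq_false_iff.2 hne⟩
        omega
    choose x hx hx0 hx1 using hpt
    obtain ⟨y, φ, hφ, hy⟩ := exists_cluster x
    refine ⟨y, (isClosed_systemCarrier V).mem_of_eventually
      (Filter.Eventually.of_forall fun n => hx (φ n)) hy, ?_, fun i hi => ?_⟩
    · obtain ⟨n, hn⟩ := (hy (-1)).exists
      rw [← hn, hx0]
    · obtain ⟨n, hn, hn'⟩ := ((hy i).and (Filter.eventually_ge_atTop i.natAbs)).exists
      rw [← hn]
      exact hx1 _ _ hi (by have := hφ.le_apply (x := n); omega)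

end IsNondegenerateRankOne

/-! ### Systems of isomorphic words -/

theorem subshiftMap_apply (V : ℕ → Bool) (x : (wordSystem V).carrier) :
    (subshiftMap (wordSystem V) x).1 = shiftWord 1 x.1 := by
  funext i
  change x.1 (1 + i) = x.1 (i + 1)
  rw [add_comm]

/-- A topological isomorphism is given by block codes (Curtis–Hedlund–Lyndon). -/
theorem SubshiftIsomorphic.exists_isBlockCode {V W : ℕ → Bool}
    (hVW : SubshiftIsomorphic (wordSystem V) (wordSystem W)) :
    ∃ ψ R, IsBlockCode (systemCarrier W) (systemCarrier V) ψ R := by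
  classical
  obtain ⟨φ, hφ⟩ := hVW
  have hshiftW : ∀ y ∈ systemCarrier W, ∀ k, shiftWord k y ∈ systemCarrier W := fun y hy k => by
    have := mapsTo_shift_systemCarrier W k hy
    convert this using 1
    funext i
    rw [SymbolicDynamics.FullShift.shift_apply, shiftWord, add_comm]
  let ψ : (ℤ → Bool) → ℤ → Bool := fun y =>
    if hy : y ∈ systemCarrier W then (φ.symm ⟨y, hy⟩).1 else y
  have hψ : ∀ y (hy : y ∈ systemCarrier W), ψ y = (φ.symm ⟨y, hy⟩).1 := fun y hy => by
    simp [ψ, hy]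
  have hshift1 : ∀ y ∈ systemCarrier W, ψ (shiftWord 1 y) = shiftWord 1 (ψ y) := by
    intro y hy
    rw [hψ y hy, hψ _ (hshiftW y hy 1), ← subshiftMap_apply V]
    congr 1
    apply φ.injective
    rw [hφ, φ.apply_symm_apply, φ.apply_symm_apply]
    exact Subtype.ext (subshiftMap_apply W ⟨y, hy⟩).symm
  have hadd : ∀ (a b : ℤ) (z : ℤ → Bool), shiftWord a (shiftWord b z) = shiftWord (a + b) z := by
    intro a b z
    funext i
    simp only [shiftWord]; congr 1; ring
  have hshift : ∀ y ∈ systemCarrier W, ∀ k, ψ (shiftWord k y) = shiftWord k (ψ y) := by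
    intro y hy k
    induction k using Int.induction_on with
    | zero =>
      have e : ∀ z, shiftWord 0 z = z := fun z => funext fun i => congrArg z (add_zero i)
      rw [e, e]
    | succ k ih =>
      rw [add_comm, ← hadd, hshift1 _ (hshiftW y hy _), ih, hadd]
    | pred k ih =>
      have e : shiftWord (-(k : ℤ)) y = shiftWord 1 (shiftWord (-(k : ℤ) - 1) y) := by
        rw [hadd]; congr 1; ring
      rw [e, hshift1 _ (hshiftW y hy _)] at ih
      have := congrArg (shiftWord (-1)) ih
      rw [hadd, hadd] at this
      convert this using 1
      · funext i; simp [shiftWord]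
      · congr 1; ring
  have hcode : ∃ R : ℕ, ∀ y ∈ systemCarrier W, ∀ y' ∈ systemCarrier W,
      (∀ i : ℤ, -R ≤ i → i ≤ R → y i = y' i) → ψ y 0 = ψ y' 0 := by
    by_contra! hno
    choose y hy y' hy' hag hne using hno
    obtain ⟨z, θ, hθ, hz⟩ := exists_cluster fun n i => (y n i, y' n i)
    have z1 : ∀ i, ∀ᶠ n in Filter.atTop, y (θ n) i = (z i).1 := fun i => by
      filter_upwards [hz i] with n hn; rw [← hn]
    have z2 : ∀ i, ∀ᶠ n in Filter.atTop, y' (θ n) i = (z i).1 := fun i => by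
      filter_upwards [hz i, Filter.eventually_ge_atTop i.natAbs] with n hn hn'
      rw [← hn, hag _ i] <;> have := hθ.le_apply (x := n) <;> omega
    have hzW : (fun i => (z i).1) ∈ systemCarrier W :=
      (isClosed_systemCarrier W).mem_of_eventually
        (Filter.Eventually.of_forall fun n => hy (θ n)) z1
    have hlim : ∀ (u : ℕ → ℤ → Bool), (∀ n, u n ∈ systemCarrier W) →
        (∀ i, ∀ᶠ n in Filter.atTop, u n i = (z i).1) →
        ∀ᶠ n in Filter.atTop, ψ (u n) 0 = ψ (fun i => (z i).1) 0 := by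
      intro u hu hlim
      have t1 : Filter.Tendsto (fun n => (⟨u n, hu n⟩ : (wordSystem W).carrier)) Filter.atTop
          (𝓝 ⟨fun i => (z i).1, hzW⟩) := by
        rw [tendsto_subtype_rng]
        refine tendsto_pi_nhds.2 fun i => tendsto_const_nhds.congr' ?_
        filter_upwards [hlim i] with n hn using hn.symm
      have t2 := (continuous_subtype_val.tendsto _).comp ((φ.symm.continuous.tendsto _).comp t1)
      have t3 := tendsto_pi_nhds.1 t2 0
      rw [nhds_discrete, Filter.tendsto_pure] at t3
      filter_upwards [t3] with n hn
      rw [hψ _ (hu n), hψ _ hzW]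
      exact hn
    obtain ⟨n, h1, h2⟩ := ((hlim (fun n => y (θ n)) (fun n => hy _) z1).and
      (hlim (fun n => y' (θ n)) (fun n => hy' _) z2)).exists
    exact hne _ (h1.trans h2.symm)
  obtain ⟨R, hR⟩ := hcode
  refine ⟨ψ, R, by positivity, fun y hy => ?_, fun y hy y' hy' he => ?_, fun x hx => ?_, hshift,
    fun y hy y' hy' j hj => ?_⟩
  · rw [hψ y hy]; exact (φ.symm ⟨y, hy⟩).2
  · rw [hψ y hy, hψ y' hy'] at he
    exact congrArg Subtype.val (φ.symm.injective (Subtype.ext he))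
  · refine ⟨(φ ⟨x, hx⟩).1, (φ ⟨x, hx⟩).2, ?_⟩
    rw [hψ _ (φ ⟨x, hx⟩).2]
    simp
  · have := hR _ (hshiftW y hy j) _ (hshiftW y' hy' j) fun i h1 h2 => hj _ (by omega) (by omega)
    rw [hshift y hy, hshift y' hy'] at this
    simpa [shiftWord] using this

/-- The part of a tiling to the right of one of its tiles, placed at the origin, is a tiling of the
right half of the word. -/
theorem IsTiling.restrict {h : ℤ} {f x : ℤ → Bool} {P : Set ℤ} {V : ℕ → Bool}
    (hP : IsTiling h f x P) {u : ℤ} (hu : u ∈ P) (hx : ∀ i, 0 ≤ i → x (u + i) = extWord V i) :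
    IsTiling h f (extWord V) {p | 0 ≤ p ∧ p + u ∈ P} := by
  refine ⟨fun p hp i h0 h1 => ?_, fun i hi => ?_, fun p hp q hq hpq => ?_⟩
  · rw [← hx _ (by have := hp.1; omega), ← hP.occ _ hp.2 i h0 h1]; congr 1; ring
  · have h0 := nonneg_of_extWord hi
    rw [← hx i h0] at hi
    obtain ⟨q, hq, a1, a2⟩ := hP.cover _ hi
    refine ⟨q - u, ⟨?_, by simpa using hq⟩, by omega, by omega⟩
    by_contra hlt
    have := hP.disj _ hq _ hu (by omega)
    omega
  · have := hP.disj _ hp.2 _ hq.2 (by omega)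
    omega

/-- Words with isomorphic systems have a common base.  It is read off at a point of one system that
coincides with its word on a right half-line and is mapped to such a point of the other system. -/
theorem IsNondegenerateRankOne.exists_common_base {V W : ℕ → Bool}
    (hV : IsNondegenerateRankOne V) (hW : IsNondegenerateRankOne W)
    (hVW : SubshiftIsomorphic (wordSystem V) (wordSystem W)) :
    ∃ P, IsBase V P ∧ IsBase W P := by
  obtain ⟨ψ, R, C⟩ := hVW.exists_isBlockCode
  obtain ⟨h, f, hb, hP, hd, hT⟩ := hV.exists_chain
  obtain ⟨k, g, kb, kP, kd, kT⟩ := hW.exists_chain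
  have S := hV.rankOneSystem hb hP hd hT
  have T := hW.rankOneSystem kb kP kd kT
  obtain ⟨y₁, hy₁, -⟩ := hW.exists_mem_systemCarrier 0
  obtain ⟨m, H, F, u, hHF, ⟨y, hy, hy0, hyu⟩, hcor⟩ := C.exists_tiling_correspondence S T ⟨y₁, hy₁⟩
  -- A word whose position `u` starts tiles of all levels coincides with `V` from there on.
  have hword : ∀ (V : ℕ → Bool) (hV : IsNondegenerateRankOne V) (h : ℕ → ℤ) (f : ℕ → ℤ → Bool)
      (S : RankOneSystem (systemCarrier V) h f)
      (hP : ∀ n, ∃ P, IsTiling (h n) (f n) (extWord V) P) (x : ℤ → Bool) (u : ℤ),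
      RankOneSystem.AllTiles h f x u → ∀ i, 0 ≤ i → x (u + i) = extWord V i := by
    intro V hV h f S hP x u hu i hi
    have hV0 : RankOneSystem.AllTiles h f (extWord V) 0 := fun n => by
      obtain ⟨P, hP⟩ := hP n
      exact ⟨P, hP, zero_mem_tiling hV.first (S.block n) hP⟩
    simpa using S.agree_of_allTiles hu hV0 hi
  obtain ⟨Q, hQ, hQ0⟩ := hy0 m
  have c1 := hQ.restrict hQ0 (hword W hW k g T kP y 0 hy0)
  have c2 := (hcor y hy Q hQ).restrict (u := u) (by simpa using hQ0)
    (hword V hV h f S hP (ψ y) u hyu)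
  refine ⟨_, ⟨H, F, hHF, c2⟩, k m, g m, T.block m, ?_⟩
  simpa using c1

/-! ### The system of tile positions -/

/-- The bi-infinite sequences (as indicators of sets of positions) all of whose windows occur in
the set of positions `P`, arbitrarily far to the right. -/
def windowClosure (P : Set ℤ) : Set (ℤ → Bool) :=
  {Q | ∀ N : ℕ, ∃ k : ℤ, N ≤ k ∧ ∀ i, -(N : ℤ) ≤ i → i ≤ N → (Q i = true ↔ i + k ∈ P)}

theorem isClosed_windowClosure (P : Set ℤ) : IsClosed (windowClosure P) := by
  refine IsSeqClosed.isClosed fun z x hz hx N => ?_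
  have hx' : ∀ i, ∀ᶠ n in Filter.atTop, z n i = x i := fun i => by
    have := tendsto_pi_nhds.1 hx i
    rwa [nhds_discrete, Filter.tendsto_pure] at this
  obtain ⟨n, hn⟩ := (eventually_forall_Icc hx' (-N) N).exists
  obtain ⟨k, hk, hk'⟩ := hz n N
  exact ⟨k, hk, fun i h1 h2 => by rw [← hn i h1 h2, hk' i h1 h2]⟩

theorem shiftWord_mem_windowClosure {P : Set ℤ} {Q : ℤ → Bool} (hQ : Q ∈ windowClosure P) :
    shiftWord 1 Q ∈ windowClosure P := by
  intro N
  obtain ⟨k, hk, hk'⟩ := hQ (N + 1)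
  refine ⟨k + 1, by push_cast at hk; omega, fun i h1 h2 => ?_⟩
  rw [shiftWord, hk' _ (by push_cast; omega) (by push_cast; omega)]
  rw [show i + 1 + k = i + (k + 1) by ring]

open Classical in
/-- The word with occurrences of the block `(h, f)` at the positions marked by `Q`, and ones
elsewhere. -/
noncomputable def fillWord (h : ℤ) (f : ℤ → Bool) (Q : ℤ → Bool) : ℤ → Bool := fun i =>
  if ∃ p, Q p = true ∧ p ≤ i ∧ i < p + h ∧ f (i - p) = false then false else true

section
variable {h : ℤ} {f : ℤ → Bool}

theorem fillWord_eq_false {Q : ℤ → Bool} {i : ℤ} : fillWord h f Q i = false ↔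
    ∃ p, Q p = true ∧ p ≤ i ∧ i < p + h ∧ f (i - p) = false := by
  simp only [fillWord]
  split_ifs with hc
  · simpa using hc
  · simpa using hc

theorem continuous_fillWord (h : ℤ) (f : ℤ → Bool) : Continuous (fillWord h f) := by
  refine continuous_pi fun i => (continuous_bool_rng false).2 ?_
  have e : (fun Q => fillWord h f Q i) ⁻¹' {false} =
      ⋃ p ∈ {p | p ∈ Set.Icc (i - h + 1) i ∧ f (i - p) = false}, {Q | Q p = true} := by
    ext Q
    simp only [mem_preimage, mem_singleton_iff, fillWord_eq_false, mem_iUnion, mem_ofPred_eq,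
      mem_Icc, exists_prop]
    constructor
    · rintro ⟨p, h1, h2, h3, h4⟩
      exact ⟨p, ⟨⟨by omega, h2⟩, h4⟩, h1⟩
    · rintro ⟨p, ⟨⟨h1, h2⟩, h3⟩, h4⟩
      exact ⟨p, h4, h2, by omega, h3⟩
  rw [e]
  exact ⟨((Set.finite_Icc _ _).subset fun p hp => hp.1).isClosed_biUnion
    fun p _ => isClosed_letter_eq p true, isOpen_biUnion fun p _ => isOpen_letter_eq p true⟩

theorem fillWord_shiftWord (Q : ℤ → Bool) (k : ℤ) :
    fillWord h f (shiftWord k Q) = shiftWord k (fillWord h f Q) := by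
  funext i
  rw [Bool.eq_iff_iff, ← not_iff_not]
  simp only [Bool.not_eq_true, shiftWord, fillWord_eq_false]
  constructor
  · rintro ⟨p, h1, h2, h3, h4⟩
    exact ⟨p + k, h1, by omega, by omega, by rw [← h4]; congr 1; ring⟩
  · rintro ⟨p, h1, h2, h3, h4⟩
    exact ⟨p - k, by simpa using h1, by omega, by omega, by rw [← h4]; congr 1; ring⟩

theorem IsTiling.eq_fillWord {x Q : ℤ → Bool} (hQ : IsTiling h f x {p | Q p = true}) :
    x = fillWord h f Q := by
  funext i
  rw [Bool.eq_iff_iff, ← not_iff_not]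
  simp only [Bool.not_eq_true, fillWord_eq_false]
  constructor
  · intro hi
    obtain ⟨p, hp, h1, h2⟩ := hQ.cover i hi
    exact ⟨p, hp, h1, h2, by rw [← hQ.occ' hp h1 h2, hi]⟩
  · rintro ⟨p, hp, h1, h2, h3⟩
    rw [hQ.occ' hp h1 h2, h3]

theorem isTiling_fillWord {Q : ℤ → Bool}
    (hQ : ∀ p q, Q p = true → Q q = true → p < q → p + h ≤ q) :
    IsTiling h f (fillWord h f Q) {p | Q p = true} := by
  refine ⟨fun p hp i h0 h1 => ?_, fun i hi => ?_, fun p hp q hq => hQ p q hp hq⟩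
  · rw [Bool.eq_iff_iff, ← not_iff_not]
    simp only [Bool.not_eq_true, fillWord_eq_false]
    constructor
    · rintro ⟨q, hq, h2, h3, h4⟩
      have : q = p := by
        rcases lt_trichotomy q p with c | c | c
        · have := hQ q p hq hp c; omega
        · exact c
        · have := hQ p q hp hq c; omega
      subst this
      rw [← h4]; congr 1; ring
    · intro hi
      exact ⟨p, hp, by omega, by omega, by rw [← hi]; congr 1; ring⟩
  · obtain ⟨p, hp, h1, h2, -⟩ := fillWord_eq_false.1 hi
    exact ⟨p, hp, h1, h2⟩

theorem isTiling_fillWord_of_mem_windowClosure {V : ℕ → Bool} {P : Set ℤ} {Q : ℤ → Bool}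
    (hP : IsTiling h f (extWord V) P) (hQ : Q ∈ windowClosure P) :
    IsTiling h f (fillWord h f Q) {p | Q p = true} := by
  refine isTiling_fillWord fun p q hp hq hpq => ?_
  obtain ⟨k, -, hk⟩ := hQ (p.natAbs + q.natAbs)
  have := hP.disj _ ((hk p (by omega) (by omega)).1 hp) _ ((hk q (by omega) (by omega)).1 hq)
    (by omega)
  omega

theorem fillWord_mem_systemCarrier {V : ℕ → Bool} {P : Set ℤ} {Q : ℤ → Bool} (hb : IsBlock h f)
    (hP : IsTiling h f (extWord V) P) (hQ : Q ∈ windowClosure P) :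
    fillWord h f Q ∈ systemCarrier V := by
  classical
  have hpos := hb.pos
  rw [mem_systemCarrier_iff]
  intro a b
  obtain ⟨k, hk, hk'⟩ := hQ (a.natAbs + b.natAbs + h.natAbs)
  refine ⟨k, by omega, fun i h1 h2 => ?_⟩
  rw [Bool.eq_iff_iff, ← not_iff_not]
  simp only [Bool.not_eq_true, fillWord_eq_false]
  constructor
  · rintro ⟨p, hp, h3, h4, h5⟩
    rw [hP.occ' ((hk' p (by omega) (by omega)).1 hp) (by omega) (by omega), ← h5]
    congr 1; ring
  · intro hi
    obtain ⟨p, hp, h3, h4⟩ := hP.cover _ hi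
    refine ⟨p - k, (hk' _ (by omega) (by omega)).2 (by simpa using hp), by omega, by omega, ?_⟩
    rw [← hi, hP.occ' hp h3 h4]; congr 1; ring

theorem exists_fillWord_eq {V : ℕ → Bool} {P : Set ℤ} {x : ℤ → Bool}
    (hP : IsTiling h f (extWord V) P) (hx : x ∈ systemCarrier V) :
    ∃ Q ∈ windowClosure P, fillWord h f Q = x := by
  classical
  rw [mem_systemCarrier_iff] at hx
  choose k hk hk' using fun n : ℕ => hx (-2 * n) (n + 1)
  obtain ⟨Q, φ, hφ, hQ⟩ := exists_cluster fun n i => decide (i + k n ∈ P)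
  refine ⟨Q, fun N => ?_, ?_⟩
  · obtain ⟨n, hn, hn'⟩ := ((eventually_forall_Icc hQ (-N) N).and
      (Filter.eventually_ge_atTop N)).exists
    refine ⟨k (φ n), ?_, fun i h1 h2 => ?_⟩
    · have := hφ.le_apply (x := n)
      have := hk (φ n)
      omega
    · rw [← hn i h1 h2, decide_eq_true_iff]
  · have hlim : Filter.Tendsto (fun n => fillWord h f fun i => decide (i + k (φ n) ∈ P))
        Filter.atTop (𝓝 (fillWord h f Q)) :=
      ((continuous_fillWord h f).tendsto Q).comp (tendsto_pi_nhds.2 fun i =>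
        tendsto_const_nhds.congr' (by filter_upwards [hQ i] with n hn using hn.symm))
    funext i
    have h1 := tendsto_pi_nhds.1 hlim i
    rw [nhds_discrete, Filter.tendsto_pure] at h1
    obtain ⟨n, hn, hn'⟩ := (h1.and (Filter.eventually_ge_atTop i.natAbs)).exists
    have := hφ.le_apply (x := n)
    rw [← hn, hk' (φ n) i (by omega) (by omega)]
    have hT := hP.shift (k (φ n))
    rw [← setOf_indicator_eq {p | p + k (φ n) ∈ P}] at hT
    exact (congrFun hT.eq_fillWord i).symm

end

/-- The system of `V` is isomorphic to the system of the positions of its tiles. -/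
theorem IsNondegenerateRankOne.exists_homeomorph {V : ℕ → Bool} (hV : IsNondegenerateRankOne V)
    {P : Set ℤ} (hP : IsBase V P) : ∃ e : windowClosure P ≃ₜ (wordSystem V).carrier,
      ∀ Q : windowClosure P, e ⟨shiftWord 1 Q.1, shiftWord_mem_windowClosure Q.2⟩ =
        subshiftMap (wordSystem V) (e Q) := by
  obtain ⟨h, f, hb, hP⟩ := hP
  obtain ⟨k, g, kb, kP, kd, kT⟩ := hV.exists_chain
  have S := hV.rankOneSystem kb kP kd kT
  have : CompactSpace (windowClosure P) := isCompact_iff_compactSpace.1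
    (isClosed_windowClosure P).isCompact
  let F : windowClosure P → (wordSystem V).carrier := fun Q =>
    ⟨fillWord h f Q.1, fillWord_mem_systemCarrier hb hP Q.2⟩
  have hF : Function.Bijective F := by
    constructor
    · intro Q Q' he
      have he' : fillWord h f Q.1 = fillWord h f Q'.1 := congrArg Subtype.val he
      have t1 := isTiling_fillWord_of_mem_windowClosure hP Q.2
      have t2 := isTiling_fillWord_of_mem_windowClosure hP Q'.2
      rw [← he'] at t2
      have := S.tiling_unique (F Q).2 hb t1 t2
      refine Subtype.ext (funext fun i => ?_)
      rw [Bool.eq_iff_iff]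
      exact Set.ext_iff.1 this i
    · rintro ⟨x, hx⟩
      obtain ⟨Q, hQ, he⟩ := exists_fillWord_eq hP hx
      exact ⟨⟨Q, hQ⟩, Subtype.ext he⟩
  have hc : Continuous (Equiv.ofBijective F hF) :=
    ((continuous_fillWord h f).comp continuous_subtype_val).subtype_mk _
  refine ⟨hc.homeoOfEquivCompactToT2, fun Q => Subtype.ext ?_⟩
  rw [subshiftMap_apply]
  exact fillWord_shiftWord Q.1 1

/-- Two non-degenerate rank-1 words have isomorphic systems if and only if they have a common
base. -/
theorem IsNondegenerateRankOne.isomorphic_iff {V W : ℕ → Bool}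
    (hV : IsNondegenerateRankOne V) (hW : IsNondegenerateRankOne W) :
    SubshiftIsomorphic (wordSystem V) (wordSystem W) ↔ ∃ P, IsBase V P ∧ IsBase W P := by
  refine ⟨hV.exists_common_base hW, ?_⟩
  rintro ⟨P, h1, h2⟩
  obtain ⟨e, he⟩ := hV.exists_homeomorph h1
  obtain ⟨e', he'⟩ := hW.exists_homeomorph h2
  refine ⟨e.symm.trans e', fun x => ?_⟩
  obtain ⟨Q, rfl⟩ := e.surjective x
  simp only [Homeomorph.trans_apply, Homeomorph.symm_apply_apply]
  rw [← he, Homeomorph.symm_apply_apply, he']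

/-! ### The bases of a word -/

/-- The number `s` is the least positive element of `P`. -/
def FirstGap (P : Set ℤ) (s : ℤ) : Prop := 0 < s ∧ s ∈ P ∧ ∀ t ∈ P, 0 < t → s ≤ t

theorem FirstGap.unique {P : Set ℤ} {s s' : ℤ} (hs : FirstGap P s) (hs' : FirstGap P s') :
    s = s' := le_antisymm (hs.2.2 _ hs'.2.1 hs'.1) (hs'.2.2 _ hs.2.1 hs.1)

theorem IsBase.nonneg {V : ℕ → Bool} {P : Set ℤ} (hP : IsBase V P) {p : ℤ} (hp : p ∈ P) :
    0 ≤ p := by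
  obtain ⟨h, f, hb, hP⟩ := hP
  exact nonneg_of_mem_tiling hb hP hp

namespace IsNondegenerateRankOne

variable {V : ℕ → Bool} {P Q : Set ℤ} {s : ℤ}

theorem zero_mem_base (hV : IsNondegenerateRankOne V) (hP : IsBase V P) : 0 ∈ P := by
  obtain ⟨h, f, hb, hP⟩ := hP
  exact zero_mem_tiling hV.first hb hP

theorem exists_firstGap (hV : IsNondegenerateRankOne V) (hP : IsBase V P) :
    ∃ s, FirstGap P s := by
  obtain ⟨h, f, hb, hP⟩ := hP
  obtain ⟨p, hp, h1⟩ := exists_mem_tiling_ge hV.zeros hP 1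
  obtain ⟨s, ⟨h1, h2⟩, h3⟩ := Int.exists_least_of_bdd (P := fun q => q ∈ P ∧ 0 < q)
    ⟨0, fun z hz => hz.2.le⟩ ⟨p, hp, by omega⟩
  exact ⟨s, h2, h1, fun t ht h0 => h3 t ⟨ht, h0⟩⟩

theorem letter_eq (hV : IsNondegenerateRankOne V) {h : ℤ} {f : ℤ → Bool} (hb : IsBlock h f)
    (hP : IsTiling h f (extWord V) P) {i : ℤ} (h0 : 0 ≤ i) (h1 : i < h) : f i = extWord V i := by
  rw [← hP.occ 0 (zero_mem_tiling hV.first hb hP) i h0 h1, zero_add]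

/-- The base is determined by the length of the block. -/
theorem tiling_eq_of_length (hV : IsNondegenerateRankOne V) {h : ℤ} {f g : ℤ → Bool}
    (hb : IsBlock h f) (hb' : IsBlock h g) (hP : IsTiling h f (extWord V) P)
    (hQ : IsTiling h g (extWord V) Q) : P = Q := by
  have hQ' : IsTiling h f (extWord V) Q := hQ.congr fun i h0 h1 => by
    rw [hV.letter_eq hb hP h0 h1, hV.letter_eq hb' hQ h0 h1]
  exact Set.ext fun p => tiling_congr_extWord hb hP hQ' (N := p + 1) (fun _ _ => rfl) p (by omega)

theorem length_le_firstGap (hV : IsNondegenerateRankOne V) {h : ℤ} {f : ℤ → Bool}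
    (hb : IsBlock h f) (hP : IsTiling h f (extWord V) P) (hs : FirstGap P s) : h ≤ s := by
  have := hP.disj _ (zero_mem_tiling hV.first hb hP) _ hs.2.1 hs.1
  omega

theorem lt_length_of_lt_firstGap {h : ℤ} {f : ℤ → Bool}
    (hb : IsBlock h f) (hP : IsTiling h f (extWord V) P) (hs : FirstGap P s) {i : ℤ}
    (hi : extWord V i = false) (his : i < s) : i < h := by
  obtain ⟨q, hq, h1, h2⟩ := hP.cover i hi
  have h0 := nonneg_of_mem_tiling hb hP hq
  rcases h0.eq_or_lt with rfl | h0
  · omega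
  · have := hs.2.2 q hq h0
    omega

/-- A base is determined by its first gap `s`, since the block is what remains of the initial
segment of length `s` when the ones at its end are removed. -/
theorem base_eq_of_firstGap (hV : IsNondegenerateRankOne V) (hP : IsBase V P) (hQ : IsBase V Q)
    (hs : FirstGap P s) (hs' : FirstGap Q s) : P = Q := by
  obtain ⟨h, f, hb, hP⟩ := hP
  obtain ⟨h', f', hb', hQ⟩ := hQ
  have hpos := hb.pos
  have hpos' := hb'.pos
  have a1 := hV.length_le_firstGap hb hP hs
  have a2 := hV.length_le_firstGap hb' hQ hs'
  have b1 := lt_length_of_lt_firstGap hb hP hs (i := h' - 1)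
    (by rw [← hV.letter_eq hb' hQ (by omega) (by omega), hb'.last]) (by omega)
  have b2 := lt_length_of_lt_firstGap hb' hQ hs' (i := h - 1)
    (by rw [← hV.letter_eq hb hP (by omega) (by omega), hb.last]) (by omega)
  have e : h = h' := by omega
  subst e
  exact hV.tiling_eq_of_length hb hb' hP hQ

theorem exists_base_ge (hV : IsNondegenerateRankOne V) (N : ℤ) :
    ∃ P s, IsBase V P ∧ FirstGap P s ∧ N ≤ s := by
  obtain ⟨h, f, P, hN, hb, hP⟩ := hV.rank N
  obtain ⟨s, hs⟩ := hV.exists_firstGap ⟨h, f, hb, hP⟩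
  exact ⟨P, s, ⟨h, f, hb, hP⟩, hs, hN.trans (hV.length_le_firstGap hb hP hs)⟩

/-- All but finitely many bases are contained in a given one. -/
theorem exists_subset_of_firstGap_ge (hV : IsNondegenerateRankOne V) (hP : IsBase V P) :
    ∃ N, ∀ Q s, IsBase V Q → FirstGap Q s → N ≤ s → Q ⊆ P := by
  obtain ⟨h, f, hb, hP⟩ := hP
  obtain ⟨N, hN⟩ := hV.exists_subset_of_long hb hP
  have hM : ∀ l : ℤ, ∃ M : ℤ, ∀ g Q s, IsBlock l g → IsTiling l g (extWord V) Q →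
      FirstGap Q s → s < M := by
    intro l
    by_cases hex : ∃ g Q s, IsBlock l g ∧ IsTiling l g (extWord V) Q ∧ FirstGap Q s
    · obtain ⟨g, Q, s, hg, hQ, hs⟩ := hex
      refine ⟨s + 1, fun g' Q' s' hg' hQ' hs' => ?_⟩
      have := hV.tiling_eq_of_length hg hg' hQ hQ'
      subst this
      have := hs.unique hs'
      omega
    · exact ⟨0, fun g Q s hg hQ hs => absurd ⟨g, Q, s, hg, hQ, hs⟩ hex⟩
  choose M hM using hM
  obtain ⟨B, hB⟩ := Finset.exists_le ((Finset.Ico 0 N).image M)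
  refine ⟨B, fun Q s hQ hs hBs => ?_⟩
  obtain ⟨h', f', hb', hQ⟩ := hQ
  refine hN h' f' Q ?_ hb' hQ
  by_contra hlt
  have h1 := hM h' f' Q s hb' hQ hs
  have := hB (M h') (Finset.mem_image_of_mem M (Finset.mem_Ico.2 ⟨hb'.pos.le, by omega⟩))
  omega

theorem isBase_zeros (V : ℕ → Bool) : IsBase V {p | extWord V p = false} := by
  refine ⟨1, fun _ => false, ⟨one_pos, rfl, rfl⟩, fun p hp i h0 h1 => ?_, fun i hi => ?_, ?_⟩
  · rw [show i = 0 by omega, add_zero]; exact hp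
  · exact ⟨i, hi, le_rfl, by omega⟩
  · intro p _ q _ hpq; omega

theorem base_subset_zeros (hP : IsBase V P) : P ⊆ {p | extWord V p = false} := by
  obtain ⟨h, f, hb, hP⟩ := hP
  exact fun p hp => hP.start_zero hb hp

/-- If `Q ⊆ P` are bases, then `P` has the same pattern in each tile of `Q`. -/
theorem eq_pattern (hV : IsNondegenerateRankOne V) {h h' : ℤ} {f f' : ℤ → Bool}
    (hb : IsBlock h f) (hP : IsTiling h f (extWord V) P) (hb' : IsBlock h' f')
    (hQ : IsTiling h' f' (extWord V) Q) (hsub : Q ⊆ P) {q₀ : ℤ} (hq₀ : q₀ ∈ Q) {q t : ℤ}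
    (hq : q ∈ Q) (h0 : 0 ≤ t) (ht : t < h') (hqt : q₀ + t ∈ P) : q + t ∈ P := by
  have hT := (hP.pad_of_subset hb hb' hQ hsub hq₀).refine hb hQ
  rw [hV.tiling_eq_of_length hb hb hP hT]
  exact ⟨q, hq, t, ⟨hqt, h0, ht⟩, rfl⟩

/-- If `Q ⊆ P` are bases, then `P` is determined by `Q` and by the part of `P` below the first gap
of `Q`. -/
theorem mem_iff_of_subset (hV : IsNondegenerateRankOne V) (hP : IsBase V P) (hQ : IsBase V Q)
    (hsub : Q ⊆ P) (hs : FirstGap Q s) (p : ℤ) :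
    p ∈ P ↔ ∃ q ∈ Q, ∃ t ∈ P, t < s ∧ p = q + t := by
  have h0 := hV.zero_mem_base hQ
  obtain ⟨h, f, hb, hP⟩ := hP
  obtain ⟨h', f', hb', hQ⟩ := hQ
  constructor
  · intro hp
    obtain ⟨q, hq, a1, a2⟩ := hQ.cover p (hP.start_zero hb hp)
    have := hV.length_le_firstGap hb' hQ hs
    have := hV.eq_pattern hb hP hb' hQ hsub hq h0 (t := p - q) (by omega) (by omega)
      (by simpa using hp)
    exact ⟨q, hq, p - q, by simpa using this, by omega, by ring⟩
  · rintro ⟨q, hq, t, ht, hts, rfl⟩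
    have ht0 := nonneg_of_mem_tiling hb hP ht
    exact hV.eq_pattern hb hP hb' hQ hsub h0 hq ht0
      (lt_length_of_lt_firstGap hb' hQ hs (hP.start_zero hb ht) hts) (by simpa using ht)

/-- Every base contained in a common base of two words is a common base. -/
theorem isBase_of_subset (hV : IsNondegenerateRankOne V) {W : ℕ → Bool}
    (hPV : IsBase V P) (hPW : IsBase W P) (hQ : IsBase V Q)
    (hsub : Q ⊆ P) : IsBase W Q := by
  have h0 := hV.zero_mem_base hQ
  obtain ⟨h, f, hb, hP⟩ := hPV
  obtain ⟨l, g, gb, hPW⟩ := hPW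
  obtain ⟨h', f', hb', hQ⟩ := hQ
  have hpos := hb.pos
  have lpos := gb.pos
  have hend : ∀ q ∈ Q, h ≤ h' ∧ q + h' - h ∈ P := fun q hq =>
    hP.end_mem_of_subset hb hb' hQ hsub hq
  have hle := (hend 0 h0).1
  -- A tile of `P` that meets the interval from `q` to the end of its last tile lies in it.
  have hin : ∀ q ∈ Q, ∀ p ∈ P, ∀ i, q ≤ i → i < q + (h' - h + l) → p ≤ i → i < p + l →
      q ≤ p ∧ p ≤ q + h' - h := by
    intro q hq p hp i h1 h2 h3 h4
    constructor
    · by_contra hlt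
      have := hPW.disj _ hp _ (hsub hq) (by omega)
      omega
    · by_contra hlt
      have := hPW.disj _ (hend q hq).2 _ hp (by omega)
      omega
  refine ⟨h' - h + l, extWord W, ⟨by omega, ?_, ?_⟩, ?_, ?_, ?_⟩
  · exact hPW.start_zero gb (hsub h0)
  · have := hPW.end_zero gb (hend 0 h0).2
    rw [← this]; congr 1; ring
  · intro q hq i h1 h2
    rw [Bool.eq_iff_iff, ← not_iff_not]
    simp only [Bool.not_eq_true]
    constructor
    · intro hi
      obtain ⟨p, hp, a1, a2⟩ := hPW.cover _ hi
      obtain ⟨b1, b2⟩ := hin q hq p hp _ (by omega) (by omega) a1 a2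
      have := hV.eq_pattern hb hP hb' hQ hsub hq h0 (t := p - q) (by omega) (by omega)
        (by simpa using hp)
      rw [hPW.occ' this (by omega) (by omega), ← hi, hPW.occ' hp a1 a2]
      congr 1; ring
    · intro hi
      obtain ⟨p, hp, a1, a2⟩ := hPW.cover _ hi
      obtain ⟨b1, b2⟩ := hin 0 h0 p hp _ h1 (by omega) a1 a2
      have := hV.eq_pattern hb hP hb' hQ hsub h0 hq (t := p) (by omega) (by omega)
        (by simpa using hp)
      rw [hPW.occ' this (by omega) (by omega), ← hi, hPW.occ' hp a1 a2]
      congr 1; ring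
  · intro i hi
    obtain ⟨p, hp, a1, a2⟩ := hPW.cover _ hi
    obtain ⟨q, hq, b1, b2⟩ := hQ.cover _ (hP.start_zero hb hp)
    refine ⟨q, hq, by omega, ?_⟩
    rcases lt_trichotomy p (q + h' - h) with c | c | c
    · omega
    · omega
    · have := hP.disj _ (hend q hq).2 _ hp c
      omega
  · intro q hq q' hq' hlt
    have a1 := hQ.disj _ hq _ hq' hlt
    have := hPW.disj _ (hend q hq).2 _ (hsub hq') (by omega)
    omega

/-- A word is determined by a base and the block belonging to it; so, given the base and a bound on
the length of the block, there are finitely many words. -/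
theorem finite_common_base (hV : IsNondegenerateRankOne V) (A : ℤ) :
    {W | IsNondegenerateRankOne W ∧
      ∃ P s, IsBase V P ∧ IsBase W P ∧ FirstGap P s ∧ s ≤ A}.Finite := by
  classical
  have h1 : {P | IsBase V P ∧ ∃ s, FirstGap P s ∧ s ≤ A}.Finite := by
    have : {P | IsBase V P ∧ ∃ s, FirstGap P s ∧ s ≤ A} ⊆
        ⋃ s ∈ Set.Icc 0 A, {P | IsBase V P ∧ FirstGap P s} := by
      rintro P ⟨hP, s, hs, hsA⟩
      simp only [mem_iUnion]
      exact ⟨s, ⟨hs.1.le, hsA⟩, hP, hs⟩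
    refine Set.Finite.subset ((Set.finite_Icc 0 A).biUnion fun s _ => ?_) this
    exact Set.Subsingleton.finite fun P hP Q hQ => hV.base_eq_of_firstGap hP.1 hQ.1 hP.2 hQ.2
  have h2 := List.finite_length_lt Bool (A.toNat + 1)
  refine (h1.image2 (fun P w n => fillWord w.length (letters w) (fun p => decide (p ∈ P)) (n : ℕ))
    h2).subset ?_
  rintro W ⟨hW, P, s, hPV, ⟨h, f, hb, hP⟩, hs, hsA⟩
  have hl := hW.length_le_firstGap hb hP hs
  have hpos := hb.pos
  refine ⟨P, ⟨hPV, s, hs, hsA⟩, blockList h f, ?_, ?_⟩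
  · have := length_blockList hb
    simp only [mem_ofPred_eq]
    omega
  · have hP' : IsTiling (blockList h f).length (letters (blockList h f)) (extWord W) P := by
      rw [length_blockList hb]
      exact hP.congr fun i h0 h1 => (letters_blockList h0 h1).symm
    rw [← setOf_indicator_eq P] at hP'
    funext n
    simp only
    rw [← hP'.eq_fillWord, extWord_natCast]

end IsNondegenerateRankOne

/-! ### Coding a word by its bases -/

/-- The base of `V` with first gap `i` is the parent of the one with first gap `k`: it is the base
with the largest first gap below `k` that contains the latter.  The number `t < k` belongs to the
parent. -/
def ParentBit (V : ℕ → Bool) (k i t : ℤ) : Prop :=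
  ∃ Q P, IsBase V Q ∧ IsBase V P ∧ FirstGap Q k ∧ FirstGap P i ∧ Q ⊆ P ∧ i < k ∧
    (∀ P' i', IsBase V P' → FirstGap P' i' → Q ⊆ P' → i' < k → i' ≤ i) ∧ t ∈ P ∧ t < k

namespace IsNondegenerateRankOne

variable {V W : ℕ → Bool} {P Q : Set ℤ} {s : ℤ}

/-- The codes of words with a common base agree from some stage on, because from some stage on
parents are contained in the common base. -/
theorem exists_parentBit_imp (hV : IsNondegenerateRankOne V) (hW : IsNondegenerateRankOne W)
    (hPV : IsBase V P) (hPW : IsBase W P) :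
    ∃ K, ∀ k ≥ K, ∀ i t, ParentBit V k i t → ParentBit W k i t := by
  obtain ⟨N, hN⟩ := hV.exists_subset_of_firstGap_ge hPV
  obtain ⟨N', hN'⟩ := hW.exists_subset_of_firstGap_ge hPW
  obtain ⟨P₁, s₁, hP₁, hs₁, hNs⟩ := hV.exists_base_ge (max N N')
  obtain ⟨M, hM⟩ := hV.exists_subset_of_firstGap_ge hP₁
  refine ⟨max M (s₁ + 1), fun k hk i t => ?_⟩
  rintro ⟨Q, R, hQ, hR, hQk, hRi, hQR, hik, hmax, ht, htk⟩
  have hQP₁ := hM Q k hQ hQk (by omega)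
  have hi : s₁ ≤ i := hmax P₁ s₁ hP₁ hs₁ hQP₁ (by omega)
  have hQP := hN Q k hQ hQk (by omega)
  have hRP := hN R i hR hRi (by omega)
  refine ⟨Q, R, hV.isBase_of_subset hPV hPW hQ hQP, hV.isBase_of_subset hPV hPW hR hRP, hQk, hRi,
    hQR, hik, fun P' i' hP' hi' hQP' hik' => ?_, ht, htk⟩
  rcases lt_or_ge i' N' with c | c
  · omega
  · exact hmax P' i' (hW.isBase_of_subset hPW hPV hP' (hN' P' i' hP' hi' c)) hi' hQP' hik'

theorem exists_parentBit_iff (hV : IsNondegenerateRankOne V) (hW : IsNondegenerateRankOne W)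
    (hPV : IsBase V P) (hPW : IsBase W P) :
    ∃ K, ∀ k ≥ K, ∀ i t, ParentBit V k i t ↔ ParentBit W k i t := by
  obtain ⟨K, hK⟩ := hV.exists_parentBit_imp hW hPV hPW
  obtain ⟨K', hK'⟩ := hW.exists_parentBit_imp hV hPW hPV
  exact ⟨max K K', fun k hk i t => ⟨hK k (by omega) i t, hK' k (by omega) i t⟩⟩

/-- A base that is contained in one with a smaller first gap has a parent. -/
theorem exists_parent {P₀ : Set ℤ} {s₀ : ℤ} (hP₀ : IsBase V P₀)
    (hs₀ : FirstGap P₀ s₀) (hQ : IsBase V Q) (hs : FirstGap Q s) (hsub : Q ⊆ P₀) (hlt : s₀ < s) :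
    ∃ P i, IsBase V P ∧ FirstGap P i ∧ Q ⊆ P ∧ i < s ∧ s₀ ≤ i ∧
      ∀ t ∈ P, t < s → ParentBit V s i t := by
  obtain ⟨i, ⟨P, hP, hi, hQP, his⟩, hmax⟩ := Int.exists_greatest_of_bdd
    (P := fun i => ∃ P, IsBase V P ∧ FirstGap P i ∧ Q ⊆ P ∧ i < s)
    ⟨s, fun z ⟨_, _, _, _, hz⟩ => hz.le⟩ ⟨s₀, P₀, hP₀, hs₀, hsub, hlt⟩
  refine ⟨P, i, hP, hi, hQP, his, hmax s₀ ⟨P₀, hP₀, hs₀, hsub, hlt⟩, fun t ht hts => ?_⟩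
  exact ⟨Q, P, hQ, hP, hs, hi, hQP, his,
    fun P' i' h1 h2 h3 h4 => hmax i' ⟨P', h1, h2, h3, h4⟩, ht, hts⟩

/-- If the codes of `V` and `W` agree from stage `K` on, then `V` and `W` have a common base, whose
first gap is bounded in terms of `V` and `K`.  Descending from a base of large first gap `n` along
the parents, one finds a base with bounded first gap whose part below `n` is the same for `V` and
`W`; by the pigeonhole principle, one of the finitely many bases with bounded first gap occurs for
arbitrarily large `n`. -/
theorem exists_common_base_of_parentBit (hV : IsNondegenerateRankOne V) (K : ℤ) :
    ∃ A, ∀ W, IsNondegenerateRankOne W →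
      (∀ k ≥ K, ∀ i t, ParentBit V k i t ↔ ParentBit W k i t) →
      ∃ P s, IsBase V P ∧ IsBase W P ∧ FirstGap P s ∧ s ≤ A := by
  have hZ := isBase_zeros V
  obtain ⟨r, hr⟩ := hV.exists_firstGap hZ
  obtain ⟨P₁, s₁, hP₁, hs₁, hK₁⟩ := hV.exists_base_ge (max K (r + 1))
  obtain ⟨N, hN⟩ := hV.exists_subset_of_firstGap_ge hP₁
  refine ⟨max N s₁, fun W hW hVW => ?_⟩
  have claim : ∀ n : ℕ, max K (r + 1) ≤ n → ∀ Q, IsBase V Q → FirstGap Q n →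
      ∃ Q', IsBase W Q' ∧ FirstGap Q' n ∧ ∃ P P' a, IsBase V P ∧ IsBase W P' ∧ FirstGap P a ∧
        FirstGap P' a ∧ a ≤ max N s₁ ∧ Q ⊆ P ∧ Q' ⊆ P' ∧ ∀ t < (n : ℤ), t ∈ P ↔ t ∈ P' := by
    intro n
    induction n using Nat.strong_induction_on with
    | _ n ih =>
      intro hn Q hQ hQn
      have hn0 := hQn.1
      obtain ⟨R, i, hR, hRi, hQR, hin, hri, hbit⟩ := exists_parent hZ hr hQ hQn
        (base_subset_zeros hQ) (by omega)
      obtain ⟨Q', R', hQ', hR', hQn', hRi', hQR', -, -, -, -⟩ :=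
        (hVW n (by omega) i 0).1 (hbit 0 (hV.zero_mem_base hR) (by omega))
      have hRR : ∀ t < (n : ℤ), t ∈ R ↔ t ∈ R' := by
        intro t ht
        constructor
        · intro htR
          obtain ⟨_, R₂, -, hR₂, -, hR₂i, -, -, -, ht₂, -⟩ :=
            (hVW n (by omega) i t).1 (hbit t htR ht)
          rwa [hW.base_eq_of_firstGap hR' hR₂ hRi' hR₂i]
        · intro htR
          obtain ⟨Q₃, R₃, hQ₃, hR₃, hQ₃n, hR₃i, hQR₃, h3, h3', -, -⟩ :=
            (hVW n (by omega) i 0).1 (hbit 0 (hV.zero_mem_base hR) (by omega))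
          have e := hW.base_eq_of_firstGap hR' hR₃ hRi' hR₃i
          obtain ⟨_, R₂, -, hR₂, -, hR₂i, -, -, -, ht₂, -⟩ :=
            (hVW n (by omega) i t).2
              ⟨Q₃, R₃, hQ₃, hR₃, hQ₃n, hR₃i, hQR₃, h3, h3', e ▸ htR, ht⟩
          rwa [hV.base_eq_of_firstGap hR hR₂ hRi hR₂i]
      refine ⟨Q', hQ', hQn', ?_⟩
      rcases le_or_gt (n : ℤ) (max N s₁) with hA | hA
      · refine ⟨Q, Q', n, hQ, hQ', hQn, hQn', hA, subset_rfl, subset_rfl, fun t ht => ?_⟩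
        have key : ∀ {U : ℕ → Bool} {B : Set ℤ}, IsNondegenerateRankOne U → IsBase U B →
            FirstGap B n → (t ∈ B ↔ t = 0) := by
          intro U B hU hB hBn
          constructor
          · intro htB
            have := hB.nonneg htB
            by_contra hne
            have := hBn.2.2 t htB (by omega)
            omega
          · rintro rfl
            exact hU.zero_mem_base hB
        rw [key hV hQ hQn, key hW hQ' hQn']
      · -- The base `P₁` contains `Q`, so the first gap of the parent of `Q` is at least that of
        -- `P₁`.
        have hi : s₁ ≤ i := by
          obtain ⟨_, _, hB₁, hB₂, hB₃, hB₄, hB₅, hB₆, hmax, -, -⟩ :=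
            hbit 0 (hV.zero_mem_base hR) (by omega)
          refine hmax P₁ s₁ hP₁ hs₁ ?_ (by omega)
          rw [hV.base_eq_of_firstGap hB₁ hQ hB₃ hQn]
          exact hN Q n hQ hQn (by omega)
        have hipos := hRi.1
        obtain ⟨i, rfl⟩ := Int.eq_ofNat_of_zero_le hipos.le
        obtain ⟨R₃, hR₃, hR₃i, P, P', a, hP, hP', hPa, hPa', haA, hRP, hRP', hPP⟩ :=
          ih i (by omega) (by omega) R hR hRi
        rw [hW.base_eq_of_firstGap hR₃ hR' hR₃i hRi'] at hRP'
        refine ⟨P, P', a, hP, hP', hPa, hPa', haA, hQR.trans hRP, hQR'.trans hRP', fun t ht => ?_⟩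
        rw [hV.mem_iff_of_subset hP hR hRP hRi, hW.mem_iff_of_subset hP' hR' hRP' hRi']
        constructor
        · rintro ⟨q, hq, t', ht', hti, rfl⟩
          have := hP.nonneg ht'
          exact ⟨q, (hRR q (by omega)).1 hq, t', (hPP t' hti).1 ht', hti, rfl⟩
        · rintro ⟨q, hq, t', ht', hti, rfl⟩
          have := hP'.nonneg ht'
          exact ⟨q, (hRR q (by omega)).2 hq, t', (hPP t' hti).2 ht', hti, rfl⟩
  by_contra! hno
  have hdiff : ∀ a : ℤ, ∃ M : ℤ, a ≤ max N s₁ → ∀ P P', IsBase V P → IsBase W P' →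
      FirstGap P a → FirstGap P' a → ∃ t < M, ¬ (t ∈ P ↔ t ∈ P') := by
    intro a
    by_cases hex : a ≤ max N s₁ ∧
      ∃ P P', IsBase V P ∧ IsBase W P' ∧ FirstGap P a ∧ FirstGap P' a
    · obtain ⟨haA, P, P', hP, hP', hPa, hPa'⟩ := hex
      have hne : P ≠ P' := by
        rintro rfl
        have := hno P a hP hP' hPa
        omega
      obtain ⟨t, ht⟩ : ∃ t, ¬ (t ∈ P ↔ t ∈ P') := by
        by_contra! hall
        exact hne (Set.ext hall)
      refine ⟨t + 1, fun _ P₂ P₂' h1 h2 h3 h4 => ⟨t, by omega, ?_⟩⟩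
      rwa [hV.base_eq_of_firstGap h1 hP h3 hPa, hW.base_eq_of_firstGap h2 hP' h4 hPa']
    · exact ⟨0, fun haA P P' h1 h2 h3 h4 => absurd ⟨haA, P, P', h1, h2, h3, h4⟩ hex⟩
  choose M hM using hdiff
  obtain ⟨B, hB⟩ := Finset.exists_le ((Finset.Icc 0 (max N s₁)).image M)
  obtain ⟨Q, n, hQ, hQn, hn⟩ := hV.exists_base_ge (max B (max K (r + 1)))
  obtain ⟨n, rfl⟩ := Int.eq_ofNat_of_zero_le hQn.1.le
  obtain ⟨-, -, -, P, P', a, hP, hP', hPa, hPa', haA, -, -, hPP⟩ := claim n (by omega) Q hQ hQn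
  obtain ⟨t, ht, hne⟩ := hM a haA P P' hP hP' hPa hPa'
  have := hB (M a) (Finset.mem_image_of_mem M (Finset.mem_Icc.2 ⟨hPa.1.le, haA⟩))
  exact hne (hPP t (by omega))

end IsNondegenerateRankOne

/-! ### The space of non-degenerate rank-1 words -/

theorem NondegenerateRankOneWord.isNondegenerate (V : NondegenerateRankOneWord) :
    IsNondegenerateRankOne V.1.word :=
  IsRankOne.isNondegenerateRankOne V.1.2 V.2

theorem isOpen_builtFrom (v : List Bool) :
    IsOpen {V : NondegenerateRankOneWord | BuiltFrom V.1.word v} := by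
  by_cases hv : v ∈ zeroWords
  · have : IsOpen {V : RankOneWord | BuiltFrom V.word v} :=
      TopologicalSpace.isOpen_generateFrom_of_mem ⟨v, hv, rfl⟩
    exact this.preimage continuous_subtype_val
  · convert isOpen_empty
    ext V
    simp only [mem_ofPred_eq, mem_empty_iff_false, iff_false]
    exact fun h => hv h.1

theorem continuous_word :
    Continuous fun V : NondegenerateRankOneWord => V.1.word := by
  refine continuous_pi fun i => continuous_discrete_rng.2 fun b => ?_
  rw [isOpen_iff_forall_mem_open]
  intro V hV
  obtain ⟨v, hv, hVv⟩ := IsRankOne.exists_builtFrom V.1.2 (i + 1)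
  refine ⟨_, fun W hW => ?_, isOpen_builtFrom v, hVv⟩
  have key : ∀ U : NondegenerateRankOneWord, BuiltFrom U.1.word v → U.1.word i = letters v i := by
    intro U hU
    obtain ⟨-, -, P, hP⟩ := hU.exists_tiling
    rw [U.isNondegenerate.letter_eq (isBlock_letters hU.1) hP (by positivity) (by omega),
      extWord_natCast]
  change W.1.word i = b
  rw [key W hW, ← key V hVv]
  exact hV

theorem continuous_extWord : Continuous extWord := by
  refine continuous_pi fun i => ?_
  by_cases hi : 0 ≤ i
  · simpa [extWord, hi] using continuous_apply i.toNat
  · simpa [extWord, hi] using continuous_const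

/-- The topology of the space is induced by the word `V` together with the set of words from which
`V` is built. -/
theorem isInducing_word_builtFrom :
    IsInducing fun V : NondegenerateRankOneWord =>
      ((V.1.word, fun v => open Classical in decide (BuiltFrom V.1.word v)) :
        (ℕ → Bool) × (List Bool → Bool)) := by
  classical
  refine ⟨le_antisymm ?_ ?_⟩
  · rw [← continuous_iff_le_induced]
    refine continuous_word.prodMk (continuous_pi fun v => (continuous_bool_rng true).2 ⟨?_, ?_⟩)
    · have e : (fun V : NondegenerateRankOneWord => decide (BuiltFrom V.1.word v)) ⁻¹' {true} =
          {V | v ∈ zeroWords} ∩ (fun V : NondegenerateRankOneWord => extWord V.1.word) ⁻¹'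
            {x | ∃ P, IsTiling v.length (letters v) x P} := by
        ext V
        simp [V.isNondegenerate.builtFrom_iff]
      rw [e]
      exact (isClosed_const (p := v ∈ zeroWords)).inter
        ((isClosed_exists_tiling _ _).preimage (continuous_extWord.comp continuous_word))
    · convert isOpen_builtFrom v using 1
      ext V; simp
  · change _ ≤ TopologicalSpace.induced Subtype.val (TopologicalSpace.generateFrom _)
    rw [induced_generateFrom_eq, TopologicalSpace.le_generateFrom_iff_subset_isOpen]
    rintro _ ⟨_, ⟨v, hv, rfl⟩, rfl⟩
    refine ⟨{p | p.2 v = true}, ?_, ?_⟩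
    · exact (isOpen_discrete ({true} : Set Bool)).preimage
        ((continuous_apply (A := fun _ : List Bool => Bool) v).comp continuous_snd)
    · ext V; simp

/-- The subspace embeds as a closed subspace of a product of open subspaces. -/
theorem IsGδ.polishSpace_coe {α : Type*} [TopologicalSpace α] [PolishSpace α] {s : Set α}
    (hs : IsGδ s) : PolishSpace s := by
  obtain ⟨U, hU, rfl⟩ := isGδ_iff_eq_iInter_nat.1 hs
  have : ∀ n, PolishSpace (U n) := fun n => (hU n).polishSpace
  let F : (⋂ n, U n : Set α) → ∀ n, U n := fun x n => ⟨x.1, mem_iInter.1 x.2 n⟩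
  have hF : Continuous F := continuous_pi fun n => continuous_subtype_val.subtype_mk _
  have hproj : Continuous fun y : ∀ n, U n => (y 0).1 :=
    continuous_subtype_val.comp (continuous_apply 0)
  have hind : IsInducing F := by
    refine IsInducing.of_comp hF hproj ?_
    exact IsInducing.subtypeVal
  refine (⟨⟨hind, fun x y hxy => Subtype.ext
    (congrArg (fun y : ∀ n, U n => (y 0).1) hxy)⟩, ?_⟩ :
    IsClosedEmbedding F).polishSpace
  have e : Set.range F = ⋂ n, {y | (y n).1 = (y 0).1} := by
    ext y
    simp only [mem_range, mem_iInter, mem_ofPred_eq]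
    constructor
    · rintro ⟨x, rfl⟩ n; rfl
    · intro hy
      refine ⟨⟨(y 0).1, mem_iInter.2 fun n => hy n ▸ (y n).2⟩, ?_⟩
      funext n
      exact Subtype.ext (hy n).symm
  rw [e]
  exact isClosed_iInter fun n =>
    isClosed_eq (continuous_subtype_val.comp (continuous_apply n)) hproj

theorem infinite_iff_encode (S : Set (List Bool)) :
    S.Infinite ↔ ∀ N : ℕ, ∃ v, N ≤ Encodable.encode v ∧ v ∈ S := by
  constructor
  · intro hS N
    by_contra! hno
    refine hS (((Set.finite_Iio N).preimage Encodable.encode_injective.injOn).subset fun v hv => ?_)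
    by_contra hlt
    exact hno v (by simpa using hlt) hv
  · intro hS hfin
    obtain ⟨N, hN⟩ := (hfin.image Encodable.encode).bddAbove
    obtain ⟨v, hv, hvS⟩ := hS (N + 1)
    have := hN (mem_image_of_mem _ hvS)
    omega

/-- That a sequence is a non-degenerate rank-1 word, and that a set of finite words is the set of
those from which it is built, are countably many open or closed conditions. -/
theorem isGδ_range_word_builtFrom :
    IsGδ (Set.range fun V : NondegenerateRankOneWord =>
      ((V.1.word, fun v => open Classical in decide (BuiltFrom V.1.word v)) :
        (ℕ → Bool) × (List Bool → Bool))) := by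
  classical
  have c1 : ∀ (i : ℕ) (b : Bool), IsClopen {p : (ℕ → Bool) × (List Bool → Bool) | p.1 i = b} :=
    fun i b => (isClopen_discrete ({b} : Set Bool)).preimage
      ((continuous_apply (A := fun _ : ℕ => Bool) i).comp continuous_fst)
  have c2 : ∀ (v : List Bool) (b : Bool),
      IsClopen {p : (ℕ → Bool) × (List Bool → Bool) | p.2 v = b} :=
    fun v b => (isClopen_discrete ({b} : Set Bool)).preimage
      ((continuous_apply (A := fun _ : List Bool => Bool) v).comp continuous_snd)
  have c3 : ∀ v : List Bool, IsClosed {p : (ℕ → Bool) × (List Bool → Bool) |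
      v ∈ zeroWords ∧ ∃ P, IsTiling v.length (letters v) (extWord p.1) P} := fun v =>
    (isClosed_const (p := v ∈ zeroWords)).inter
      ((isClosed_exists_tiling _ _).preimage (continuous_extWord.comp continuous_fst))
  have e : (Set.range fun V : NondegenerateRankOneWord =>
      ((V.1.word, fun v => decide (BuiltFrom V.1.word v)) : (ℕ → Bool) × (List Bool → Bool))) =
      {p | p.1 0 = false} ∩ (⋂ N : ℕ, ⋃ n ≥ N, {p | p.1 n = false}) ∩
      (⋂ v : List Bool, ({p | p.2 v = true → v ∈ zeroWords ∧
        ∃ P, IsTiling v.length (letters v) (extWord p.1) P} ∩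
        {p | (v ∈ zeroWords ∧ ∃ P, IsTiling v.length (letters v) (extWord p.1) P) →
          p.2 v = true})) ∩
      (⋂ N : ℕ, ⋃ v ∈ {v : List Bool | N ≤ Encodable.encode v}, {p | p.2 v = true}) ∩
      ⋂ c ∈ Set.Ioi 0, (⋂ i, {p | p.1 (i + c) = p.1 i})ᶜ := by
    ext p
    simp only [mem_range, mem_inter_iff, mem_iInter, mem_iUnion, mem_compl_iff, mem_ofPred_eq,
      exists_prop, mem_Ioi]
    constructor
    · rintro ⟨V, rfl⟩
      have hV := V.isNondegenerate
      have hinf := (infinite_iff_encode _).1 V.1.2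
      refine ⟨⟨⟨⟨hV.first, hV.zeros⟩, fun v => ?_⟩, fun N => ?_⟩, fun c hc hp => ?_⟩
      · simp only [decide_eq_true_iff, hV.builtFrom_iff]
        exact ⟨id, id⟩
      · obtain ⟨v, hv, hvV⟩ := hinf N
        exact ⟨v, hv, decide_eq_true hvV⟩
      · exact hV.aperiodic ⟨c, hc, hp⟩
    · rintro ⟨⟨⟨⟨h0, hz⟩, hv⟩, hinf⟩, hap⟩
      have hbf : ∀ v, p.2 v = true ↔ BuiltFrom p.1 v := fun v =>
        ⟨fun hpv => builtFrom_of_tiling ((hv v).1 hpv).1 h0 hz ((hv v).1 hpv).2.choose_spec,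
          fun hpv => (hv v).2 ⟨hpv.1, hpv.exists_tiling.2.2⟩⟩
      have hR : IsRankOne p.1 := by
        refine (infinite_iff_encode _).2 fun N => ?_
        obtain ⟨v, hNv, hpv⟩ := hinf N
        exact ⟨v, hNv, (hbf v).1 hpv⟩
      have hD : ¬ IsDegenerate p.1 := by
        rw [isDegenerate_iff]
        rintro ⟨c, hc, hp⟩
        exact hap c hc hp
      refine ⟨⟨⟨p.1, hR⟩, hD⟩, Prod.ext rfl (funext fun v => ?_)⟩
      rw [Bool.eq_iff_iff, hbf, decide_eq_true_iff]
      rfl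
  rw [e]
  refine ((((c1 0 false).isOpen.isGδ.inter (.iInter_of_isOpen fun N => ?_)).inter
    (.iInter fun v => .inter ?_ ?_)).inter (.iInter_of_isOpen fun N => ?_)).inter
    (.biInter (to_countable _) fun c _ => ?_)
  · exact isOpen_biUnion fun n _ => (c1 n false).isOpen
  · exact (isClosed_imp (c2 v true).isOpen (c3 v)).isGδ
  · refine IsOpen.isGδ ?_
    have : {p : (ℕ → Bool) × (List Bool → Bool) | (v ∈ zeroWords ∧
        ∃ P, IsTiling v.length (letters v) (extWord p.1) P) → p.2 v = true} =
        {p | v ∈ zeroWords ∧ ∃ P, IsTiling v.length (letters v) (extWord p.1) P}ᶜ ∪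
          {p | p.2 v = true} := by
      ext p; simp only [mem_ofPred_eq, mem_union, mem_compl_iff, imp_iff_not_or]
    rw [this]
    exact (c3 v).isOpen_compl.union (c2 v true).isOpen
  · exact isOpen_biUnion fun v _ => (c2 v true).isOpen
  · refine IsOpen.isGδ (IsClosed.isOpen_compl (self := isClosed_iInter fun i => ?_))
    exact isClosed_eq ((continuous_apply _).comp continuous_fst)
      ((continuous_apply _).comp continuous_fst)

theorem polishSpace_nondegenerateRankOneWord : PolishSpace NondegenerateRankOneWord := by
  have hemb : IsEmbedding fun V : NondegenerateRankOneWord =>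
      ((V.1.word, fun v => open Classical in decide (BuiltFrom V.1.word v)) :
        (ℕ → Bool) × (List Bool → Bool)) :=
    ⟨isInducing_word_builtFrom, fun V W h =>
      Subtype.ext (Subtype.ext (congrArg Prod.fst h))⟩
  have p1 : PolishSpace (ℕ → Bool) := {}
  have p2 : PolishSpace (List Bool → Bool) := {}
  have := isGδ_range_word_builtFrom.polishSpace_coe
  exact hemb.toHomeomorph.isClosedEmbedding.polishSpace

/-! ### The isomorphism relation is F-sigma -/

theorem IsNondegenerateRankOne.isBase_iff {V : ℕ → Bool} (hV : IsNondegenerateRankOne V)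
    {P : Set ℤ} :
    IsBase V P ↔ ∃ v, BuiltFrom V v ∧ IsTiling v.length (letters v) (extWord V) P := by
  constructor
  · rintro ⟨h, f, hb, hP⟩
    have hP' : IsTiling (blockList h f).length (letters (blockList h f)) (extWord V) P := by
      rw [length_blockList hb]
      exact hP.congr fun i h0 h1 => (letters_blockList h0 h1).symm
    exact ⟨_, hV.builtFrom_iff.2 ⟨hb.blockList_mem, P, hP'⟩, hP'⟩
  · rintro ⟨v, hv, hP⟩
    exact ⟨_, _, isBlock_letters hv.1, hP⟩

theorem isClosed_exists_common_tiling (h : ℤ) (f : ℤ → Bool) (h' : ℤ) (f' : ℤ → Bool) :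
    IsClosed {z : (ℤ → Bool) × (ℤ → Bool) | ∃ P, IsTiling h f z.1 P ∧ IsTiling h' f' z.2 P} := by
  classical
  have c1 : Continuous fun z : ((ℤ → Bool) × (ℤ → Bool)) × (ℤ → Bool) => (z.1.1, z.2) := by
    fun_prop
  have c2 : Continuous fun z : ((ℤ → Bool) × (ℤ → Bool)) × (ℤ → Bool) => (z.1.2, z.2) := by
    fun_prop
  have := isClosedMap_fst_of_compactSpace (X := (ℤ → Bool) × (ℤ → Bool)) (Y := ℤ → Bool) _
    (((isClosed_isTiling h f).preimage c1).inter ((isClosed_isTiling h' f').preimage c2))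
  convert this using 1
  ext z
  constructor
  · rintro ⟨P, hP, hP'⟩
    refine ⟨(z, fun p => decide (p ∈ P)), ⟨?_, ?_⟩, rfl⟩
    · change IsTiling h f z.1 {p | (fun p => decide (p ∈ P)) p = true}
      rwa [setOf_indicator_eq]
    · change IsTiling h' f' z.2 {p | (fun p => decide (p ∈ P)) p = true}
      rwa [setOf_indicator_eq]
  · rintro ⟨⟨z, Q⟩, ⟨h1, h2⟩, rfl⟩
    exact ⟨_, h1, h2⟩

theorem rankOneIso_iff (V W : NondegenerateRankOneWord) :
    rankOneIso V W ↔ ∃ P, IsBase V.1.word P ∧ IsBase W.1.word P :=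
  V.isNondegenerate.isomorphic_iff W.isNondegenerate

theorem isFSigma_rankOneIso :
    IsFSigma {p : NondegenerateRankOneWord × NondegenerateRankOneWord | rankOneIso p.1 p.2} := by
  obtain ⟨e, he⟩ := exists_surjective_nat (List Bool × List Bool)
  refine ⟨fun k => {p | (e k).1 ∈ zeroWords ∧ (e k).2 ∈ zeroWords ∧
    ∃ P, IsTiling (e k).1.length (letters (e k).1) (extWord p.1.1.word) P ∧
      IsTiling (e k).2.length (letters (e k).2) (extWord p.2.1.word) P}, fun k => ?_, ?_⟩
  · have c : Continuous fun p : NondegenerateRankOneWord × NondegenerateRankOneWord =>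
        (extWord p.1.1.word, extWord p.2.1.word) :=
      (continuous_extWord.comp (continuous_word.comp continuous_fst)).prodMk
        (continuous_extWord.comp (continuous_word.comp continuous_snd))
    exact (isClosed_const (p := (e k).1 ∈ zeroWords)).inter
      ((isClosed_const (p := (e k).2 ∈ zeroWords)).inter
        ((isClosed_exists_common_tiling _ _ _ _).preimage c))
  · ext ⟨V, W⟩
    simp only [mem_ofPred_eq, mem_iUnion, rankOneIso_iff,
      V.isNondegenerate.isBase_iff, W.isNondegenerate.isBase_iff]
    constructor
    · rintro ⟨P, ⟨v, hv, hP⟩, w, hw, hP'⟩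
      obtain ⟨k, hk⟩ := he (v, w)
      refine ⟨k, ?_⟩
      rw [hk]
      exact ⟨hv.1, hw.1, P, hP, hP'⟩
    · rintro ⟨k, hv, hw, P, hP, hP'⟩
      exact ⟨P, ⟨_, V.isNondegenerate.builtFrom_iff.2 ⟨hv, P, hP⟩, hP⟩,
        ⟨_, W.isNondegenerate.builtFrom_iff.2 ⟨hw, P, hP'⟩, hP'⟩⟩

/-! ### Hyperfiniteness -/

/-- The positions of the tiles of `V` by the word `v`, when there is a tiling. -/
def tileSet (v : List Bool) (V : ℕ → Bool) : Set ℤ :=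
  {t | HasTile v.length (letters v) (extWord V) t}

theorem IsNondegenerateRankOne.eq_tileSet {V : ℕ → Bool} (hV : IsNondegenerateRankOne V)
    {v : List Bool} (hv : v ∈ zeroWords) {P : Set ℤ}
    (hP : IsTiling v.length (letters v) (extWord V) P) : P = tileSet v V := by
  ext t
  constructor
  · exact fun ht => ⟨P, hP, ht⟩
  · rintro ⟨Q, hQ, ht⟩
    rwa [hV.tiling_eq_of_length (isBlock_letters hv) (isBlock_letters hv) hP hQ]

theorem IsNondegenerateRankOne.isBase_iff_tileSet {V : ℕ → Bool} (hV : IsNondegenerateRankOne V)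
    {P : Set ℤ} : IsBase V P ↔ ∃ v, BuiltFrom V v ∧ P = tileSet v V := by
  rw [hV.isBase_iff]
  refine exists_congr fun v => and_congr_right fun hv => ?_
  constructor
  · exact hV.eq_tileSet hv.1
  · rintro rfl
    obtain ⟨-, -, P, hP⟩ := hv.exists_tiling
    rwa [← hV.eq_tileSet hv.1 hP]

/-- The relation `ParentBit` expressed by quantifiers over countable sets. -/
theorem IsNondegenerateRankOne.parentBit_iff {V : ℕ → Bool} (hV : IsNondegenerateRankOne V)
    (k i t : ℤ) : ParentBit V k i t ↔ ∃ v w, BuiltFrom V v ∧ BuiltFrom V w ∧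
      FirstGap (tileSet v V) k ∧ FirstGap (tileSet w V) i ∧
      (∀ p, p ∈ tileSet v V → p ∈ tileSet w V) ∧ i < k ∧
      (∀ w' i', BuiltFrom V w' → FirstGap (tileSet w' V) i' →
        (∀ p, p ∈ tileSet v V → p ∈ tileSet w' V) → i' < k → i' ≤ i) ∧
      t ∈ tileSet w V ∧ t < k := by
  unfold ParentBit
  simp only [hV.isBase_iff_tileSet]
  constructor
  · rintro ⟨_, _, ⟨v, hv, rfl⟩, ⟨w, hw, rfl⟩, h1, h2, h3, h4, h5, h6⟩
    exact ⟨v, w, hv, hw, h1, h2, h3, h4, fun w' i' hw' => h5 _ i' ⟨w', hw', rfl⟩, h6⟩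
  · rintro ⟨v, w, hv, hw, h1, h2, h3, h4, h5, h6⟩
    refine ⟨_, _, ⟨v, hv, rfl⟩, ⟨w, hw, rfl⟩, h1, h2, h3, h4, ?_, h6⟩
    rintro _ i' ⟨w', hw', rfl⟩
    exact h5 w' i' hw'

theorem measurableSet_parentBit [MeasurableSpace NondegenerateRankOneWord]
    [BorelSpace NondegenerateRankOneWord] (k i t : ℤ) :
    MeasurableSet {V : NondegenerateRankOneWord | ParentBit V.1.word k i t} := by
  have m1 : ∀ v, Measurable fun V : NondegenerateRankOneWord => BuiltFrom V.1.word v :=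
    fun v => measurableSet_setOfPred.1 (isOpen_builtFrom v).measurableSet
  have m2 : ∀ v t, Measurable fun V : NondegenerateRankOneWord => t ∈ tileSet v V.1.word :=
    fun v t => measurableSet_setOfPred.1 ((isClosed_hasTile _ _ t).preimage
      (continuous_extWord.comp continuous_word)).measurableSet
  have m3 : ∀ v s, Measurable fun V : NondegenerateRankOneWord =>
      FirstGap (tileSet v V.1.word) s := fun v s => by
    unfold FirstGap
    fun_prop
  simp only [fun V : NondegenerateRankOneWord => V.isNondegenerate.parentBit_iff k i t]
  rw [measurableSet_setOfPred]
  fun_prop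

/-- The bits of `ParentBit V` as a point of Cantor space; negative indices are dropped, since the
bits there vanish. -/
noncomputable def parentCode (V : ℕ → Bool) (n : ℕ) : Bool := open Classical in
  decide (ParentBit V n.unpair.1 n.unpair.2.unpair.1 n.unpair.2.unpair.2)

theorem parentCode_eq_iff {V W : ℕ → Bool} {n : ℕ} : parentCode V n = parentCode W n ↔
    (ParentBit V n.unpair.1 n.unpair.2.unpair.1 n.unpair.2.unpair.2 ↔
      ParentBit W n.unpair.1 n.unpair.2.unpair.1 n.unpair.2.unpair.2) := by
  simp [parentCode]

theorem ParentBit.bounds {V : ℕ → Bool} {k i t : ℤ} (hp : ParentBit V k i t) :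
    0 < k ∧ 0 < i ∧ 0 ≤ t ∧ i < k ∧ t < k := by
  obtain ⟨Q, P, hQ, hP, hQk, hPi, hQP, hik, hmax, ht, htk⟩ := hp
  exact ⟨hQk.1, hPi.1, hP.nonneg ht, hik, htk⟩

theorem eventualAgreement_parentCode {V W : ℕ → Bool} {K : ℤ}
    (hK : ∀ k ≥ K, ∀ i t, ParentBit V k i t ↔ ParentBit W k i t) :
    eventualAgreement (parentCode V) (parentCode W) := by
  have key : ∀ U k i t, ParentBit U (k : ℕ) (i : ℕ) (t : ℕ) → (k : ℤ) < K →
      Nat.pair k (Nat.pair i t) ≤ Nat.pair K.toNat (Nat.pair K.toNat K.toNat) := by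
    intro U k i t hp hk
    have := hp.bounds
    have hi : i < K.toNat := by omega
    have ht : t < K.toNat := by omega
    have hk : k < K.toNat := by omega
    exact ((Nat.pair_lt_pair_left _ hk).trans (Nat.pair_lt_pair_right _
      ((Nat.pair_lt_pair_left _ hi).trans (Nat.pair_lt_pair_right _ ht)))).le
  refine ⟨Nat.pair K.toNat (Nat.pair K.toNat K.toNat), fun n hn => parentCode_eq_iff.2 ?_⟩
  rcases le_or_gt K n.unpair.1 with c | c
  · exact hK _ c _ _
  · have e : Nat.pair n.unpair.1 (Nat.pair n.unpair.2.unpair.1 n.unpair.2.unpair.2) = n := by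
      simp
    have hno : ∀ U, ¬ ParentBit U n.unpair.1 n.unpair.2.unpair.1 n.unpair.2.unpair.2 :=
      fun U hp => by
        have := key U _ _ _ hp c
        omega
    exact iff_of_false (hno V) (hno W)

theorem parentBit_iff_of_parentCode_eq {V W : ℕ → Bool} {n : ℕ}
    (hn : ∀ m > n, parentCode V m = parentCode W m) :
    ∀ k ≥ (n + 1 : ℤ), ∀ i t, ParentBit V k i t ↔ ParentBit W k i t := by
  intro k hk i t
  have key : 0 ≤ i → 0 ≤ t → (ParentBit V k i t ↔ ParentBit W k i t) := by
    intro hi ht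
    lift i to ℕ using hi
    lift t to ℕ using ht
    lift k to ℕ using by omega
    have h1 := Nat.left_le_pair k (Nat.pair i t)
    have := parentCode_eq_iff.1 (hn (Nat.pair k (Nat.pair i t)) (by omega))
    simpa using this
  constructor
  · intro hp
    obtain ⟨-, hi, ht, -⟩ := hp.bounds
    exact (key hi.le ht).1 hp
  · intro hp
    obtain ⟨-, hi, ht, -⟩ := hp.bounds
    exact (key hi.le ht).2 hp

/-- The code is a reduction of isomorphism to eventual agreement. -/
theorem rankOneIso_iff_parentCode (V W : NondegenerateRankOneWord) :
    rankOneIso V W ↔ eventualAgreement (parentCode V.1.word) (parentCode W.1.word) := by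
  rw [rankOneIso_iff]
  constructor
  · rintro ⟨P, hV, hW⟩
    obtain ⟨K, hK⟩ := V.isNondegenerate.exists_parentBit_iff W.isNondegenerate hV hW
    exact eventualAgreement_parentCode hK
  · rintro ⟨n, hn⟩
    obtain ⟨A, hA⟩ := V.isNondegenerate.exists_common_base_of_parentBit (n + 1)
    obtain ⟨P, s, hV, hW, -⟩ := hA _ W.isNondegenerate (parentBit_iff_of_parentCode_eq hn)
    exact ⟨P, hV, hW⟩

theorem measurable_parentCode [MeasurableSpace NondegenerateRankOneWord]
    [BorelSpace NondegenerateRankOneWord] :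
    Measurable fun V : NondegenerateRankOneWord => parentCode V.1.word := by
  refine measurable_pi_iff.2 fun n => measurable_to_bool ?_
  convert measurableSet_parentBit n.unpair.1 n.unpair.2.unpair.1 n.unpair.2.unpair.2 using 1
  ext V
  simp [parentCode]

theorem borelReducible_rankOneIso_eventualAgreement :
    BorelReducible rankOneIso eventualAgreement := by
  let _ : MeasurableSpace NondegenerateRankOneWord := borel _
  have : BorelSpace NondegenerateRankOneWord := ⟨rfl⟩
  refine ⟨fun V => parentCode V.1.word, ?_, rankOneIso_iff_parentCode⟩
  rw [← BorelSpace.measurable_eq (α := ℕ → Bool)]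
  exact measurable_parentCode

theorem isHyperfinite_rankOneIso : IsHyperfinite rankOneIso := by
  refine ⟨fun n V W => ∀ m > n, parentCode V.1.word m = parentCode W.1.word m, fun n => ?_,
    fun n V W h m hm => h m (by omega), rankOneIso_iff_parentCode⟩
  refine ⟨⟨fun V m _ => rfl, fun h m hm => (h m hm).symm,
    fun h h' m hm => (h m hm).trans (h' m hm)⟩, ?_, fun V => ?_⟩
  · let _ : MeasurableSpace NondegenerateRankOneWord := borel _
    have : BorelSpace NondegenerateRankOneWord := ⟨rfl⟩
    let _ : MeasurableSpace (NondegenerateRankOneWord × NondegenerateRankOneWord) := borel _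
    have : BorelSpace (NondegenerateRankOneWord × NondegenerateRankOneWord) := ⟨rfl⟩
    have h1 : Measurable fun p : NondegenerateRankOneWord × NondegenerateRankOneWord =>
        parentCode p.1.1.word := measurable_parentCode.comp continuous_fst.measurable
    have h2 : Measurable fun p : NondegenerateRankOneWord × NondegenerateRankOneWord =>
        parentCode p.2.1.word := measurable_parentCode.comp continuous_snd.measurable
    have : {p : NondegenerateRankOneWord × NondegenerateRankOneWord |
        ∀ m > n, parentCode p.1.1.word m = parentCode p.2.1.word m} =
        ⋂ m ∈ Set.Ioi n, {p | parentCode p.1.1.word m = parentCode p.2.1.word m} := by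
      ext p; simp
    rw [this]
    exact MeasurableSet.biInter (to_countable _) fun m _ =>
      measurableSet_eq_fun ((measurable_pi_apply m).comp h1) ((measurable_pi_apply m).comp h2)
  · obtain ⟨A, hA⟩ := V.isNondegenerate.exists_common_base_of_parentBit (n + 1)
    refine ((V.isNondegenerate.finite_common_base A).preimage (f := fun W => W.1.word) ?_).subset
      fun W hW => ?_
    · exact fun W _ W' _ h => Subtype.ext (Subtype.ext h)
    · exact ⟨W.isNondegenerate, hA _ W.isNondegenerate (parentBit_iff_of_parentCode_eq hW)⟩

/-! ### The words given by points of Cantor space -/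

theorem letters_append (u w : List Bool) {i : ℤ} (hi : 0 ≤ i) :
    letters (u ++ w) i = if i < u.length then letters u i else letters w (i - u.length) := by
  lift i to ℕ using hi
  have e : (i - u.length : ℤ).toNat = i - u.length := by omega
  simp only [letters, Int.toNat_natCast, Nat.cast_lt, e]
  split_ifs with h
  · exact List.getD_append _ _ _ _ h
  · exact List.getD_append_right _ _ _ _ (not_lt.1 h)

theorem letters_singleton_true (i : ℤ) : letters [true] i = true := by
  simp only [letters]
  rcases i.toNat with _ | n <;> simp

theorem isTiling_padBlock_self (h : ℤ) (f : ℤ → Bool) : IsTiling h f (padBlock h f) {0} := by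
  refine ⟨?_, fun i hi => ⟨0, rfl, ?_⟩, ?_⟩
  · rintro p rfl i h0 h1
    rw [zero_add, padBlock, if_pos ⟨h0, h1⟩]
  · simp only [padBlock] at hi
    split_ifs at hi
    omega
  · rintro p rfl q rfl hlt
    exact absurd hlt (lt_irrefl 0)

section
variable (α β : ℕ → Bool) (m : ℕ)

/-- The number of ones between the first two copies of `stageWord α m` in `stageWord α (m + 1)`;
between the last two copies there are `1 - stageGap α m` ones. -/
def stageGap : ℤ := if α m = false then 1 else 0

theorem length_stageWord_succ :
    (stageWord α (m + 1)).length = 3 * (stageWord α m).length + 1 := by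
  simp only [stageWord]
  split_ifs <;> simp <;> ring

theorem length_stageWord_congr :
    (stageWord α m).length = (stageWord β m).length := by
  induction m with
  | zero => rfl
  | succ m ih => rw [length_stageWord_succ, length_stageWord_succ, ih]

theorem lt_length_stageWord : m < (stageWord α m).length := by
  induction m with
  | zero => simp [stageWord]
  | succ m ih => rw [length_stageWord_succ]; omega

theorem stageWord_mem : stageWord α m ∈ zeroWords := by
  induction m with
  | zero => simp [stageWord, zeroWords]
  | succ m ih =>
    obtain ⟨h1, h2⟩ := ih
    simp only [stageWord]
    split_ifs <;> simp only [zeroWords, mem_ofPred_eq, List.head?_append, List.getLast?_append,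
      h1, h2, Option.some_or, and_self]

theorem letters_stageWord_succ {i : ℤ} (hi : 0 ≤ i) : letters (stageWord α (m + 1)) i =
    if i < (stageWord α m).length then letters (stageWord α m) i
    else if i < (stageWord α m).length + stageGap α m then true
    else if i < 2 * (stageWord α m).length + stageGap α m then
      letters (stageWord α m) (i - ((stageWord α m).length + stageGap α m))
    else if i < 2 * (stageWord α m).length + 1 then true
    else letters (stageWord α m) (i - (2 * (stageWord α m).length + 1)) := by
  have hl := lt_length_stageWord α m
  simp only [stageWord, stageGap]
  generalize stageWord α m = v at *
  split_ifs <;> simp only [List.append_assoc]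
  all_goals
    repeat
      rw [letters_append _ _ (by omega)]
      try simp only [List.length_singleton, Nat.cast_one]
      first
      | rw [if_pos (by omega)]
      | rw [if_neg (by omega)]
    all_goals first
    | exact letters_singleton_true _
    | omega
    | congr 1 <;> omega

theorem isTiling_stageWord_succ :
    IsTiling (stageWord α m).length (letters (stageWord α m))
      (padBlock (stageWord α (m + 1)).length (letters (stageWord α (m + 1))))
      {(0 : ℤ), ((stageWord α m).length : ℤ) + stageGap α m,
        2 * ((stageWord α m).length : ℤ) + 1} := by
  have hl := length_stageWord_succ α m
  have hpos := lt_length_stageWord α m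
  have he : 0 ≤ stageGap α m ∧ stageGap α m ≤ 1 := by unfold stageGap; split_ifs <;> simp
  refine ⟨?_, fun i hi => ?_, ?_⟩
  · intro p hp i h0 h1
    have hp' : 0 ≤ p + i ∧ p + i < (stageWord α (m + 1)).length := by
      rcases hp with rfl | rfl | rfl <;> omega
    rw [padBlock, if_pos hp', letters_stageWord_succ α m hp'.1]
    rcases hp with rfl | rfl | rfl
    · rw [if_pos (by omega), zero_add]
    · rw [if_neg (by omega), if_neg (by omega), if_pos (by omega), add_sub_cancel_left]
    · rw [if_neg (by omega), if_neg (by omega), if_neg (by omega), if_neg (by omega),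
        add_sub_cancel_left]
  · simp only [padBlock] at hi
    split_ifs at hi with hi'
    rw [letters_stageWord_succ α m hi'.1] at hi
    split_ifs at hi with c1 c2 c3 c4
    · exact ⟨0, by simp, hi'.1, by omega⟩
    · exact ⟨_, .inr (.inl rfl), by omega, by omega⟩
    · exact ⟨_, .inr (.inr rfl), by omega, by omega⟩
  · rintro p (rfl | rfl | rfl) q (rfl | rfl | rfl) hpq <;> omega

variable {α β m}

theorem letters_stageWord_of_le {n : ℕ} (hmn : m ≤ n) {i : ℤ} (h0 : 0 ≤ i)
    (h1 : i < (stageWord α m).length) :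
    letters (stageWord α n) i = letters (stageWord α m) i := by
  induction n, hmn using Nat.le_induction with
  | base => rfl
  | succ n hmn ih =>
    have hlt : i < (stageWord α n).length := by
      clear ih
      induction n, hmn using Nat.le_induction with
      | base => exact h1
      | succ n hmn ih => rw [length_stageWord_succ]; omega
    rw [letters_stageWord_succ α n h0, if_pos hlt, ih]

theorem stageWord_congr (hαβ : ∀ i < m, α i = β i) : stageWord α m = stageWord β m := by
  induction m with
  | zero => rfl
  | succ m ih =>
    simp only [stageWord, hαβ m (by omega), ih fun i hi => hαβ i (by omega)]

/-- The infinite word with initial segments `stageWord α m`. -/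
def limitWord (α : ℕ → Bool) (i : ℕ) : Bool := letters (stageWord α i) i

theorem extWord_limitWord {i : ℤ} (h0 : 0 ≤ i) (h1 : i < (stageWord α m).length) :
    extWord (limitWord α) i = letters (stageWord α m) i := by
  lift i to ℕ using h0
  rw [extWord_natCast, limitWord]
  have := lt_length_stageWord α i
  rcases le_total m i with c | c
  · exact letters_stageWord_of_le c (by positivity) h1
  · exact (letters_stageWord_of_le c (by positivity) (by omega)).symm

theorem isInitialSegment_stageWord : IsInitialSegment (stageWord α m) (limitWord α) := by
  intro i hi
  rw [← extWord_natCast (limitWord α), extWord_limitWord (m := m) (by positivity)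
    (by exact_mod_cast hi), letters_natCast _ hi]

theorem tendsto_padBlock_stageWord (α : ℕ → Bool) :
    Filter.Tendsto (fun n => padBlock (stageWord α n).length (letters (stageWord α n)))
      Filter.atTop (𝓝 (extWord (limitWord α))) := by
  refine tendsto_pi_nhds.2 fun i => tendsto_const_nhds.congr' ?_
  filter_upwards [Filter.eventually_ge_atTop i.toNat] with n hn
  have := lt_length_stageWord α n
  rcases lt_or_ge i 0 with c | c
  · rw [extWord_of_neg _ c, padBlock, if_neg (by omega)]
  · rw [padBlock, if_pos (by omega), extWord_limitWord (m := n) c (by omega)]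

/-- If `α` and `β` agree from the place `m` on, then the blocks of stage `m` occur in both words at
the same places. -/
theorem exists_common_tiling_limitWord (hαβ : ∀ i ≥ m, α i = β i) :
    ∃ P, IsTiling (stageWord α m).length (letters (stageWord α m)) (extWord (limitWord α)) P ∧
      IsTiling (stageWord β m).length (letters (stageWord β m)) (extWord (limitWord β)) P := by
  have hbα := isBlock_letters (stageWord_mem α m)
  have hbβ := isBlock_letters (stageWord_mem β m)
  refine (isClosed_exists_common_tiling _ _ _ _).mem_of_tendsto
    ((tendsto_padBlock_stageWord α).prodMk_nhds (tendsto_padBlock_stageWord β)) ?_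
  filter_upwards [Filter.eventually_ge_atTop m] with n hmn
  induction n, hmn using Nat.le_induction with
  | base =>
    exact ⟨{0}, isTiling_padBlock_self _ _, isTiling_padBlock_self _ _⟩
  | succ n hmn ih =>
    obtain ⟨T, hTα, hTβ⟩ := ih
    refine ⟨_, hTα.refine hbα (isTiling_stageWord_succ α n), ?_⟩
    have hgap : stageGap α n = stageGap β n := by rw [stageGap, stageGap, hαβ n hmn]
    rw [length_stageWord_congr α β, hgap]
    exact hTβ.refine hbβ (isTiling_stageWord_succ β n)

theorem exists_tiling_limitWord (α : ℕ → Bool) (m : ℕ) : ∃ P,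
    IsTiling (stageWord α m).length (letters (stageWord α m)) (extWord (limitWord α)) P :=
  (exists_common_tiling_limitWord (α := α) (β := α) (fun _ _ => rfl)).imp fun _ h => h.1

theorem limitWord_zero (α : ℕ → Bool) : limitWord α 0 = false := rfl

theorem exists_limitWord_eq_false (α : ℕ → Bool) (N : ℕ) : ∃ n ≥ N, limitWord α n = false := by
  have hl := lt_length_stageWord α N
  refine ⟨(stageWord α N).length - 1, by omega, ?_⟩
  rw [← extWord_natCast (limitWord α), extWord_limitWord (m := N) (by omega) (by omega),
    ← (isBlock_letters (stageWord_mem α N)).last]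
  congr 1; omega

theorem builtFrom_stageWord (α : ℕ → Bool) (m : ℕ) : BuiltFrom (limitWord α) (stageWord α m) := by
  obtain ⟨P, hP⟩ := exists_tiling_limitWord α m
  exact builtFrom_of_tiling (stageWord_mem α m) (limitWord_zero α) (exists_limitWord_eq_false α) hP

theorem isRankOne_limitWord (α : ℕ → Bool) : IsRankOne (limitWord α) := by
  have hmono : StrictMono fun m => (stageWord α m).length :=
    strictMono_nat_of_lt_succ fun m => by rw [length_stageWord_succ]; omega
  exact (infinite_range_of_injective (f := stageWord α)
    fun m n h => hmono.injective (congrArg List.length h)).mono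
      (range_subset_iff.2 (builtFrom_stageWord α))

/-- A period `c` of the word would make all copies of a stage longer than `c` be followed by the
same letter, whereas both letters occur there. -/
theorem not_isDegenerate_limitWord (α : ℕ → Bool) : ¬ IsDegenerate (limitWord α) := by
  rw [isDegenerate_iff]
  rintro ⟨c, hc, hper⟩
  have hl := lt_length_stageWord α c
  have hl' := length_stageWord_succ α c
  have hb := isBlock_letters (stageWord_mem α c)
  set h : ℕ := (stageWord α c).length
  have hmul : ∀ k i, limitWord α (i + c * k) = limitWord α i := by
    intro k i
    induction k with
    | zero => rfl
    | succ k ih => rw [mul_add, mul_one, ← add_assoc, hper, ih]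
  have hlet : ∀ i : ℕ, i < 3 * h + 1 → limitWord α i = letters (stageWord α (c + 1)) i := by
    intro i hi
    rw [← extWord_natCast (limitWord α), extWord_limitWord (m := c + 1) (by omega) (by omega)]
  -- A copy of the initial segment of length `h ≥ c` at `q` makes the word repeat from `q` on.
  have hocc : ∀ q : ℕ, (∀ i < h, limitWord α (q + i) = limitWord α i) →
      ∀ i, limitWord α (q + i) = limitWord α i := by
    intro q hq i
    have e : i = i % c + c * (i / c) := (Nat.mod_add_div i c).symm
    have : i % c < c := Nat.mod_lt i hc
    rw [e, ← add_assoc, hmul, hmul, hq _ (by omega)]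
  have hstart : ∀ i < h, limitWord α i = letters (stageWord α c) i := fun i hi => by
    rw [← extWord_natCast (limitWord α), extWord_limitWord (m := c) (by omega) (by omega)]
  cases hα : α c with
  | false =>
    have hg : stageGap α c = 1 := by simp [stageGap, hα]
    have h1 : limitWord α h = true := by
      rw [hlet h (by omega), letters_stageWord_succ α c (by omega), hg, if_neg (by omega),
        if_pos (by omega)]
    have h2 : limitWord α (h + 1 + h) = false := by
      rw [hlet _ (by omega), letters_stageWord_succ α c (by omega), hg, if_neg (by omega),
        if_neg (by omega), if_neg (by omega), if_neg (by omega), ← hb.first]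
      congr 1; omega
    have h3 := hocc (h + 1) (fun i hi => by
      rw [hlet _ (by omega), letters_stageWord_succ α c (by omega), hg, if_neg (by omega),
        if_neg (by omega), if_pos (by omega), hstart i hi]
      congr 1; omega) h
    rw [h1, h2] at h3
    exact absurd h3 (by decide)
  | true =>
    have hg : stageGap α c = 0 := by simp [stageGap, hα]
    have h1 : limitWord α h = false := by
      rw [hlet h (by omega), letters_stageWord_succ α c (by omega), hg, if_neg (by omega),
        if_neg (by omega), if_pos (by omega), ← hb.first]
      congr 1; omega
    have h2 : limitWord α (h + h) = true := by
      rw [hlet _ (by omega), letters_stageWord_succ α c (by omega), hg, if_neg (by omega),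
        if_neg (by omega), if_neg (by omega), if_pos (by omega)]
    have h3 := hocc h (fun i hi => by
      rw [hlet _ (by omega), letters_stageWord_succ α c (by omega), hg, if_neg (by omega),
        if_neg (by omega), if_pos (by omega), hstart i hi]
      congr 1; omega) h
    rw [h1, h2] at h3
    exact absurd h3 (by decide)

theorem isNondegenerateRankOne_limitWord (α : ℕ → Bool) : IsNondegenerateRankOne (limitWord α) :=
  (isRankOne_limitWord α).isNondegenerateRankOne (not_isDegenerate_limitWord α)

/-- The word `limitWord α` as a point of the space of non-degenerate rank-1 words. -/
def limitPoint (α : ℕ → Bool) : NondegenerateRankOneWord :=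
  ⟨⟨limitWord α, isRankOne_limitWord α⟩, not_isDegenerate_limitWord α⟩

/-- If `limitWord α` is built from `v`, then so is some stage `m`, and hence every word that has the
same stage `m`. -/
theorem exists_forall_builtFrom {v : List Bool} (hv : BuiltFrom (limitWord α) v) :
    ∃ m, ∀ β : ℕ → Bool, (∀ i < m, α i = β i) → BuiltFrom (limitWord β) v := by
  have hα := isNondegenerateRankOne_limitWord α
  have hb := isBlock_letters hv.1
  obtain ⟨-, -, P, hP⟩ := hv.exists_tiling
  obtain ⟨N, hN⟩ := hα.exists_subset_of_long hb hP
  have hl := lt_length_stageWord α N.toNat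
  have hb' := isBlock_letters (stageWord_mem α N.toNat)
  obtain ⟨Q, hQ⟩ := exists_tiling_limitWord α N.toNat
  have hT := hP.pad_of_subset hb hb' hQ (hN _ _ _ (by omega) hb' hQ)
    (zero_mem_tiling hα.first hb' hQ)
  refine ⟨N.toNat, fun β hβ => ?_⟩
  obtain ⟨R, hR⟩ := exists_tiling_limitWord β N.toNat
  rw [← stageWord_congr hβ] at hR
  exact (isNondegenerateRankOne_limitWord β).builtFrom_iff.2 ⟨hv.1, _, hT.refine hb hR⟩

theorem continuous_limitPoint : Continuous limitPoint := by
  refine continuous_induced_rng.2 (continuous_generateFrom_iff.2 ?_)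
  rintro _ ⟨v, -, rfl⟩
  refine isOpen_iff_forall_mem_open.2 fun α hα => ?_
  obtain ⟨m, hm⟩ := exists_forall_builtFrom (α := α) hα
  refine ⟨{β | ∀ i < m, α i = β i}, fun β hβ => hm β hβ, ?_, fun _ _ => rfl⟩
  have : {β : ℕ → Bool | ∀ i < m, α i = β i} = (Set.Iio m).pi fun i => {α i} := by
    ext β
    simp [Set.mem_pi, eq_comm]
  rw [this]
  exact isOpen_set_pi (Set.finite_Iio m) fun i _ => isOpen_discrete _

/-- The first gap of the base of stage `m` tells `α m`. -/
theorem exists_base_stageWord (α : ℕ → Bool) (m : ℕ) : ∃ P, IsBase (limitWord α) P ∧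
    FirstGap P ((stageWord α m).length + stageGap α m) := by
  have hα := isNondegenerateRankOne_limitWord α
  have hb := isBlock_letters (stageWord_mem α m)
  have hb' := isBlock_letters (stageWord_mem α (m + 1))
  have hl := lt_length_stageWord α m
  have hl' := length_stageWord_succ α m
  have he : 0 ≤ stageGap α m ∧ stageGap α m ≤ 1 := by unfold stageGap; split_ifs <;> simp
  obtain ⟨Q, hQ⟩ := exists_tiling_limitWord α (m + 1)
  have hP := (isTiling_stageWord_succ α m).refine hb hQ
  have h0 := zero_mem_tiling hα.first hb' hQ
  refine ⟨_, ⟨_, _, hb, hP⟩, by omega, ⟨0, h0, _, .inr (.inl rfl), by ring⟩, fun t ht ht0 => ?_⟩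
  have h1 := hP.disj _ (zero_mem_tiling hα.first hb hP) _ ht ht0
  by_contra hlt
  have h2 := hP.start_zero hb ht
  rw [extWord_limitWord (m := m + 1) (by omega) (by omega), letters_stageWord_succ α m (by omega),
    if_neg (by omega), if_pos (by omega)] at h2
  exact absurd h2 (by decide)

/-- If both words have a common base, then all late bases of the one are bases of the other.  But if
`α m = 1` and `β m = 0`, then the second copy of stage `m` in the word of `α` starts at a
place where the word of `β` has a 1. -/
theorem exists_imp_of_common_base {P : Set ℤ} (hPα : IsBase (limitWord α) P)
    (hPβ : IsBase (limitWord β) P) :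
    ∃ n, ∀ m > n, α m = true → β m = true := by
  have hα := isNondegenerateRankOne_limitWord α
  obtain ⟨N, hN⟩ := hα.exists_subset_of_firstGap_ge hPα
  refine ⟨N.toNat, fun m hm hαm => ?_⟩
  by_contra hβm
  have hlm := lt_length_stageWord α m
  have hl := length_stageWord_congr α β m
  have hlβ := length_stageWord_succ β m
  obtain ⟨Q, hQ, hs⟩ := exists_base_stageWord α m
  have hgα : stageGap α m = 0 := by simp [stageGap, hαm]
  have hgβ : stageGap β m = 1 := by simp [stageGap, hβm]
  rw [hgα, add_zero] at hs
  have hQβ := hα.isBase_of_subset hPα hPβ hQ (hN Q _ hQ hs (by omega))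
  have h1 : extWord (limitWord β) (stageWord α m).length = false :=
    IsNondegenerateRankOne.base_subset_zeros hQβ hs.2.1
  rw [extWord_limitWord (m := m + 1) (by omega) (by omega), letters_stageWord_succ β m (by omega),
    hgβ, if_neg (by omega), if_pos (by omega)] at h1
  exact absurd h1 (by decide)

theorem isReduction_limitPoint : IsReduction eventualAgreement rankOneIso limitPoint := by
  intro α β
  rw [rankOneIso_iff]
  constructor
  · rintro ⟨n, hn⟩
    obtain ⟨P, hα, hβ⟩ := exists_common_tiling_limitWord (m := n + 1) hn
    exact ⟨P, ⟨_, _, isBlock_letters (stageWord_mem _ _), hα⟩,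
      ⟨_, _, isBlock_letters (stageWord_mem _ _), hβ⟩⟩
  · rintro ⟨P, hα, hβ⟩
    obtain ⟨n, hn⟩ := exists_imp_of_common_base hα hβ
    obtain ⟨n', hn'⟩ := exists_imp_of_common_base hβ hα
    refine ⟨max n n', fun m hm => Bool.eq_iff_iff.2 ⟨hn m (by omega), hn' m (by omega)⟩⟩

end

theorem borelReducible_eventualAgreement_rankOneIso :
    BorelReducible eventualAgreement rankOneIso := by
  refine ⟨limitPoint, ?_, isReduction_limitPoint⟩
  exact continuous_limitPoint.borel_measurable

theorem mainTheorem4 :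
    PolishSpace NondegenerateRankOneWord ∧
    BorelBireducible rankOneIso eventualAgreement ∧
    (∃ f : (ℕ → Bool) → NondegenerateRankOneWord,
      (∀ α m, IsInitialSegment (stageWord α m) (f α).1.word) ∧
      Continuous f ∧ IsReduction eventualAgreement rankOneIso f) ∧
    IsHyperfinite rankOneIso ∧
    IsFSigma {p : NondegenerateRankOneWord × NondegenerateRankOneWord | rankOneIso p.1 p.2} :=
  ⟨polishSpace_nondegenerateRankOneWord,
    ⟨borelReducible_rankOneIso_eventualAgreement, borelReducible_eventualAgreement_rankOneIso⟩,
    ⟨limitPoint, fun _ _ => isInitialSegment_stageWord, continuous_limitPoint,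
      isReduction_limitPoint⟩,
    isHyperfinite_rankOneIso, isFSigma_rankOneIso⟩
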